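/- Let $T,\rho>0$ and $r\in\mathbb R$. Let $a\in W^{1,2}([-T,0])$ with $a\ge 0$ and $a(-T)=0$. Let $f_0:[0,\infty)\times\mathbb R\to\mathbb R$ be jointly concave, Lipschitz continuous and nondecreasing in the second variable, with $f_0(0,y)>0$ for all $y>0$ and $rx+f_0(x,0)\ge 0$ for all $x\ge 0$. Let $U_1:[0,\infty)\to\mathbb R$ be bounded and continuous, $C^2$ on $(0,\infty)$, with $U_1'>0$, $U_1'(0^+)=+\infty$ and $U_1''<0$. For $\eta=(\eta_0,\eta_1)\in H_+:=(0,\infty)\times L^2([-T,0])$, let $\mathcal C(\eta)$ be the set of controls $c\in L^1_{loc}([0,\infty);[0,\infty))$ for which the equation $$x'(t)=rx(t)+f_0\Big(x(t),\int_{-T}^0a(\xi)x(t+\xi)\,d\xi\Big)-c(t),\qquad x(0)=\eta_0,\quad x=\eta_1 \text{ on }[-T,0),$$ understood in integrated form, has a solution $x=x(\cdot;\eta,c)$ that is strictly positive on $[0,\infty)$. For a state utility $U_2$ put $$J(\eta;c)=\int_0^\infty e^{-\rho t}\,[U_1(c(t))+U_2(x(t;\eta,c))]\,dt,\qquad V(\eta)=\sup_{c\in\mathcal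 C(\eta)}J(\eta;c)\quad(\sup\emptyset=-\infty),$$ and $\mathcal D(V)=\{\eta\in H_+ : V(\eta)>-\infty\}$. For $\eta\in\mathcal D(V)$ let $V_{\eta_0}(\eta)$ be the derivative of $V$ in the direction $(1,0)$, and let $C(\eta)=\operatorname{argmax}_{k\ge0}\,(U_1(k)-kV_{\eta_0}(\eta))$. A feedback strategy from $\eta$ is a control $c^*(t)=C\big(x^*(t),x^*(t+\cdot)|_{[-T,0]}\big)$, $t\ge0$, where $x^*$ is a strictly positive solution of the closed loop equation, that is, of the above equation with $c=c^*$. Let $(U_2^n)_{n\ge1}$ be continuous, nondecreasing, concave functions on $(0,\infty)$ with $U_2^n\uparrow0$ as $n\to\infty$, each $U_2^n$ not integrable at $0^+$, and $U_2^n\equiv0$ on $[1/n,\infty)$. Let $J^n,V^n$ be the objective and the value function for $U_2=U_2^n$, and $J^0,V^0$ those for $U_2\equiv0$. Let $\eta\in\mathcal D(V^0)$. Then: 1. $V^n(\eta)\to V^0(\eta)$ as $n\to\infty$. 2. For every $n\ge1$ the $n$-th problem has a feedback strategy $c_n^*$ from $\eta$, and every such $c^*_n$ is optimal: $c_n^*\in\mathcal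 C(\eta)$ and $J^n(\eta;c_n^*)=V^n(\eta)$. 3. For every $\varepsilon>0$ there is $N\ge 1$ such that, for all $n\ge N$, every feedback strategy $c_n^*$ of the $n$-th problem from $\eta$ is $\varepsilon$-optimal for $V^0(\eta)$: $c_n^*\in\mathcal C(\eta)$ and $J^0(\eta;c_n^*)>V^0(\eta)-\varepsilon$. -/

import Mathlib

open MeasureTheory Filter Topology Set

/-- Data of the control problem: the linear rate `r`, the maximal delay `T`, the discount rate `ρ`,
the delay kernel `a` on `[-T, 0]`, the production function `f₀` (used on `[0, ∞) × ℝ`), and the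
utility of consumption `U₁` (used on `[0, ∞)`). -/
structure DelayModel where
  r : ℝ
  T : ℝ
  ρ : ℝ
  a : ℝ → ℝ
  f₀ : ℝ → ℝ → ℝ
  U₁ : ℝ → ℝ

namespace DelayModel

/-- Standing assumptions on the data other than the state utility. -/
structure Standing (M : DelayModel) : Prop where
  T_pos : 0 < M.T
  ρ_pos : 0 < M.ρ
  /-- `a ∈ W^{1,2}([-T,0])` and `a(-T) = 0`: `a` is the primitive, vanishing at `-T`, of a function
  in `L²(-T,0)`. -/
  a_sobolev : ∃ a' : ℝ → ℝ, MemLp a' 2 (volume.restrict (Icc (-M.T) 0)) ∧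
    ∀ ξ ∈ Icc (-M.T) 0, M.a ξ = ∫ s in (-M.T)..ξ, a' s
  a_nonneg : ∀ ξ ∈ Icc (-M.T) 0, 0 ≤ M.a ξ
  f₀_concave : ConcaveOn ℝ (Ici (0 : ℝ) ×ˢ (univ : Set ℝ)) (Function.uncurry M.f₀)
  f₀_mono : ∀ x, 0 ≤ x → Monotone (M.f₀ x)
  f₀_lipschitz : ∃ K, LipschitzOnWith K (Function.uncurry M.f₀) (Ici (0 : ℝ) ×ˢ (univ : Set ℝ))
  f₀_pos : ∀ y, 0 < y → 0 < M.f₀ 0 y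
  /-- Nonnegative net production when the delay term vanishes. -/
  drift_nonneg : ∀ x, 0 ≤ x → 0 ≤ M.r * x + M.f₀ x 0
  U₁_cont : ContinuousOn M.U₁ (Ici 0)
  U₁_contDiff : ContDiffOn ℝ 2 M.U₁ (Ioi 0)
  U₁_deriv_pos : ∀ c, 0 < c → 0 < deriv M.U₁ c
  U₁_deriv_zero : Tendsto (deriv M.U₁) (𝓝[>] 0) atTop
  U₁_deriv2_neg : ∀ c, 0 < c → deriv (deriv M.U₁) c < 0
  U₁_bdd : ∃ B, ∀ c, 0 ≤ c → |M.U₁ c| ≤ B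

/-- The delay term `∫_{-T}^0 a(ξ) x(s+ξ) dξ`. -/
noncomputable def delayTerm (M : DelayModel) (x : ℝ → ℝ) (s : ℝ) : ℝ :=
  ∫ ξ in (-M.T)..0, M.a ξ * x (s + ξ)

/-- The initial state `(η₀, η₁)` belongs to `H₊ = (0,∞) × L²([-T,0])`; elements of `L²` are
represented by functions. -/
def InHPlus (M : DelayModel) (η₀ : ℝ) (η₁ : ℝ → ℝ) : Prop :=
  0 < η₀ ∧ MemLp η₁ 2 (volume.restrict (Icc (-M.T) 0))

/-- `c` is an admissible control for the initial state `(η₀, η₁)` and `x` is the corresponding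
trajectory: `c ∈ L¹_loc([0,∞); ℝ⁺)`, and `x` is the strictly positive solution on `[0,∞)` of
`x'(t) = r x(t) + f₀(x(t), ∫_{-T}^0 a(ξ) x(t+ξ) dξ) - c(t)`, `x(0) = η₀`, `x = η₁` on `[-T,0)`,
in integrated form. (Since `f₀` is Lipschitz, `x` is determined by `η` and `c` on `[-T,∞)`.) -/
structure IsAdmissible (M : DelayModel) (η₀ : ℝ) (η₁ : ℝ → ℝ) (c x : ℝ → ℝ) : Prop where
  control_nonneg : ∀ t, 0 ≤ t → 0 ≤ c t
  control_locInt : LocallyIntegrableOn c (Ici 0)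
  continuousOn : ContinuousOn x (Ici 0)
  history : ∀ s ∈ Ico (-M.T) 0, x s = η₁ s
  equation : ∀ t, 0 ≤ t →
    x t = η₀ + (∫ s in (0 : ℝ)..t, M.r * x s)
      + (∫ s in (0 : ℝ)..t, M.f₀ (x s) (M.delayTerm x s)) - ∫ s in (0 : ℝ)..t, c s
  pos : ∀ t, 0 ≤ t → 0 < x t

/-- The objective `J = ∫_0^∞ e^{-ρt} [U₁(c(t)) + U₂(x(t))] dt ∈ [-∞, ∞)`, as the integral of the
positive part minus the integral of the negative part (the former is finite when `U₁`, `U₂` are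
bounded from above). -/
noncomputable def payoff (M : DelayModel) (U₂ : ℝ → ℝ) (c x : ℝ → ℝ) : EReal :=
  ((∫⁻ t in Ioi (0 : ℝ),
      ENNReal.ofReal (Real.exp (-M.ρ * t) * (M.U₁ (c t) + U₂ (x t))) : ENNReal) : EReal)
  - ((∫⁻ t in Ioi (0 : ℝ),
      ENNReal.ofReal (-(Real.exp (-M.ρ * t) * (M.U₁ (c t) + U₂ (x t)))) : ENNReal) : EReal)

/-- The value function `V(η) = sup J` over the admissible controls, with `sup ∅ = -∞`. -/
noncomputable def value (M : DelayModel) (U₂ : ℝ → ℝ) (η₀ : ℝ) (η₁ : ℝ → ℝ) : EReal :=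
  ⨆ (c : ℝ → ℝ) (x : ℝ → ℝ) (_ : M.IsAdmissible η₀ η₁ c x), M.payoff U₂ c x

/-- `η ∈ 𝒟(V) = {η ∈ H₊ | V(η) > -∞}`. -/
def InDomain (M : DelayModel) (U₂ : ℝ → ℝ) (η₀ : ℝ) (η₁ : ℝ → ℝ) : Prop :=
  M.InHPlus η₀ η₁ ∧ ⊥ < M.value U₂ η₀ η₁

/-- `c` is optimal for the initial state `η`, with trajectory `x`. -/
def IsOptimal (M : DelayModel) (U₂ : ℝ → ℝ) (η₀ : ℝ) (η₁ : ℝ → ℝ) (c x : ℝ → ℝ) : Prop :=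
  M.IsAdmissible η₀ η₁ c x ∧ M.payoff U₂ c x = M.value U₂ η₀ η₁

/-- `c` is `ε`-optimal for the initial state `η`, with trajectory `x`:
it is admissible and `J(η; c) > V(η) - ε`. -/
def IsEpsOptimal (M : DelayModel) (U₂ : ℝ → ℝ) (η₀ : ℝ) (η₁ : ℝ → ℝ) (ε : ℝ) (c x : ℝ → ℝ) : Prop :=
  M.IsAdmissible η₀ η₁ c x ∧ M.value U₂ η₀ η₁ - (ε : EReal) < M.payoff U₂ c x

/-- `κ` is the value at `η` of the feedback map `C(η) = argmax_{k ≥ 0} (U₁(k) - k V_{η₀}(η))`,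
`η ∈ 𝒟(V)`, where `V_{η₀}(η)` is the derivative of `V` in the direction `(1,0)`. -/
def IsFeedbackValue (M : DelayModel) (U₂ : ℝ → ℝ) (η₀ : ℝ) (η₁ : ℝ → ℝ) (κ : ℝ) : Prop :=
  M.InDomain U₂ η₀ η₁ ∧
  ∃ p : ℝ, HasDerivAt (fun s => (M.value U₂ s η₁).toReal) p η₀ ∧
    0 ≤ κ ∧ ∀ k, 0 ≤ k → M.U₁ k - k * p ≤ M.U₁ κ - κ * p

/-- `x` is a strictly positive solution of the closed loop equation
`x'(t) = r x(t) + f₀(x(t), ∫_{-T}^0 a(ξ) x(t+ξ) dξ) - C(x(t), x(t+·)|_{[-T,0]})` with initial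
state `η`, and `c(t) = C(x(t), x(t+·)|_{[-T,0]})` is the associated feedback strategy. -/
def IsFeedbackStrategy (M : DelayModel) (U₂ : ℝ → ℝ) (η₀ : ℝ) (η₁ : ℝ → ℝ) (c x : ℝ → ℝ) : Prop :=
  M.IsAdmissible η₀ η₁ c x ∧
  ∀ t, 0 ≤ t → M.IsFeedbackValue U₂ (x t) (fun ξ => x (t + ξ)) (c t)

end DelayModel

/-- Assumptions on the state utilities `U₂ⁿ`, `n ≥ 1`: each is a continuous, nondecreasing, concave
function on `(0,∞)`, not integrable at `0⁺` and vanishing on `[1/n,∞)`, and the sequence is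
nondecreasing in `n` (so that `U₂ⁿ ↑ 0` pointwise on `(0,∞)`). -/
structure StateUtilities (U₂ : ℕ → ℝ → ℝ) : Prop where
  cont : ∀ n, 1 ≤ n → ContinuousOn (U₂ n) (Ioi 0)
  mono : ∀ n, 1 ≤ n → MonotoneOn (U₂ n) (Ioi 0)
  concave : ∀ n, 1 ≤ n → ConcaveOn ℝ (Ioi 0) (U₂ n)
  increasing : ∀ m n, 1 ≤ m → m ≤ n → ∀ x, 0 < x → U₂ m x ≤ U₂ n x
  not_integrable : ∀ n, 1 ≤ n → ¬ IntegrableAtFilter (U₂ n) (𝓝[>] 0) volume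
  vanish : ∀ n : ℕ, 1 ≤ n → ∀ x : ℝ, 1 / (n : ℝ) ≤ x → U₂ n x = 0

/-! Everything is carried by the `n`-th problem, whose state utility is concave, nonpositive and not
integrable at zero. Its value function is concave in the state, because the drift is concave and any
surplus production can be consumed (`IsPlan.mix`, `vf_concave`). No Hamilton-Jacobi-Bellman equation
is solved; the regularity needed at a state is read off an optimal plan from that state.

Existence (`Feas.exists_isOpt`). The drift is bounded above on bounded time intervals, so a
trajectory that comes close to zero needs time to leave, and the nonintegrable utility makes this
arbitrarily costly. Hence plans with payoff bounded below stay uniformly away from zero on bounded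
intervals (`exists_lower_bound`). A parallelogram argument produces a maximizing sequence that
converges almost everywhere. Consumption may lose mass in the limit, so the limit trajectory is only
a subsolution of the state equation; after a linear shift the right-hand side is monotone in the
state, and monotone iteration gives a genuine trajectory above it with the same control and at least
the same payoff.

Regularity. Infinite marginal utility at zero forces optimal consumption to be bounded below on
bounded intervals (`IsOpt.exists_consumption_lower_bound`). A nearby initial state can then be
merged into the optimal trajectory over a short time `δ`, which bounds the nearby value from below,
to first order, by a linear function of the change of capital, with slope the mean marginal utility
on `[0, δ]`. Concavity makes the bound two-sided. Thus the value is differentiable in the initial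
capital, the derivative is the limit of these means, and the error in the history is controlled in
`L¹` (`IsOpt.exists_expansion`).

Feedback strategies are therefore plans with `U₁'(c(t))` equal to the marginal value of capital at
every `t` (`IsMarginalPlan`). An optimal plan becomes one after changing its control on a null set,
by Lebesgue differentiation; this gives existence. Conversely a marginal plan is optimal: from each
state it visits, an optimal marginal plan starts with the same consumption. Both controls are
continuous at the initial time from the right, so the two plans differ by `o(h)` on a time step `h`,
and accumulated gain plus discounted value does not decrease along the marginal plan
(`IsMarginalPlan.eventually_vf_le`, `IsMarginalPlan.isOpt`).

Limit in `n`. Since the state utilities are nonpositive, `Vⁿ ≤ V⁰`. An almost optimal plan for the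
problem without state utility, mixed with a little of a plan bounded away from zero, stays above
some `μ > 0`; its payoff is the same in both problems once `1/n ≤ μ`. Hence `Vⁿ → V⁰`, and a
feedback strategy `c` of the `n`-th problem satisfies `J⁰(c) ≥ Jⁿ(c) = Vⁿ > V⁰ - ε` for large `n`.
-/

theorem tendsto_integral_abs_translate_sub {g : ℝ → ℝ} (hg : Integrable g) :
    Tendsto (fun s => ∫ u, |g (u + s) - g u|) (𝓝 0) (𝓝 0) := by
  let G : ℝ → C(ℝ, ℝ) := fun s => ⟨fun u => u + s, by fun_prop⟩
  have hG : Continuous G :=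
    ContinuousMap.continuous_of_continuous_uncurry _ (by simp [G, Function.uncurry_def]; fun_prop)
  have hmp : ∀ s, MeasurePreserving (G s) volume volume := fun s =>
    measurePreserving_add_right volume s
  have : Fact ((1 : ENNReal) ≤ 1) := ⟨le_rfl⟩
  have h := Filter.Tendsto.compMeasurePreservingLp (μ := volume) (ν := volume) (p := 1) (E := ℝ)
    (tendsto_const_nhds (x := hg.toL1 g) (f := 𝓝 (0 : ℝ))) (hG.tendsto 0) hmp (hmp 0) (by simp)
  have h2 := (h.sub_const (Lp.compMeasurePreserving (⇑(G 0)) (hmp 0) (hg.toL1 g))).norm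
  simp only [sub_self, norm_zero] at h2
  refine h2.congr fun s => ?_
  rw [L1.norm_eq_integral_norm]
  refine integral_congr_ae ?_
  have e : ∀ s, (Lp.compMeasurePreserving (⇑(G s)) (hmp s) (hg.toL1 g) : ℝ → ℝ)
      =ᵐ[volume] fun u => g (u + s) := by
    intro s
    refine (Lp.coeFn_compMeasurePreserving _ (hmp s)).trans ?_
    exact (hmp s).quasiMeasurePreserving.ae_eq_comp (hg.coeFn_toL1)
  filter_upwards [Lp.coeFn_sub (Lp.compMeasurePreserving (⇑(G s)) (hmp s) (hg.toL1 g))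
    (Lp.compMeasurePreserving (⇑(G 0)) (hmp 0) (hg.toL1 g)), e s, e 0] with u h1 h2 h3
  rw [h1, Pi.sub_apply, h2, h3, add_zero, Real.norm_eq_abs]

theorem integral_sub_le_integral_of_abs_le {f g : ℝ → ℝ} {a b : ℝ} (hab : a ≤ b)
    (hf : IntervalIntegrable f volume a b) (hg : IntervalIntegrable g volume a b)
    (h : ∀ s ∈ Icc a b, |f s| ≤ g s) : |∫ s in a..b, f s| ≤ ∫ s in a..b, g s :=
  (intervalIntegral.abs_integral_le_integral_abs hab).trans
    (intervalIntegral.integral_mono_on hab hf.abs hg h)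

/-! ### Delay term and drift along locally integrable trajectories -/

namespace DelayModel

variable {M : DelayModel}

/-- Local integrability of a trajectory on `[-T, ∞)`. -/
def LocInt (M : DelayModel) (x : ℝ → ℝ) : Prop :=
  ∀ t, 0 ≤ t → IntervalIntegrable x volume (-M.T) t

theorem LocInt.sub {x y : ℝ → ℝ} (hx : M.LocInt x) (hy : M.LocInt y) :
    M.LocInt (fun u => x u - y u) := fun t ht => (hx t ht).sub (hy t ht)

theorem LocInt.mono_interval {x : ℝ → ℝ} (hT : 0 < M.T) (hx : M.LocInt x) {a b : ℝ}
    (ha : -M.T ≤ a) (hab : a ≤ b) : IntervalIntegrable x volume a b := by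
  refine (hx (max b 0) (le_max_right _ _)).mono_set ?_
  rw [uIcc_of_le hab, uIcc_of_le (by linarith [le_max_right b 0])]
  exact Icc_subset_Icc ha (le_max_left _ _)

theorem LocInt.of_continuousOn {x : ℝ → ℝ} (h1 : IntervalIntegrable x volume (-M.T) 0)
    (h2 : ContinuousOn x (Ici 0)) : M.LocInt x := fun t ht =>
  h1.trans (ContinuousOn.intervalIntegrable (h2.mono (by
    rw [uIcc_of_le ht]; exact Icc_subset_Ici_self)))

theorem LocInt.shift {x : ℝ → ℝ} (hT : 0 < M.T) (hx : M.LocInt x) {t : ℝ} (ht : 0 ≤ t) :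
    M.LocInt (fun u => x (t + u)) := by
  intro s hs
  have h := hx.mono_interval hT (a := -M.T + t) (b := s + t) (by linarith) (by linarith)
  have h3 := h.comp_add_right t
  simp only [add_sub_cancel_right] at h3
  simpa [add_comm] using h3

/-- This is continuity of translations in `L¹`. The filter describes approach to `s₀` within `[0,
∞)`: from the right, and from the left without passing below zero. -/
theorem tendsto_history_sub {x : ℝ → ℝ} (hT : 0 < M.T) (hx : M.LocInt x) {s₀ : ℝ} (hs₀ : 0 ≤ s₀) :
    Tendsto (fun s => ∫ ξ in (-M.T)..0, |x (s + ξ) - x (s₀ + ξ)|) (𝓝[≥] s₀ ⊔ 𝓝[Icc 0 s₀] s₀)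
      (𝓝 0) := by
  -- The cutoff makes the trajectory integrable on the line and is invisible to all history windows
  -- at times in `[0, s₀ + 1]`.
  set g : ℝ → ℝ := (Ioc (-M.T) (s₀ + 1)).indicator x with hgdef
  have hg : Integrable g := by
    have := (hx (s₀ + 1) (by linarith)).1
    exact this.integrable_indicator measurableSet_Ioc
  have h := tendsto_integral_abs_translate_sub hg
  have h1 : Tendsto (fun s : ℝ => s - s₀) (𝓝 s₀) (𝓝 0) := by
    have : Continuous (fun s : ℝ => s - s₀) := by fun_prop
    simpa using this.tendsto s₀
  have h2 := (h.comp h1).mono_left (sup_le (nhdsWithin_le_nhds (s := Ici s₀))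
    (nhdsWithin_le_nhds (s := Icc 0 s₀)))
  have hmem : ∀ᶠ s in (𝓝[≥] s₀ ⊔ 𝓝[Icc 0 s₀] s₀), 0 ≤ s ∧ s ≤ s₀ + 1 := by
    rw [eventually_sup]
    constructor
    · have : Ico s₀ (s₀ + 1) ∈ 𝓝[≥] s₀ := Ico_mem_nhdsGE (by linarith)
      filter_upwards [this] with s hs using ⟨hs₀.trans hs.1, hs.2.le⟩
    · filter_upwards [self_mem_nhdsWithin] with s hs using ⟨hs.1, by linarith [hs.2]⟩
  refine squeeze_zero' ?_ ?_ h2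
  · exact Eventually.of_forall fun s => intervalIntegral.integral_nonneg (by linarith)
      fun _ _ => abs_nonneg _
  · filter_upwards [hmem] with s hs
    have e1 : ∫ ξ in (-M.T)..0, |x (s + ξ) - x (s₀ + ξ)|
        = ∫ ξ in Ioc (-M.T) 0, |g (s + ξ) - g (s₀ + ξ)| := by
      rw [intervalIntegral.integral_of_le (by linarith)]
      refine setIntegral_congr_fun measurableSet_Ioc fun ξ hξ => ?_
      have m1 : s + ξ ∈ Ioc (-M.T) (s₀ + 1) := ⟨by linarith [hξ.1, hs.1], by linarith [hξ.2, hs.2]⟩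
      have m2 : s₀ + ξ ∈ Ioc (-M.T) (s₀ + 1) := ⟨by linarith [hξ.1, hs.1], by linarith [hξ.2, hs.2]⟩
      simp [hgdef, indicator_of_mem m1, indicator_of_mem m2]
    have e2 : ∫ u, |g (u + (s - s₀)) - g u| = ∫ ξ, |g (s + ξ) - g (s₀ + ξ)| := by
      rw [← integral_add_left_eq_self (fun u => |g (u + (s - s₀)) - g u|) s₀]
      congr 1; ext ξ; congr 3; ring
    rw [e1]
    simp only [Function.comp_apply]
    rw [e2]
    refine setIntegral_le_integral ?_ (Eventually.of_forall fun _ => abs_nonneg _)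
    exact ((hg.comp_add_left s).sub (hg.comp_add_left s₀)).abs

theorem Standing.kernel_continuousOn (hM : M.Standing) : ContinuousOn M.a (Icc (-M.T) 0) := by
  obtain ⟨a', ha', h⟩ := hM.a_sobolev
  have hi : IntegrableOn a' (Icc (-M.T) 0) := ha'.integrable (by norm_num)
  have := intervalIntegral.continuousOn_primitive_interval (μ := volume) (f := a') (a := -M.T)
    (b := 0) (by rwa [uIcc_of_le (by linarith [hM.T_pos])])
  rw [uIcc_of_le (by linarith [hM.T_pos])] at this
  exact this.congr h

theorem Standing.exists_kernel_bound (hM : M.Standing) :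
    ∃ A, 0 ≤ A ∧ ∀ ξ ∈ Icc (-M.T) 0, |M.a ξ| ≤ A := by
  obtain ⟨A, hA⟩ := isCompact_Icc.exists_bound_of_continuousOn hM.kernel_continuousOn
  exact ⟨max A 0, le_max_right _ _, fun ξ hξ => (hA ξ hξ).trans (le_max_left _ _)⟩

theorem Standing.exists_lipschitz (hM : M.Standing) :
    ∃ K, 0 ≤ K ∧ ∀ x x' y y' : ℝ, 0 ≤ x → 0 ≤ x' →
      |M.f₀ x y - M.f₀ x' y'| ≤ K * (|x - x'| + |y - y'|) := by
  obtain ⟨K, hK⟩ := hM.f₀_lipschitz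
  refine ⟨K, K.2, fun x x' y y' hx hx' => ?_⟩
  have := hK.dist_le_mul (x, y) ⟨hx, mem_univ _⟩ (x', y') ⟨hx', mem_univ _⟩
  rw [Real.dist_eq] at this
  refine this.trans (mul_le_mul_of_nonneg_left ?_ K.2)
  rw [Prod.dist_eq, Real.dist_eq, Real.dist_eq]
  exact max_le (by linarith [abs_nonneg (y - y')]) (by linarith [abs_nonneg (x - x')])

theorem delay_intervalIntegrable (hM : M.Standing) {x : ℝ → ℝ} (hx : M.LocInt x) {s : ℝ}
    (hs : 0 ≤ s) : IntervalIntegrable (fun ξ => M.a ξ * x (s + ξ)) volume (-M.T) 0 := by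
  have h := (hx.shift hM.T_pos hs) 0 le_rfl
  refine h.continuousOn_mul ?_
  rw [uIcc_of_le (by linarith [hM.T_pos])]
  exact hM.kernel_continuousOn

theorem abs_delayTerm_sub_le (hM : M.Standing) {A : ℝ} (hA : ∀ ξ ∈ Icc (-M.T) 0, |M.a ξ| ≤ A)
    {x y : ℝ → ℝ} (hx : M.LocInt x) (hy : M.LocInt y) {s t : ℝ} (hs : 0 ≤ s) (ht : 0 ≤ t) :
    |M.delayTerm x s - M.delayTerm y t| ≤ A * ∫ ξ in (-M.T)..0, |x (s + ξ) - y (t + ξ)| := by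
  unfold delayTerm
  rw [← intervalIntegral.integral_sub (delay_intervalIntegrable hM hx hs)
    (delay_intervalIntegrable hM hy ht), ← intervalIntegral.integral_const_mul]
  refine integral_sub_le_integral_of_abs_le (by linarith [hM.T_pos])
    ((delay_intervalIntegrable hM hx hs).sub (delay_intervalIntegrable hM hy ht)) ?_ ?_
  · exact ((((hx.shift hM.T_pos hs) 0 le_rfl).sub ((hy.shift hM.T_pos ht) 0 le_rfl)).abs).const_mul A
  · intro ξ hξ
    rw [← mul_sub, abs_mul]
    exact mul_le_mul_of_nonneg_right (hA ξ hξ) (abs_nonneg _)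

theorem delayTerm_mono (hM : M.Standing) {x y : ℝ → ℝ} (hx : M.LocInt x) (hy : M.LocInt y) {s : ℝ}
    (hs : 0 ≤ s) (h : ∀ᵐ u, u ∈ Icc (-M.T) s → x u ≤ y u) :
    M.delayTerm x s ≤ M.delayTerm y s := by
  unfold delayTerm
  refine intervalIntegral.integral_mono_ae_restrict (by linarith [hM.T_pos])
    (delay_intervalIntegrable hM hx hs) (delay_intervalIntegrable hM hy hs) ?_
  have h2 := (measurePreserving_add_left volume s).quasiMeasurePreserving.ae h
  refine (ae_restrict_iff' measurableSet_Icc).2 ?_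
  filter_upwards [h2] with ξ hξ hm
  exact mul_le_mul_of_nonneg_left (hξ ⟨by linarith [hm.1], by linarith [hm.2]⟩) (hM.a_nonneg ξ hm)

theorem delayTerm_congr_ae (hM : M.Standing) {x y : ℝ → ℝ} {s : ℝ}
    (h : ∀ᵐ u, u ∈ Ioo (s - M.T) s → x u = y u) : M.delayTerm x s = M.delayTerm y s := by
  unfold delayTerm
  refine intervalIntegral.integral_congr_ae ?_
  have h2 := (measurePreserving_add_left volume s).quasiMeasurePreserving.ae h
  have h3 : ∀ᵐ u : ℝ, u ≠ 0 := by simp [ae_iff]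
  filter_upwards [h2, h3] with ξ hξ h0 hm
  rw [uIoc_of_le (by linarith [hM.T_pos])] at hm
  rw [hξ ⟨by linarith [hm.1], by linarith [lt_of_le_of_ne hm.2 h0]⟩]

theorem delayTerm_shift (x : ℝ → ℝ) (t s : ℝ) :
    M.delayTerm (fun u => x (t + u)) s = M.delayTerm x (t + s) := by
  simp [delayTerm, add_assoc]

theorem delayTerm_nonneg (hM : M.Standing) {x : ℝ → ℝ} {s : ℝ}
    (h : ∀ u ∈ Icc (s - M.T) s, 0 ≤ x u) : 0 ≤ M.delayTerm x s :=
  intervalIntegral.integral_nonneg (by linarith [hM.T_pos]) fun ξ hξ =>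
    mul_nonneg (hM.a_nonneg ξ hξ) (h _ ⟨by linarith [hξ.1], by linarith [hξ.2]⟩)

theorem delayTerm_add_smul (hM : M.Standing) {x y : ℝ → ℝ} (hx : M.LocInt x) (hy : M.LocInt y)
    (k l : ℝ) {s : ℝ} (hs : 0 ≤ s) :
    M.delayTerm (fun u => k * x u + l * y u) s = k * M.delayTerm x s + l * M.delayTerm y s := by
  unfold delayTerm
  rw [← intervalIntegral.integral_const_mul, ← intervalIntegral.integral_const_mul,
    ← intervalIntegral.integral_add ((delay_intervalIntegrable hM hx hs).const_mul k)
    ((delay_intervalIntegrable hM hy hs).const_mul l)]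
  congr 1; ext ξ; ring

/-- The kernel is bounded, so the delay term inherits the `L¹` continuity of the history, even where
the trajectory itself is not continuous. -/
theorem delayTerm_continuousOn (hM : M.Standing) {x : ℝ → ℝ} (hx : M.LocInt x) :
    ContinuousOn (M.delayTerm x) (Ici 0) := by
  obtain ⟨A, hA0, hA⟩ := hM.exists_kernel_bound
  intro s₀ hs₀
  have h := (tendsto_history_sub hM.T_pos hx hs₀).const_mul A
  rw [mul_zero] at h
  have hle : 𝓝[Ici 0] s₀ ≤ 𝓝[≥] s₀ ⊔ 𝓝[Icc 0 s₀] s₀ := by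
    rw [← nhdsWithin_union]
    refine nhdsWithin_mono _ fun u hu => ?_
    rcases le_total s₀ u with h | h
    · exact Or.inl h
    · exact Or.inr ⟨hu, h⟩
  rw [ContinuousWithinAt, tendsto_iff_dist_tendsto_zero]
  refine squeeze_zero' (Eventually.of_forall fun _ => dist_nonneg) ?_ (h.mono_left hle)
  filter_upwards [self_mem_nhdsWithin] with s hs
  rw [Real.dist_eq]
  exact abs_delayTerm_sub_le hM hA hx hx hs hs₀

/-- The right-hand side of the uncontrolled state equation along a trajectory. -/
noncomputable def drift (M : DelayModel) (x : ℝ → ℝ) (s : ℝ) : ℝ :=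
  M.r * x s + M.f₀ (x s) (M.delayTerm x s)

theorem f₀_continuousOn (hM : M.Standing) :
    ContinuousOn (Function.uncurry M.f₀) (Ici (0 : ℝ) ×ˢ (univ : Set ℝ)) := by
  obtain ⟨K, hK⟩ := hM.f₀_lipschitz
  exact hK.continuousOn

theorem drift_continuousOn (hM : M.Standing) {x : ℝ → ℝ} (hx : M.LocInt x)
    (hc : ContinuousOn x (Ici 0)) (hp : ∀ t, 0 ≤ t → 0 ≤ x t) :
    ContinuousOn (M.drift x) (Ici 0) := by
  refine (continuousOn_const.mul hc).add ?_
  exact (f₀_continuousOn hM).comp (hc.prodMk (delayTerm_continuousOn hM hx))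
    fun t ht => ⟨hp t ht, mem_univ _⟩

theorem drift_intervalIntegrable (hM : M.Standing) {x : ℝ → ℝ} (hx : M.LocInt x)
    (hc : ContinuousOn x (Ici 0)) (hp : ∀ t, 0 ≤ t → 0 ≤ x t) {a b : ℝ} (ha : 0 ≤ a) (hb : 0 ≤ b) :
    IntervalIntegrable (M.drift x) volume a b :=
  ContinuousOn.intervalIntegrable ((drift_continuousOn hM hx hc hp).mono
    fun _ ht => (le_min ha hb).trans ht.1)

theorem drift_shift (x : ℝ → ℝ) (t s : ℝ) :
    M.drift (fun u => x (t + u)) s = M.drift x (t + s) := by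
  simp [drift, delayTerm_shift]

theorem drift_congr_ae (hM : M.Standing) {x y : ℝ → ℝ} {s : ℝ} (h0 : x s = y s)
    (h : ∀ᵐ u, u ∈ Ioo (s - M.T) s → x u = y u) : M.drift x s = M.drift y s := by
  simp [drift, h0, delayTerm_congr_ae hM h]

/-- Concavity of the drift. -/
theorem drift_concave (hM : M.Standing) {x y : ℝ → ℝ} (hx : M.LocInt x) (hy : M.LocInt y)
    {k l : ℝ} (hk : 0 ≤ k) (hl : 0 ≤ l) (hkl : k + l = 1) {s : ℝ} (hs : 0 ≤ s)
    (hxs : 0 ≤ x s) (hys : 0 ≤ y s) :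
    k * M.drift x s + l * M.drift y s ≤ M.drift (fun u => k * x u + l * y u) s := by
  have h := hM.f₀_concave.2 (x := (x s, M.delayTerm x s)) ⟨hxs, mem_univ _⟩
    (y := (y s, M.delayTerm y s)) ⟨hys, mem_univ _⟩ hk hl hkl
  simp only [Function.uncurry, smul_eq_mul, Prod.smul_mk, Prod.mk_add_mk] at h
  simp only [drift, delayTerm_add_smul hM hx hy k l hs]
  linarith

theorem abs_drift_sub_le (hM : M.Standing) {A K : ℝ} (hA : ∀ ξ ∈ Icc (-M.T) 0, |M.a ξ| ≤ A)
    (hK0 : 0 ≤ K) (hK : ∀ x x' y y' : ℝ, 0 ≤ x → 0 ≤ x' →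
      |M.f₀ x y - M.f₀ x' y'| ≤ K * (|x - x'| + |y - y'|))
    {x y : ℝ → ℝ} (hx : M.LocInt x) (hy : M.LocInt y) {s : ℝ} (hs : 0 ≤ s)
    (hxs : 0 ≤ x s) (hys : 0 ≤ y s) :
    |M.drift x s - M.drift y s| ≤
      (|M.r| + K) * |x s - y s| + K * A * ∫ ξ in (-M.T)..0, |x (s + ξ) - y (s + ξ)| := by
  have h1 := hK (x s) (y s) (M.delayTerm x s) (M.delayTerm y s) hxs hys
  have h2 := abs_delayTerm_sub_le hM hA hx hy hs hs
  have h3 : |M.r * x s - M.r * y s| = |M.r| * |x s - y s| := by rw [← mul_sub, abs_mul]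
  have h4 := mul_le_mul_of_nonneg_left h2 hK0
  have h5 : M.drift x s - M.drift y s = (M.r * x s - M.r * y s) +
      (M.f₀ (x s) (M.delayTerm x s) - M.f₀ (y s) (M.delayTerm y s)) := by simp [drift]; ring
  rw [h5]
  refine (abs_add_le _ _).trans ?_
  rw [h3]
  linarith

/-! ### Plans: shifting, perturbing, mixing, concatenating, freezing -/

/-- A control `c` together with a strictly positive trajectory `x`, whose restriction to `[-T, 0]`
is the initial state. -/
structure IsPlan (M : DelayModel) (c x : ℝ → ℝ) : Prop where
  nonneg : ∀ t, 0 ≤ t → 0 ≤ c t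
  ctrl : ∀ t, 0 ≤ t → IntervalIntegrable c volume 0 t
  cont : ContinuousOn x (Ici 0)
  hist : IntervalIntegrable x volume (-M.T) 0
  pos : ∀ t, 0 ≤ t → 0 < x t
  eqn : ∀ t, 0 ≤ t → x t = x 0 + ∫ s in (0 : ℝ)..t, (M.drift x s - c s)

theorem IsPlan.locInt {c x : ℝ → ℝ} (h : M.IsPlan c x) : M.LocInt x :=
  LocInt.of_continuousOn h.hist h.cont

theorem IsPlan.ctrl' {c x : ℝ → ℝ} (h : M.IsPlan c x) {a b : ℝ} (ha : 0 ≤ a) (hb : 0 ≤ b) :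
    IntervalIntegrable c volume a b := (h.ctrl a ha).symm.trans (h.ctrl b hb)

theorem IsPlan.drift_cont (hM : M.Standing) {c x : ℝ → ℝ} (h : M.IsPlan c x) :
    ContinuousOn (M.drift x) (Ici 0) :=
  drift_continuousOn hM h.locInt h.cont fun t ht => (h.pos t ht).le

theorem IsPlan.drift_int (hM : M.Standing) {c x : ℝ → ℝ} (h : M.IsPlan c x) {a b : ℝ}
    (ha : 0 ≤ a) (hb : 0 ≤ b) : IntervalIntegrable (M.drift x) volume a b :=
  drift_intervalIntegrable hM h.locInt h.cont (fun t ht => (h.pos t ht).le) ha hb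

theorem IsPlan.rate_int (hM : M.Standing) {c x : ℝ → ℝ} (h : M.IsPlan c x) {a b : ℝ}
    (ha : 0 ≤ a) (hb : 0 ≤ b) : IntervalIntegrable (fun s => M.drift x s - c s) volume a b :=
  (h.drift_int hM ha hb).sub (h.ctrl' ha hb)

theorem IsPlan.sub_eq (hM : M.Standing) {c x : ℝ → ℝ} (h : M.IsPlan c x) {a b : ℝ}
    (ha : 0 ≤ a) (hb : 0 ≤ b) : x b - x a = ∫ s in a..b, (M.drift x s - c s) := by
  rw [h.eqn b hb, h.eqn a ha, ← intervalIntegral.integral_add_adjacent_intervals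
    (h.rate_int hM le_rfl ha) (h.rate_int hM ha hb)]
  ring

/-- Plans do not mention the initial data: a state is the restriction of a trajectory to `[-T, 0]`,
which makes time shifts harmless. The value at `0` must be recorded apart from the history on `[-T,
0)`; it comes from the equation at `t = 0`. -/
theorem isAdmissible_iff (hM : M.Standing) {η₀ : ℝ} {η₁ c x : ℝ → ℝ}
    (hη : IntervalIntegrable η₁ volume (-M.T) 0) :
    M.IsAdmissible η₀ η₁ c x ↔ M.IsPlan c x ∧ x 0 = η₀ ∧ EqOn x η₁ (Ico (-M.T) 0) := by
  have hT := hM.T_pos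
  have hloc : ∀ c : ℝ → ℝ, LocallyIntegrableOn c (Ici 0) ↔
      ∀ t, 0 ≤ t → IntervalIntegrable c volume 0 t := by
    intro c
    rw [locallyIntegrableOn_iff isClosed_Ici.isLocallyClosed]
    constructor
    · intro h t ht
      exact (intervalIntegrable_iff_integrableOn_Icc_of_le ht).2
        (h _ Icc_subset_Ici_self isCompact_Icc)
    · intro h k hk hkc
      obtain ⟨b, hb⟩ := hkc.bddAbove
      have := (intervalIntegrable_iff_integrableOn_Icc_of_le (le_max_right b 0)).1
        (h (max b 0) (le_max_right _ _))
      exact this.mono_set fun u hu => ⟨hk hu, (hb hu).trans (le_max_left _ _)⟩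
  constructor
  · intro h
    have hh : IntervalIntegrable x volume (-M.T) 0 := by
      rw [intervalIntegrable_iff_integrableOn_Ico_of_le (by linarith)] at hη ⊢
      exact hη.congr_fun (fun s hs => (h.history s hs).symm) measurableSet_Ico
    have hx0 : x 0 = η₀ := by simpa using h.equation 0 le_rfl
    have hl : M.LocInt x := LocInt.of_continuousOn hh h.continuousOn
    have hd := fun t (ht : 0 ≤ t) => drift_intervalIntegrable hM hl h.continuousOn
      (fun t ht => (h.pos t ht).le) le_rfl ht
    refine ⟨⟨h.control_nonneg, (hloc c).1 h.control_locInt, h.continuousOn, hh, h.pos, ?_⟩, hx0,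
      h.history⟩
    intro t ht
    have hr : IntervalIntegrable (fun s => M.r * x s) volume 0 t :=
      (hl.mono_interval hT (by linarith) ht).const_mul _
    have hf : IntervalIntegrable (fun s => M.f₀ (x s) (M.delayTerm x s)) volume 0 t := by
      have := (hd t ht).sub hr
      refine this.congr (fun s _ => ?_)
      simp [drift]
    rw [intervalIntegral.integral_sub (hd t ht) ((hloc c).1 h.control_locInt t ht), h.equation t ht,
      hx0]
    simp only [drift]
    rw [intervalIntegral.integral_add hr hf]
    ring
  · rintro ⟨h, h0, hh⟩
    refine ⟨h.nonneg, (hloc c).2 h.ctrl, h.cont, hh, ?_, h.pos⟩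
    intro t ht
    have hr : IntervalIntegrable (fun s => M.r * x s) volume 0 t :=
      (h.locInt.mono_interval hT (by linarith) ht).const_mul _
    have hf : IntervalIntegrable (fun s => M.f₀ (x s) (M.delayTerm x s)) volume 0 t := by
      have := (h.drift_int hM le_rfl ht).sub hr
      refine this.congr (fun s _ => ?_)
      simp [drift]
    rw [h.eqn t ht, intervalIntegral.integral_sub (h.drift_int hM le_rfl ht) (h.ctrl t ht), h0]
    simp only [drift]
    rw [intervalIntegral.integral_add hr hf]
    ring

theorem IsPlan.shift (hM : M.Standing) {c x : ℝ → ℝ} (h : M.IsPlan c x) {t : ℝ} (ht : 0 ≤ t) :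
    M.IsPlan (fun s => c (t + s)) (fun s => x (t + s)) := by
  refine ⟨fun s hs => h.nonneg _ (by linarith), fun s hs => ?_, ?_, ?_,
    fun s hs => h.pos _ (by linarith), fun s hs => ?_⟩
  · have := (h.ctrl' ht (add_nonneg hs ht)).comp_add_right t
    simpa [add_comm] using this
  · exact h.cont.comp (by fun_prop) fun s hs => add_nonneg ht hs
  · exact h.locInt.shift hM.T_pos ht 0 le_rfl
  · have := h.sub_eq hM ht (add_nonneg ht hs)
    simp only [drift_shift]
    rw [intervalIntegral.integral_comp_add_left (fun s => M.drift x s - c s) t]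
    simp only [add_zero]
    linarith

/-- A trajectory differing from that of a plan by an absolutely continuous function belongs to a
plan, provided that the required consumption is nonnegative. -/
theorem IsPlan.perturb (hM : M.Standing) {c x y θ : ℝ → ℝ} (h : M.IsPlan c x)
    (hθ : ∀ t, 0 ≤ t → IntervalIntegrable θ volume 0 t)
    (hy : IntervalIntegrable y volume (-M.T) 0) (hyc : ContinuousOn y (Ici 0))
    (hyp : ∀ t, 0 ≤ t → 0 < y t)
    (hyθ : ∀ t, 0 ≤ t → y t = x t + (y 0 - x 0) + ∫ s in (0 : ℝ)..t, θ s)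
    (hc : ∀ᵐ s, 0 ≤ s → θ s ≤ c s + M.drift y s - M.drift x s) :
    M.IsPlan (fun s => max (c s + M.drift y s - M.drift x s - θ s) 0) y := by
  have hl : M.LocInt y := LocInt.of_continuousOn hy hyc
  have hd := fun t (ht : 0 ≤ t) => drift_intervalIntegrable hM hl hyc
      (fun t ht => (hyp t ht).le) le_rfl ht
  have hi := fun t (ht : 0 ≤ t) =>
    (((h.ctrl t ht).add (hd t ht)).sub (h.drift_int hM le_rfl ht)).sub (hθ t ht)
  have hae : ∀ t, 0 ≤ t → ∀ᵐ s, s ∈ uIoc 0 t → c s + M.drift y s - M.drift x s - θ s =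
      max (c s + M.drift y s - M.drift x s - θ s) 0 := by
    intro t ht
    filter_upwards [hc] with s hs hm
    rw [uIoc_of_le ht] at hm
    rw [max_eq_left]
    linarith [hs hm.1.le]
  -- The bound on `θ` holds only almost everywhere. Truncation at zero makes the control nonnegative
  -- at every time and changes it on a null set.
  refine ⟨fun _ _ => le_max_right _ _, fun t ht => ?_, hyc, hy, hyp, fun t ht => ?_⟩
  · refine (hi t ht).congr_ae ?_
    exact (ae_restrict_iff' measurableSet_uIoc).2 (hae t ht)
  · have e : ∫ s in (0 : ℝ)..t, (M.drift y s - max (c s + M.drift y s - M.drift x s - θ s) 0)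
        = ∫ s in (0 : ℝ)..t, ((M.drift x s - c s) + θ s) := by
      refine intervalIntegral.integral_congr_ae ?_
      filter_upwards [hae t ht] with s hs hm
      rw [← hs hm]; ring
    rw [e, intervalIntegral.integral_add (h.rate_int hM le_rfl ht) (hθ t ht), hyθ t ht, h.eqn t ht]
    ring

/-- Free disposal: the convex combination of two trajectories belongs to a plan that consumes at
least the convex combination of the controls. -/
theorem IsPlan.mix (hM : M.Standing) {c x d y : ℝ → ℝ} (h : M.IsPlan c x) (h' : M.IsPlan d y)
    {k l : ℝ} (hk : 0 ≤ k) (hl : 0 ≤ l) (hkl : k + l = 1) :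
    ∃ e : ℝ → ℝ, M.IsPlan e (fun u => k * x u + l * y u) ∧ ∀ t, 0 ≤ t → k * c t + l * d t ≤ e t := by
  set z : ℝ → ℝ := fun u => k * x u + l * y u with hz
  have hzc : ContinuousOn z (Ici 0) :=
    (continuousOn_const.mul h.cont).add (continuousOn_const.mul h'.cont)
  have hzh : IntervalIntegrable z volume (-M.T) 0 := (h.hist.const_mul k).add (h'.hist.const_mul l)
  have hzp : ∀ t, 0 ≤ t → 0 < z t := by
    intro t ht
    have := h.pos t ht
    have := h'.pos t ht
    rcases hk.eq_or_lt with h0 | h0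
    -- The weights are allowed to vanish, so positivity of the mixture needs the degenerate case
    -- separately.
    · have : l = 1 := by linarith
      simp only [hz, ← h0, this]; linarith
    · simp only [hz]; positivity
  have hl' : M.LocInt z := LocInt.of_continuousOn hzh hzc
  have key : ∀ t, 0 ≤ t → k * M.drift x t + l * M.drift y t ≤ M.drift z t := fun t ht =>
    drift_concave hM h.locInt h'.locInt hk hl hkl ht (h.pos t ht).le (h'.pos t ht).le
  have hle : ∀ t, 0 ≤ t → k * c t + l * d t ≤
      k * c t + l * d t + (M.drift z t - (k * M.drift x t + l * M.drift y t)) :=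
    fun t ht => by linarith [key t ht]
  -- The drift at the mixed trajectory exceeds the mixture of the drifts, and the whole surplus is
  -- consumed.
  refine ⟨fun t => k * c t + l * d t + (M.drift z t - (k * M.drift x t + l * M.drift y t)),
    ⟨fun t ht => ?_, fun t ht => ?_, hzc, hzh, hzp, fun t ht => ?_⟩, hle⟩
  · exact (add_nonneg (mul_nonneg hk (h.nonneg t ht)) (mul_nonneg hl (h'.nonneg t ht))).trans
      (hle t ht)
  · exact (((h.ctrl t ht).const_mul k).add ((h'.ctrl t ht).const_mul l)).add
      ((drift_intervalIntegrable hM hl' hzc (fun t ht => (hzp t ht).le) le_rfl ht).sub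
      (((h.drift_int hM le_rfl ht).const_mul k).add ((h'.drift_int hM le_rfl ht).const_mul l)))
  · have e : (fun s => M.drift z s - (k * c s + l * d s +
        (M.drift z s - (k * M.drift x s + l * M.drift y s)))) =
        fun s => k * (M.drift x s - c s) + l * (M.drift y s - d s) := by ext s; ring
    rw [e, intervalIntegral.integral_add ((h.rate_int hM le_rfl ht).const_mul k)
      ((h'.rate_int hM le_rfl ht).const_mul l), intervalIntegral.integral_const_mul,
      intervalIntegral.integral_const_mul]
    simp only [hz]
    rw [h.eqn t ht, h'.eqn t ht]
    ring

/-- The second plan starts from the full state of the first at time `t₀`, history included. So the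
glued trajectory seen from `t₀` coincides with `y` on `[-T, ∞)`, and the drift after the junction is
that of `y`. -/
theorem IsPlan.concat (hM : M.Standing) {c x d y : ℝ → ℝ} (h : M.IsPlan c x) (h' : M.IsPlan d y)
    {t₀ : ℝ} (ht₀ : 0 ≤ t₀) (hxy : EqOn y (fun u => x (t₀ + u)) (Icc (-M.T) 0)) :
    M.IsPlan (fun s => if s < t₀ then c s else d (s - t₀))
      (fun s => if s < t₀ then x s else y (s - t₀)) := by
  have hT := hM.T_pos
  set e : ℝ → ℝ := fun s => if s < t₀ then c s else d (s - t₀) with he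
  set z : ℝ → ℝ := fun s => if s < t₀ then x s else y (s - t₀) with hz
  have hy0 : y 0 = x t₀ := by simpa using hxy ⟨by linarith, le_rfl⟩
  have zl : ∀ s, s ≤ t₀ → z s = x s := by
    intro s hs
    rcases hs.lt_or_eq with h1 | h1
    · simp [hz, h1]
    · simp [hz, h1, hy0]
  have zr : ∀ u, -M.T ≤ u → z (t₀ + u) = y u := by
    intro u hu
    rcases lt_or_ge u 0 with h1 | h1
    · rw [hxy ⟨hu, h1.le⟩, zl _ (by linarith)]
    · simp [hz, h1]
  have el : ∀ s, s < t₀ → e s = c s := fun s hs => by simp [he, hs]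
  have er : ∀ u, 0 ≤ u → e (t₀ + u) = d u := fun u hu => by simp [he, hu]
  have dl : ∀ s, s ≤ t₀ → M.drift z s = M.drift x s := fun s hs =>
    drift_congr_ae hM (zl s hs) (Eventually.of_forall fun u hu => zl u (hu.2.le.trans hs))
  have dr : ∀ u, 0 ≤ u → M.drift z (t₀ + u) = M.drift y u := by
    intro u hu
    rw [← drift_shift]
    exact drift_congr_ae hM (zr u (by linarith)) (Eventually.of_forall fun v hv =>
      zr v (by linarith [hv.1]))
  have il : ∀ t, t ≤ t₀ → ∀ t', t' ≤ t₀ → 0 ≤ t → 0 ≤ t' → IntervalIntegrable e volume t t' := by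
    intro t h1 t' h2 h3 h4
    refine (h.ctrl' h3 h4).congr_ae ?_
    refine (ae_restrict_iff' measurableSet_uIoc).2 ?_
    have h3 : ∀ᵐ u : ℝ, u ≠ t₀ := by simp [ae_iff]
    filter_upwards [h3] with s hs hm
    exact (el s (lt_of_le_of_ne (hm.2.trans (max_le h1 h2)) hs)).symm
  have ir : ∀ t, t₀ ≤ t → IntervalIntegrable e volume t₀ t := by
    intro t ht
    have := (h'.ctrl (t - t₀) (by linarith)).comp_sub_right t₀
    simp only [zero_add, sub_add_cancel] at this
    refine this.congr_uIoo fun s hs => ?_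
    rw [uIoo_of_le ht] at hs
    have := er (s - t₀) (by linarith [hs.1])
    simpa using this.symm
  have hzc : ContinuousOn z (Ici 0) := by
    have e1 : Ici (0 : ℝ) = Icc 0 t₀ ∪ Ici t₀ := (Icc_union_Ici_eq_Ici ht₀).symm
    rw [e1]
    refine ContinuousOn.union_of_isClosed ?_ ?_ isClosed_Icc isClosed_Ici
    · exact (h.cont.mono Icc_subset_Ici_self).congr fun s hs => zl s hs.2
    · have : ContinuousOn (fun s => y (s - t₀)) (Ici t₀) :=
        h'.cont.comp (by fun_prop) fun s hs => mem_Ici.2 (sub_nonneg.2 (mem_Ici.1 hs))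
      refine this.congr fun s hs => ?_
      have := zr (s - t₀) (by linarith [mem_Ici.1 hs])
      simpa using this
  refine ⟨fun t ht => ?_, fun t ht => ?_, hzc, ?_, fun t ht => ?_, fun t ht => ?_⟩
  · simp only [he]
    split_ifs with h1
    · exact h.nonneg t ht
    · exact h'.nonneg _ (by linarith)
  · rcases le_total t t₀ with h1 | h1
    · exact il 0 ht₀ t h1 le_rfl ht
    · exact (il 0 ht₀ t₀ le_rfl le_rfl ht₀).trans (ir t h1)
  · refine h.hist.congr fun s hs => ?_
    rw [uIoc_of_le (by linarith)] at hs
    exact (zl s (hs.2.trans ht₀)).symm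
  · simp only [hz]
    split_ifs with h1
    · exact h.pos t ht
    · exact h'.pos _ (by linarith)
  · have left : ∀ t, 0 ≤ t → t ≤ t₀ → ∫ s in (0 : ℝ)..t, (M.drift z s - e s) =
        ∫ s in (0 : ℝ)..t, (M.drift x s - c s) := by
      intro t ht h1
      refine intervalIntegral.integral_congr_ae ?_
      have h3 : ∀ᵐ u : ℝ, u ≠ t₀ := by simp [ae_iff]
      filter_upwards [h3] with s hs hm
      rw [uIoc_of_le ht] at hm
      rw [dl s (hm.2.trans h1), el s (lt_of_le_of_ne (hm.2.trans h1) hs)]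
    rcases le_total t t₀ with h1 | h1
    · rw [left t ht h1, zl t h1, zl 0 ht₀, h.eqn t ht]
    · have hzd : ∀ a b, 0 ≤ a → 0 ≤ b → IntervalIntegrable (M.drift z) volume a b := by
        intro a b ha hb
        have hzl : M.LocInt z := LocInt.of_continuousOn (h.hist.congr fun s hs => by
          rw [uIoc_of_le (by linarith)] at hs
          exact (zl s (hs.2.trans ht₀)).symm) hzc
        refine drift_intervalIntegrable hM hzl hzc (fun s hs => ?_) ha hb
        simp only [hz]
        split_ifs with h1
        · exact (h.pos _ hs).le
        · exact (h'.pos _ (by linarith)).le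
      rw [← intervalIntegral.integral_add_adjacent_intervals (b := t₀)
        ((hzd _ _ le_rfl ht₀).sub (il 0 ht₀ t₀ le_rfl le_rfl ht₀))
        ((hzd _ _ ht₀ ht).sub (ir t h1)), left t₀ ht₀ le_rfl, zl 0 ht₀]
      have e2 : ∫ s in t₀..t, (M.drift z s - e s) =
          ∫ s in (0 : ℝ)..(t - t₀), (M.drift y s - d s) := by
        have := intervalIntegral.integral_comp_add_left (a := 0) (b := t - t₀)
          (fun s => M.drift z s - e s) t₀
        rw [add_zero, add_sub_cancel] at this
        rw [← this]
        refine intervalIntegral.integral_congr fun s hs => ?_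
        rw [uIcc_of_le (by linarith)] at hs
        simp only [dr s hs.1, er s hs.1]
      have e3 := h'.eqn (t - t₀) (by linarith)
      have e4 := h.eqn t₀ ht₀
      have e5 := zr (t - t₀) (by linarith)
      rw [add_sub_cancel] at e5
      rw [e2, e5]
      linarith

/-- The plan that keeps the state constant, from a nonnegative history. -/
theorem isPlan_freeze (hM : M.Standing) {y : ℝ → ℝ} (hy : IntervalIntegrable y volume (-M.T) 0)
    (hn : ∀ u ∈ Icc (-M.T) 0, 0 ≤ y u) (h0 : 0 < y 0) :
    M.IsPlan (M.drift fun u => if u < 0 then y u else y 0) (fun u => if u < 0 then y u else y 0) := by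
  set z : ℝ → ℝ := fun u => if u < 0 then y u else y 0 with hz
  have hT := hM.T_pos
  have zr : ∀ t, 0 ≤ t → z t = y 0 := fun t ht => by simp [hz, ht]
  have hzc : ContinuousOn z (Ici 0) := continuousOn_const.congr zr
  have hzh : IntervalIntegrable z volume (-M.T) 0 := by
    refine hy.congr_uIoo fun s hs => ?_
    rw [uIoo_of_le (by linarith)] at hs
    simp [hz, hs.2]
  have hzp : ∀ t, 0 ≤ t → 0 < z t := fun t ht => by rwa [zr t ht]
  have hzl := LocInt.of_continuousOn hzh hzc
  have zn : ∀ u, -M.T ≤ u → 0 ≤ z u := by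
    intro u hu
    rcases lt_or_ge u 0 with h1 | h1
    · simpa [hz, h1] using hn u ⟨hu, h1.le⟩
    · exact (hzp u h1).le
  refine ⟨fun t ht => ?_, fun t ht => ?_, hzc, hzh, hzp, fun t ht => ?_⟩
  -- Holding the state constant means consuming the drift. It is nonnegative because a nonnegative
  -- history gives at least the production at zero delay term, where net production is nonnegative.
  · have h1 : 0 ≤ M.delayTerm z t := delayTerm_nonneg hM fun u hu => zn u (by linarith [hu.1])
    have h2 := hM.f₀_mono (z t) (hzp t ht).le h1
    have h3 := hM.drift_nonneg (z t) (hzp t ht).le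
    simp only [drift]
    linarith
  · exact drift_intervalIntegrable hM hzl hzc (fun t ht => (hzp t ht).le) le_rfl ht
  · simp [zr t ht, zr 0 le_rfl]

end DelayModel

/-! ### Payoff, value function and dynamic programming -/

theorem preimage_add_left_Ioi (t : ℝ) : (fun s => t + s) ⁻¹' Ioi t = Ioi (0 : ℝ) := by
  ext s; simp

theorem integrableOn_Ioi_translate {f : ℝ → ℝ} (t : ℝ) :
    IntegrableOn (fun s => f (t + s)) (Ioi 0) ↔ IntegrableOn f (Ioi t) := by
  rw [← preimage_add_left_Ioi t]
  exact (measurePreserving_add_left volume t).integrableOn_comp_preimage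
    (measurableEmbedding_addLeft t) (f := f)

theorem integral_Ioi_translate (f : ℝ → ℝ) (t : ℝ) :
    ∫ s in Ioi 0, f (t + s) = ∫ s in Ioi t, f s := by
  rw [← preimage_add_left_Ioi t]
  exact (measurePreserving_add_left volume t).setIntegral_preimage_emb
    (measurableEmbedding_addLeft t) f (Ioi t)

namespace DelayModel

variable {M : DelayModel}

/-- State utilities: continuous, nondecreasing, concave and nonpositive on `(0, ∞)`. -/
structure IsUtil (U : ℝ → ℝ) : Prop where
  cont : ContinuousOn U (Ioi 0)
  mono : MonotoneOn U (Ioi 0)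
  concave : ConcaveOn ℝ (Ioi 0) U
  nonpos : ∀ x, 0 < x → U x ≤ 0

/-- The discounted running payoff. -/
noncomputable def gain (M : DelayModel) (U c x : ℝ → ℝ) (t : ℝ) : ℝ :=
  Real.exp (-M.ρ * t) * (M.U₁ (c t) + U (x t))

theorem U₁_strictMono (hM : M.Standing) : StrictMonoOn M.U₁ (Ici 0) :=
  strictMonoOn_of_deriv_pos (convex_Ici 0) hM.U₁_cont fun x hx => by
    rw [interior_Ici] at hx; exact hM.U₁_deriv_pos x hx

theorem U₁_strictConcave (hM : M.Standing) : StrictConcaveOn ℝ (Ici 0) M.U₁ :=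
  strictConcaveOn_of_deriv2_neg (convex_Ici 0) hM.U₁_cont fun x hx => by
    rw [interior_Ici] at hx; simpa using hM.U₁_deriv2_neg x hx

theorem discount_integrable (hM : M.Standing) :
    IntegrableOn (fun t => Real.exp (-M.ρ * t)) (Ioi 0) := exp_neg_integrableOn_Ioi 0 hM.ρ_pos

theorem IsPlan.aesm {c x : ℝ → ℝ} (h : M.IsPlan c x) :
    AEStronglyMeasurable c (volume.restrict (Ioi 0)) := by
  have : Ioi (0 : ℝ) = ⋃ n : ℕ, Ioc (0 : ℝ) n := by
    ext t
    simp only [mem_Ioi, mem_iUnion, mem_Ioc, exists_and_left]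
    exact ⟨fun ht => ⟨ht, exists_nat_ge t⟩, fun ht => ht.1⟩
  rw [this, aestronglyMeasurable_iUnion_iff]
  intro n
  exact (h.ctrl n (Nat.cast_nonneg n)).1.aestronglyMeasurable

theorem aesm_U₁_comp (hM : M.Standing) {c : ℝ → ℝ} (h0 : ∀ t, 0 ≤ t → 0 ≤ c t)
    (hc : AEStronglyMeasurable c (volume.restrict (Ioi 0))) :
    AEStronglyMeasurable (fun t => M.U₁ (c t)) (volume.restrict (Ioi 0)) := by
  have hcont : Continuous fun k : ℝ => M.U₁ (max k 0) :=
    hM.U₁_cont.comp_continuous (by fun_prop) fun k => mem_Ici.2 (le_max_right _ _)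
  refine (hcont.comp_aestronglyMeasurable hc).congr ?_
  filter_upwards [ae_restrict_mem measurableSet_Ioi] with t ht
  simp [h0 t (le_of_lt ht)]

theorem IsPlan.utility_continuousOn {U c x : ℝ → ℝ} (h : M.IsPlan c x) (hU : IsUtil U) :
    ContinuousOn (fun t => U (x t)) (Ici 0) :=
  hU.cont.comp h.cont fun t ht => h.pos t ht

theorem IsPlan.gain_aesm (hM : M.Standing) {U c x : ℝ → ℝ} (h : M.IsPlan c x) (hU : IsUtil U) :
    AEStronglyMeasurable (M.gain U c x) (volume.restrict (Ioi 0)) := by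
  have h1 : AEStronglyMeasurable (fun t => Real.exp (-M.ρ * t)) (volume.restrict (Ioi 0)) :=
    Continuous.aestronglyMeasurable (by fun_prop)
  have h2 : AEStronglyMeasurable (fun t => U (x t)) (volume.restrict (Ioi 0)) :=
    ((h.utility_continuousOn hU).mono Ioi_subset_Ici_self).aestronglyMeasurable measurableSet_Ioi
  exact h1.mul ((aesm_U₁_comp hM h.nonneg h.aesm).add h2)

theorem IsPlan.gain_le {U c x : ℝ → ℝ} (h : M.IsPlan c x) (hU : IsUtil U) {B : ℝ}
    (hB : ∀ c, 0 ≤ c → |M.U₁ c| ≤ B) {t : ℝ} (ht : 0 ≤ t) :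
    M.gain U c x t ≤ B * Real.exp (-M.ρ * t) := by
  have h1 := (abs_le.1 (hB _ (h.nonneg t ht))).2
  have h2 := hU.nonpos _ (h.pos t ht)
  rw [gain, mul_comm]
  exact mul_le_mul_of_nonneg_right (by linarith) (Real.exp_pos _).le

theorem IsPlan.gain_intervalIntegrable (hM : M.Standing) {U c x : ℝ → ℝ} (h : M.IsPlan c x)
    (hU : IsUtil U) {a b : ℝ} (ha : 0 ≤ a) (hb : 0 ≤ b) :
    IntervalIntegrable (M.gain U c x) volume a b := by
  obtain ⟨B, hB⟩ := hM.U₁_bdd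
  have hs : uIoc a b ⊆ Ioi 0 := fun t ht => (le_min ha hb).trans_lt ht.1
  have h1 : IntervalIntegrable (fun t => M.U₁ (c t)) volume a b := by
    refine IntervalIntegrable.mono_fun' (g := fun _ => B) intervalIntegrable_const
      ((aesm_U₁_comp hM h.nonneg h.aesm).mono_measure (Measure.restrict_mono hs le_rfl)) ?_
    filter_upwards [ae_restrict_mem measurableSet_uIoc] with t ht
    exact hB _ (h.nonneg t (le_of_lt (hs ht)))
  have h2 : IntervalIntegrable (fun t => U (x t)) volume a b :=
    ContinuousOn.intervalIntegrable ((h.utility_continuousOn hU).mono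
      fun t ht => (le_min ha hb).trans ht.1)
  exact (h1.add h2).continuousOn_mul (Continuous.continuousOn (by fun_prop))

/-- The gain is always below `B * exp (-ρ t)`, so an integrable minorant is all that integrability
requires. -/
theorem IsPlan.integrableOn_of_le (hM : M.Standing) {U c x g : ℝ → ℝ} (h : M.IsPlan c x)
    (hU : IsUtil U) (hg : IntegrableOn g (Ioi 0))
    (hle : ∀ᵐ t, 0 < t → g t ≤ M.gain U c x t) : IntegrableOn (M.gain U c x) (Ioi 0) := by
  obtain ⟨B, hB⟩ := hM.U₁_bdd
  refine integrable_of_le_of_le (h.gain_aesm hM hU)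
    ((ae_restrict_iff' measurableSet_Ioi).2 hle) ?_ hg ((discount_integrable hM).const_mul B)
  filter_upwards [ae_restrict_mem measurableSet_Ioi] with t ht
  exact h.gain_le hU hB (le_of_lt ht)

theorem payoff_eq_integral {U c x : ℝ → ℝ} (hi : IntegrableOn (M.gain U c x) (Ioi 0)) :
    M.payoff U c x = ((∫ t in Ioi 0, M.gain U c x t : ℝ) : EReal) := by
  have h1 : ∫⁻ t in Ioi 0, ENNReal.ofReal (-M.gain U c x t) ≠ ⊤ := hi.neg.lintegral_lt_top.ne
  rw [integral_eq_lintegral_pos_part_sub_lintegral_neg_part hi, EReal.coe_sub,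
    EReal.coe_ennreal_toReal hi.lintegral_lt_top.ne, EReal.coe_ennreal_toReal h1]
  rfl

/-- The positive part of the gain is integrable because the gain is bounded above by a discounted
constant. Failure of integrability therefore comes from the negative part alone, and `∞ - ∞` never
occurs. -/
theorem IsPlan.payoff_eq_bot (hM : M.Standing) {U c x : ℝ → ℝ} (h : M.IsPlan c x) (hU : IsUtil U)
    (hi : ¬ IntegrableOn (M.gain U c x) (Ioi 0)) : M.payoff U c x = ⊥ := by
  have hm := h.gain_aesm hM hU
  obtain ⟨B, hB⟩ := hM.U₁_bdd
  have hp : IntegrableOn (fun t => max (M.gain U c x t) 0) (Ioi 0) := by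
    refine integrable_of_le_of_le (g₁ := fun _ => 0)
      (g₂ := fun t => max (B * Real.exp (-M.ρ * t)) 0) (hm.sup aestronglyMeasurable_const)
      (Eventually.of_forall fun t => le_max_right _ _) ?_ (integrable_zero _ _ _)
      ((discount_integrable hM).const_mul B).pos_part
    filter_upwards [ae_restrict_mem measurableSet_Ioi] with t ht
    exact max_le_max (h.gain_le hU hB (le_of_lt ht)) le_rfl
  have hn : (∫⁻ t in Ioi (0 : ℝ), ENNReal.ofReal (-M.gain U c x t)) = ⊤ := by
    by_contra hne
    apply hi
    have hq : IntegrableOn (fun t => max (-M.gain U c x t) 0) (Ioi 0) := by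
      refine (lintegral_ofReal_ne_top_iff_integrable (f := fun t => max (-M.gain U c x t) 0)
        (hm.neg.sup aestronglyMeasurable_const)
        (Eventually.of_forall fun t => le_max_right _ _)).1 ?_
      simpa [ENNReal.ofReal_max] using hne
    refine (hp.sub hq).congr (Eventually.of_forall fun t => ?_)
    simp only [Pi.sub_apply]
    rcases le_total 0 (M.gain U c x t) with h1 | h1
    · rw [max_eq_left h1, max_eq_right (by linarith)]; ring
    · rw [max_eq_right h1, max_eq_left (by linarith)]; ring
  have : M.payoff U c x = ((∫⁻ t in Ioi (0 : ℝ), ENNReal.ofReal (M.gain U c x t) : ENNReal) : EReal)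
    - ((∫⁻ t in Ioi (0 : ℝ), ENNReal.ofReal (-M.gain U c x t) : ENNReal) : EReal) := rfl
  rw [this, hn, EReal.coe_ennreal_top, EReal.sub_top]

/-- The value function at the state `x|_{[-T, 0]}`, as a real number. -/
noncomputable def vf (M : DelayModel) (U x : ℝ → ℝ) : ℝ := (M.value U (x 0) x).toReal

/-- There is a plan with finite payoff from the state `x|_{[-T, 0]}`. -/
def Feas (M : DelayModel) (U x : ℝ → ℝ) : Prop :=
  ∃ c y, M.IsPlan c y ∧ EqOn y x (Icc (-M.T) 0) ∧ IntegrableOn (M.gain U c y) (Ioi 0)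

theorem eqOn_Icc_iff (hM : M.Standing) {x y : ℝ → ℝ} :
    EqOn y x (Icc (-M.T) 0) ↔ y 0 = x 0 ∧ EqOn y x (Ico (-M.T) 0) := by
  have hT := hM.T_pos
  constructor
  · exact fun h => ⟨h ⟨by linarith, le_rfl⟩, h.mono Ico_subset_Icc_self⟩
  · rintro ⟨h0, h⟩ u hu
    rcases hu.2.lt_or_eq with h1 | h1
    · exact h ⟨hu.1, h1⟩
    · rw [h1, h0]

theorem value_congr {U η₁ x : ℝ → ℝ} {η₀ : ℝ}
    (h0 : x 0 = η₀) (h : EqOn x η₁ (Ico (-M.T) 0)) : M.value U η₀ η₁ = M.value U (x 0) x := by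
  have : ∀ c y, M.IsAdmissible η₀ η₁ c y ↔ M.IsAdmissible (x 0) x c y := by
    intro c y
    constructor
    · intro hh
      exact ⟨hh.1, hh.2, hh.3, fun s hs => (hh.4 s hs).trans (h hs).symm, h0 ▸ hh.5, hh.6⟩
    · intro hh
      exact ⟨hh.1, hh.2, hh.3, fun s hs => (hh.4 s hs).trans (h hs), h0 ▸ hh.5, hh.6⟩
  simp only [value, this]

theorem vf_congr (hM : M.Standing) {U x y : ℝ → ℝ} (h : EqOn y x (Icc (-M.T) 0)) :
    M.vf U x = M.vf U y := by
  rw [vf, vf, value_congr ((eqOn_Icc_iff hM).1 h).1 ((eqOn_Icc_iff hM).1 h).2]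

theorem isAdmissible_self_iff (hM : M.Standing) {c x y : ℝ → ℝ}
    (hx : IntervalIntegrable x volume (-M.T) 0) :
    M.IsAdmissible (x 0) x c y ↔ M.IsPlan c y ∧ EqOn y x (Icc (-M.T) 0) := by
  rw [isAdmissible_iff hM hx, eqOn_Icc_iff hM]

theorem IsPlan.payoff_le_value (hM : M.Standing) {U c x y : ℝ → ℝ} (h : M.IsPlan c y)
    (hy : EqOn y x (Icc (-M.T) 0)) : M.payoff U c y ≤ M.value U (x 0) x := by
  have hx : IntervalIntegrable x volume (-M.T) 0 := by
    refine h.hist.congr fun s hs => ?_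
    rw [uIoc_of_le (by linarith [hM.T_pos])] at hs
    exact hy ⟨hs.1.le, hs.2⟩
  exact le_iSup_of_le c (le_iSup_of_le y (le_iSup_of_le
    ((isAdmissible_self_iff hM hx).2 ⟨h, hy⟩) le_rfl))

theorem Feas.hist (hM : M.Standing) {U x : ℝ → ℝ} (h : M.Feas U x) :
    IntervalIntegrable x volume (-M.T) 0 := by
  obtain ⟨c, y, h1, h2, -⟩ := h
  refine h1.hist.congr fun s hs => ?_
  rw [uIoc_of_le (by linarith [hM.T_pos])] at hs
  exact h2 ⟨hs.1.le, hs.2⟩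

theorem exists_plan_of_lt_value (hM : M.Standing) {U x : ℝ → ℝ} (hU : IsUtil U)
    (hx : IntervalIntegrable x volume (-M.T) 0) {r : EReal} (hr : r < M.value U (x 0) x) :
    ∃ c y, M.IsPlan c y ∧ EqOn y x (Icc (-M.T) 0) ∧ IntegrableOn (M.gain U c y) (Ioi 0) ∧
      r < ((∫ t in Ioi 0, M.gain U c y t : ℝ) : EReal) := by
  simp only [value, lt_iSup_iff] at hr
  obtain ⟨c, y, had, hlt⟩ := hr
  obtain ⟨hp, hy⟩ := (isAdmissible_self_iff hM hx).1 had
  have hi : IntegrableOn (M.gain U c y) (Ioi 0) := by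
    by_contra hi
    rw [hp.payoff_eq_bot hM hU hi] at hlt
    exact not_lt_bot hlt
  exact ⟨c, y, hp, hy, hi, by rwa [payoff_eq_integral hi] at hlt⟩

theorem feas_iff (hM : M.Standing) {U x : ℝ → ℝ} (hU : IsUtil U)
    (hx : IntervalIntegrable x volume (-M.T) 0) : M.Feas U x ↔ ⊥ < M.value U (x 0) x := by
  constructor
  · rintro ⟨c, y, h1, h2, h3⟩
    refine lt_of_lt_of_le ?_ (h1.payoff_le_value hM h2)
    rw [payoff_eq_integral h3]
    exact EReal.bot_lt_coe _
  · intro h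
    obtain ⟨c, y, h1, h2, h3, -⟩ := exists_plan_of_lt_value hM hU hx h
    exact ⟨c, y, h1, h2, h3⟩

theorem exists_value_bound (hM : M.Standing) : ∃ B : ℝ, 0 ≤ B ∧ ∀ U c x : ℝ → ℝ, IsUtil U →
    M.IsPlan c x → IntegrableOn (M.gain U c x) (Ioi 0) → ∫ t in Ioi 0, M.gain U c x t ≤ B := by
  obtain ⟨B, hB⟩ := hM.U₁_bdd
  have hB0 : 0 ≤ B := (abs_nonneg _).trans (hB 0 le_rfl)
  refine ⟨B * ∫ t in Ioi 0, Real.exp (-M.ρ * t), mul_nonneg hB0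
    (integral_nonneg fun _ => (Real.exp_pos _).le), fun U c x hU h hi => ?_⟩
  rw [← integral_const_mul]
  exact setIntegral_mono_on hi ((discount_integrable hM).const_mul B) measurableSet_Ioi
    fun t ht => h.gain_le hU hB (le_of_lt ht)

theorem value_eq_vf (hM : M.Standing) {U x : ℝ → ℝ} (hU : IsUtil U) (hx : M.Feas U x) :
    M.value U (x 0) x = (M.vf U x : EReal) := by
  rw [vf, EReal.coe_toReal]
  · obtain ⟨B, -, hB⟩ := exists_value_bound hM
    intro htop
    have hlt : (B : EReal) < M.value U (x 0) x := by rw [htop]; exact EReal.coe_lt_top B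
    obtain ⟨c, y, h1, h2, h3, h4⟩ := exists_plan_of_lt_value hM hU (hx.hist hM) hlt
    exact absurd (hB U c y hU h1 h3) (not_le.2 (EReal.coe_lt_coe_iff.1 h4))
  · exact ((feas_iff hM hU (hx.hist hM)).1 hx).ne'

theorem IsPlan.le_vf (hM : M.Standing) {U c x y : ℝ → ℝ} (hU : IsUtil U) (h : M.IsPlan c y)
    (hy : EqOn y x (Icc (-M.T) 0)) (hi : IntegrableOn (M.gain U c y) (Ioi 0)) :
    ∫ t in Ioi 0, M.gain U c y t ≤ M.vf U x := by
  have h1 := h.payoff_le_value hM (U := U) hy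
  rwa [payoff_eq_integral hi, value_eq_vf hM hU ⟨c, y, h, hy, hi⟩, EReal.coe_le_coe_iff] at h1

/-- Lower bounds for the value are obtained in this form: a plan from the state and an integrable
minorant of its gain. Finiteness of the value comes with the bound. -/
theorem IsPlan.le_vf_of_le (hM : M.Standing) {U c x y g : ℝ → ℝ} (hU : IsUtil U) (h : M.IsPlan c y)
    (hy : EqOn y x (Icc (-M.T) 0)) (hg : IntegrableOn g (Ioi 0))
    (hle : ∀ᵐ t, 0 < t → g t ≤ M.gain U c y t) :
    M.Feas U x ∧ ∫ t in Ioi 0, g t ≤ M.vf U x := by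
  have hi := h.integrableOn_of_le hM hU hg hle
  refine ⟨⟨c, y, h, hy, hi⟩, le_trans ?_ (h.le_vf hM hU hy hi)⟩
  exact setIntegral_mono_ae_restrict hg hi ((ae_restrict_iff' measurableSet_Ioi).2 hle)

theorem Feas.exists_lt (hM : M.Standing) {U x : ℝ → ℝ} (hU : IsUtil U) (hx : M.Feas U x) {ε : ℝ}
    (hε : 0 < ε) : ∃ c y, M.IsPlan c y ∧ EqOn y x (Icc (-M.T) 0) ∧
      IntegrableOn (M.gain U c y) (Ioi 0) ∧ M.vf U x - ε < ∫ t in Ioi 0, M.gain U c y t := by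
  have hlt : ((M.vf U x - ε : ℝ) : EReal) < M.value U (x 0) x := by
    rw [value_eq_vf hM hU hx, EReal.coe_lt_coe_iff]; linarith
  obtain ⟨c, y, h1, h2, h3, h4⟩ := exists_plan_of_lt_value hM hU (hx.hist hM) hlt
  exact ⟨c, y, h1, h2, h3, EReal.coe_lt_coe_iff.1 h4⟩

theorem exists_vf_le (hM : M.Standing) : ∃ B : ℝ, 0 ≤ B ∧ ∀ U x : ℝ → ℝ, IsUtil U → M.Feas U x →
    M.vf U x ≤ B := by
  obtain ⟨B, hB0, hB⟩ := exists_value_bound hM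
  refine ⟨B, hB0, fun U x hU hx => le_of_forall_pos_lt_add fun ε hε => ?_⟩
  obtain ⟨c, y, h1, h2, h3, h4⟩ := hx.exists_lt hM hU hε
  linarith [hB U c y hU h1 h3]

/-- Concavity of the running payoff, with a bonus in consumption. -/
theorem gain_concave (hM : M.Standing) {U c x d y e : ℝ → ℝ} (hU : IsUtil U) (h : M.IsPlan c x)
    (h' : M.IsPlan d y) {k l : ℝ} (hk : 0 ≤ k) (hl : 0 ≤ l) (hkl : k + l = 1) {t : ℝ} (ht : 0 ≤ t)
    (he : k * c t + l * d t ≤ e t) :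
    k * M.gain U c x t + l * M.gain U d y t ≤ M.gain U e (fun u => k * x u + l * y u) t := by
  have h1 := (U₁_strictConcave hM).concaveOn.2 (h.nonneg t ht) (h'.nonneg t ht) hk hl hkl
  have h2 := hU.concave.2 (h.pos t ht) (h'.pos t ht) hk hl hkl
  simp only [smul_eq_mul] at h1 h2
  have h0 : 0 ≤ k * c t + l * d t :=
    add_nonneg (mul_nonneg hk (h.nonneg t ht)) (mul_nonneg hl (h'.nonneg t ht))
  have h3 := (U₁_strictMono hM).monotoneOn h0 (h0.trans he) he
  have h4 := Real.exp_pos (-M.ρ * t)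
  simp only [gain]
  calc _ = Real.exp (-M.ρ * t) * ((k * M.U₁ (c t) + l * M.U₁ (d t)) + (k * U (x t) + l * U (y t))) := by
        ring
    _ ≤ _ := mul_le_mul_of_nonneg_left (by linarith) h4.le

/-- Mixtures of almost optimal plans are dominated by plans from the mixed state that consume at
least as much, and both utilities are concave and nondecreasing. Convexity of the set of states with
finite value is part of the conclusion. -/
theorem vf_concave (hM : M.Standing) {U x y : ℝ → ℝ} (hU : IsUtil U) (hx : M.Feas U x)
    (hy : M.Feas U y) {k l : ℝ} (hk : 0 ≤ k) (hl : 0 ≤ l) (hkl : k + l = 1) :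
    M.Feas U (fun u => k * x u + l * y u) ∧
      k * M.vf U x + l * M.vf U y ≤ M.vf U (fun u => k * x u + l * y u) := by
  have key : ∀ ε, 0 < ε → M.Feas U (fun u => k * x u + l * y u) ∧
      k * M.vf U x + l * M.vf U y ≤ M.vf U (fun u => k * x u + l * y u) + ε := by
    intro ε hε
    obtain ⟨c, x', p1, e1, i1, v1⟩ := hx.exists_lt hM hU hε
    obtain ⟨d, y', p2, e2, i2, v2⟩ := hy.exists_lt hM hU hε
    obtain ⟨e, p3, he⟩ := p1.mix hM p2 hk hl hkl
    have := p3.le_vf_of_le hM (x := fun u => k * x u + l * y u) hU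
      (fun u hu => by simp only [e1 hu, e2 hu]) ((i1.const_mul k).add (i2.const_mul l))
      (Eventually.of_forall fun t ht => gain_concave hM hU p1 p2 hk hl hkl ht.le (he t ht.le))
    refine ⟨this.1, ?_⟩
    have h2 := this.2
    simp only [Pi.add_apply] at h2
    rw [integral_add (i1.const_mul k) (i2.const_mul l), integral_const_mul, integral_const_mul] at h2
    have a1 := mul_le_mul_of_nonneg_left v1.le hk
    have a2 := mul_le_mul_of_nonneg_left v2.le hl
    have a3 : k * ε + l * ε = ε := by rw [← add_mul, hkl, one_mul]
    linarith
  exact ⟨(key 1 one_pos).1, le_of_forall_pos_le_add fun ε hε => (key ε hε).2⟩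

theorem gain_shift (U c x : ℝ → ℝ) (t s : ℝ) :
    M.gain U (fun u => c (t + u)) (fun u => x (t + u)) s =
      Real.exp (M.ρ * t) * M.gain U c x (t + s) := by
  simp only [gain]
  rw [← mul_assoc, ← Real.exp_add]
  congr 2; ring

theorem integrableOn_gain_shift {U c x : ℝ → ℝ} (t : ℝ) :
    IntegrableOn (M.gain U (fun u => c (t + u)) (fun u => x (t + u))) (Ioi 0) ↔
      IntegrableOn (M.gain U c x) (Ioi t) := by
  have : M.gain U (fun u => c (t + u)) (fun u => x (t + u)) =
      fun s => Real.exp (M.ρ * t) * M.gain U c x (t + s) := funext fun s => gain_shift U c x t s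
  rw [this, ← integrableOn_Ioi_translate t]
  exact integrable_const_mul_iff (isUnit_iff_ne_zero.2 (Real.exp_pos _).ne') _

theorem integral_gain_shift (U c x : ℝ → ℝ) (t : ℝ) :
    ∫ s in Ioi t, M.gain U c x s =
      Real.exp (-M.ρ * t) * ∫ s in Ioi 0, M.gain U (fun u => c (t + u)) (fun u => x (t + u)) s := by
  simp only [gain_shift]
  rw [integral_const_mul, integral_Ioi_translate, ← mul_assoc, ← Real.exp_add]
  simp

/-- Dynamic programming inequality. -/
theorem IsPlan.dpp_le (hM : M.Standing) {U c x : ℝ → ℝ} (hU : IsUtil U) (h : M.IsPlan c x) {t : ℝ}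
    (ht : 0 ≤ t) (hf : M.Feas U (fun u => x (t + u))) :
    M.Feas U x ∧ (∫ s in (0 : ℝ)..t, M.gain U c x s) +
      Real.exp (-M.ρ * t) * M.vf U (fun u => x (t + u)) ≤ M.vf U x := by
  have key : ∀ ε, 0 < ε → M.Feas U x ∧ (∫ s in (0 : ℝ)..t, M.gain U c x s) +
      Real.exp (-M.ρ * t) * (M.vf U (fun u => x (t + u)) - ε) ≤ M.vf U x := by
    intro ε hε
    obtain ⟨d, y, p, e, i, v⟩ := hf.exists_lt hM hU hε
    have pc := h.concat hM p ht e
    -- The given plan is followed up to time `t`, then an almost optimal plan from the state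
    -- reached.
    set c' : ℝ → ℝ := fun s => if s < t then c s else d (s - t) with hc'
    set x' : ℝ → ℝ := fun s => if s < t then x s else y (s - t) with hx'
    have hxx : EqOn x' x (Icc (-M.T) 0) := by
      intro u hu
      rcases lt_or_ge u t with h1 | h1
      · simp [hx', h1]
      · have hu0 : u = 0 := le_antisymm hu.2 (ht.trans h1)
        have ht0 : t = 0 := le_antisymm (h1.trans hu.2) ht
        subst hu0; subst ht0
        have := e ⟨by linarith [hM.T_pos], le_rfl⟩
        simpa [hx'] using this
    have gl : ∀ s, s < t → M.gain U c' x' s = M.gain U c x s := fun s hs => by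
      simp [gain, hc', hx', hs]
    have gr : ∀ s ∈ Ioi (0 : ℝ),
        M.gain U (fun u => c' (t + u)) (fun u => x' (t + u)) s = M.gain U d y s := fun s hs => by
      have : 0 ≤ s := le_of_lt hs
      simp [gain, hc', hx', not_lt.2 this]
    have ir : IntegrableOn (M.gain U c' x') (Ioi t) :=
      (integrableOn_gain_shift t).1 (i.congr_fun (fun s hs => (gr s hs).symm) measurableSet_Ioi)
    have il : IntervalIntegrable (M.gain U c' x') volume 0 t :=
      pc.gain_intervalIntegrable hM hU le_rfl ht
    have iu : IntegrableOn (M.gain U c' x') (Ioi 0) := by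
      rw [← Ioc_union_Ioi_eq_Ioi ht]
      exact ((intervalIntegrable_iff_integrableOn_Ioc_of_le ht).1 il).union ir
    refine ⟨⟨c', x', pc, hxx, iu⟩, ?_⟩
    have h1 := pc.le_vf hM hU hxx iu
    rw [← intervalIntegral.integral_interval_add_Ioi iu ir, integral_gain_shift,
      setIntegral_congr_fun measurableSet_Ioi gr] at h1
    have h2 : ∫ s in (0 : ℝ)..t, M.gain U c' x' s = ∫ s in (0 : ℝ)..t, M.gain U c x s := by
      refine intervalIntegral.integral_congr_ae ?_
      have h3 : ∀ᵐ u : ℝ, u ≠ t := by simp [ae_iff]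
      filter_upwards [h3] with s hs hm
      rw [uIoc_of_le ht] at hm
      exact gl s (lt_of_le_of_ne hm.2 hs)
    rw [h2] at h1
    have h4 := mul_le_mul_of_nonneg_left v.le (Real.exp_pos (-M.ρ * t)).le
    linarith
  refine ⟨(key 1 one_pos).1, le_of_forall_pos_le_add fun ε hε => ?_⟩
  have h1 := (key ε hε).2
  have h2 : Real.exp (-M.ρ * t) ≤ 1 := Real.exp_le_one_iff.2 (by nlinarith [hM.ρ_pos])
  nlinarith

/-- A plan with finite payoff that attains the value function. -/
structure IsOpt (M : DelayModel) (U c x : ℝ → ℝ) : Prop where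
  plan : M.IsPlan c x
  integrable : IntegrableOn (M.gain U c x) (Ioi 0)
  eq : ∫ t in Ioi 0, M.gain U c x t = M.vf U x

theorem IsPlan.feas_shift (hM : M.Standing) {U c x : ℝ → ℝ} (h : M.IsPlan c x)
    (hi : IntegrableOn (M.gain U c x) (Ioi 0)) {t : ℝ} (ht : 0 ≤ t) :
    M.Feas U (fun u => x (t + u)) :=
  ⟨_, _, h.shift hM ht, fun _ _ => rfl,
    (integrableOn_gain_shift t).2 (hi.mono_set (Ioi_subset_Ioi ht))⟩

/-- Principle of optimality. -/
theorem IsOpt.shift (hM : M.Standing) {U c x : ℝ → ℝ} (hU : IsUtil U) (h : M.IsOpt U c x) {t : ℝ}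
    (ht : 0 ≤ t) : M.IsOpt U (fun u => c (t + u)) (fun u => x (t + u)) := by
  have hf := h.plan.feas_shift hM h.integrable ht
  have it := h.integrable.mono_set (Ioi_subset_Ioi ht)
  refine ⟨h.plan.shift hM ht, (integrableOn_gain_shift t).2 it, ?_⟩
  refine le_antisymm ((h.plan.shift hM ht).le_vf hM hU (fun _ _ => rfl)
    ((integrableOn_gain_shift t).2 it)) ?_
  have h1 := (h.plan.dpp_le hM hU ht hf).2
  rw [← h.eq, ← intervalIntegral.integral_interval_add_Ioi h.integrable it,
    integral_gain_shift, add_le_add_iff_left] at h1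
  exact le_of_mul_le_mul_left h1 (Real.exp_pos _)

theorem IsOpt.dpp (hM : M.Standing) {U c x : ℝ → ℝ} (hU : IsUtil U) (h : M.IsOpt U c x) {t : ℝ}
    (ht : 0 ≤ t) : (∫ s in (0 : ℝ)..t, M.gain U c x s) +
      Real.exp (-M.ρ * t) * M.vf U (fun u => x (t + u)) = M.vf U x := by
  rw [← h.eq, ← (h.shift hM hU ht).eq, ← intervalIntegral.integral_interval_add_Ioi h.integrable
    (h.integrable.mono_set (Ioi_subset_Ioi ht)), integral_gain_shift U c x t]

end DelayModel

/-! ### A priori bounds: exponential growth and distance from zero -/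

theorem integral_exp_mul_le {β t : ℝ} (hβ : 0 < β) :
    ∫ s in (0 : ℝ)..t, Real.exp (β * s) ≤ Real.exp (β * t) / β := by
  rw [intervalIntegral.integral_comp_mul_left (fun u => Real.exp u) hβ.ne', integral_exp, smul_eq_mul,
    mul_zero, Real.exp_zero, div_eq_inv_mul]
  exact mul_le_mul_of_nonneg_left (by linarith) (inv_pos.2 hβ).le

namespace DelayModel

variable {M : DelayModel}

/-- The right-hand side of the state equation, with the state in `f₀` truncated at zero and an
additional linear term. -/
noncomputable def rate (M : DelayModel) (κ : ℝ) (x : ℝ → ℝ) (s : ℝ) : ℝ :=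
  (κ + M.r) * x s + M.f₀ (max (x s) 0) (M.delayTerm x s)

theorem rate_eq {κ s : ℝ} {x : ℝ → ℝ} (h : 0 ≤ x s) : M.rate κ x s = κ * x s + M.drift x s := by
  simp only [rate, drift, max_eq_left h]; ring

theorem abs_delayTerm_le (hM : M.Standing) {A : ℝ} (hA0 : 0 ≤ A)
    (hA : ∀ ξ ∈ Icc (-M.T) 0, |M.a ξ| ≤ A) {x : ℝ → ℝ} (hx : M.LocInt x) {s : ℝ} (hs : 0 ≤ s) :
    |M.delayTerm x s| ≤ A * ((∫ u in (-M.T)..0, |x u|) + ∫ u in (0 : ℝ)..s, |x u|) := by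
  have hT := hM.T_pos
  have h0 : M.LocInt (fun _ => (0 : ℝ)) := fun t _ => intervalIntegrable_const
  have h := abs_delayTerm_sub_le hM hA hx h0 hs hs
  have e0 : M.delayTerm (fun _ => (0 : ℝ)) s = 0 := by simp [delayTerm]
  rw [e0, sub_zero] at h
  refine h.trans (mul_le_mul_of_nonneg_left ?_ hA0)
  simp only [sub_zero]
  have hl := (hx.mono_interval hT le_rfl (by linarith : -M.T ≤ 0)).abs
  have hr := (hx.mono_interval hT (by linarith) hs).abs
  rw [intervalIntegral.integral_comp_add_left (fun u => |x u|) s,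
    intervalIntegral.integral_add_adjacent_intervals hl hr, add_zero]
  exact intervalIntegral.integral_mono_interval (by linarith) (by linarith) le_rfl
    (Eventually.of_forall fun _ => abs_nonneg _) (hl.trans hr)

/-- Linear growth of the right-hand side, along functions of exponential growth. -/
theorem exists_rate_growth (hM : M.Standing) (κ : ℝ) (hκ : 0 ≤ κ) :
    ∃ C₁, 0 ≤ C₁ ∧ ∀ N, 0 ≤ N → ∃ C₀, 0 ≤ C₀ ∧ ∀ (x : ℝ → ℝ) (q β s : ℝ), M.LocInt x →
      (∫ u in (-M.T)..0, |x u|) ≤ N → 1 ≤ β → 0 ≤ s →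
      (∀ᵐ u, u ∈ Icc 0 s → |x u| ≤ q * Real.exp (β * u)) → |x s| ≤ q * Real.exp (β * s) →
      |M.rate κ x s| ≤ C₀ + C₁ * (q * Real.exp (β * s)) := by
  obtain ⟨A, hA0, hA⟩ := hM.exists_kernel_bound
  obtain ⟨K, hK0, hK⟩ := hM.exists_lipschitz
  -- The constant `C₁` depends neither on the exponent `β ≥ 1` nor on the history bound `N`. This
  -- permits `β` to be chosen from `C₁` afterwards.
  refine ⟨κ + |M.r| + K * (1 + A), by positivity, fun N hN => ⟨|M.f₀ 0 0| + K * A * N, by positivity,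
    fun x q β s hx hxN hβ hs hae hxs => ?_⟩⟩
  have hT := hM.T_pos
  have hq : 0 ≤ q * Real.exp (β * s) := (abs_nonneg _).trans hxs
  have hq0 : 0 ≤ q := nonneg_of_mul_nonneg_left hq (Real.exp_pos _)
  have h1 := abs_delayTerm_le hM hA0 hA hx hs
  have h2 : ∫ u in (0 : ℝ)..s, |x u| ≤ q * Real.exp (β * s) := by
    calc ∫ u in (0 : ℝ)..s, |x u| ≤ ∫ u in (0 : ℝ)..s, q * Real.exp (β * u) := by
          refine intervalIntegral.integral_mono_ae_restrict hs
            (hx.mono_interval hT (by linarith) hs).abs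
            (Continuous.intervalIntegrable (by fun_prop) _ _) ?_
          exact (ae_restrict_iff' measurableSet_Icc).2 hae
      _ = q * ∫ u in (0 : ℝ)..s, Real.exp (β * u) := intervalIntegral.integral_const_mul _ _
      _ ≤ q * (Real.exp (β * s) / β) :=
          mul_le_mul_of_nonneg_left (integral_exp_mul_le (by linarith)) hq0
      _ ≤ q * Real.exp (β * s) :=
          mul_le_mul_of_nonneg_left (div_le_self (Real.exp_pos _).le hβ) hq0
  have h3 : |M.delayTerm x s| ≤ A * (N + q * Real.exp (β * s)) :=
    h1.trans (mul_le_mul_of_nonneg_left (add_le_add hxN h2) hA0)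
  have h4 := hK (max (x s) 0) 0 (M.delayTerm x s) 0 (le_max_right _ _) le_rfl
  rw [sub_zero, sub_zero] at h4
  have h5 : |max (x s) 0| ≤ q * Real.exp (β * s) := by
    rw [abs_of_nonneg (le_max_right _ _)]
    exact max_le ((le_abs_self _).trans hxs) hq
  have h6 : |M.f₀ (max (x s) 0) (M.delayTerm x s)| ≤ |M.f₀ 0 0| +
      K * (q * Real.exp (β * s) + A * (N + q * Real.exp (β * s))) := by
    have := abs_sub_abs_le_abs_sub (M.f₀ (max (x s) 0) (M.delayTerm x s)) (M.f₀ 0 0)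
    have := mul_le_mul_of_nonneg_left (add_le_add h5 h3) hK0
    linarith
  have h7 : |(κ + M.r) * x s| ≤ (κ + |M.r|) * (q * Real.exp (β * s)) := by
    rw [abs_mul]
    refine mul_le_mul ?_ hxs (abs_nonneg _) (by positivity)
    exact (abs_add_le _ _).trans (by rw [abs_of_nonneg hκ])
  refine (abs_add_le _ _).trans ((add_le_add h7 h6).trans (le_of_eq ?_))
  ring

theorem hist_integral_congr (hM : M.Standing) {x y : ℝ → ℝ} (h : EqOn y x (Icc (-M.T) 0)) :
    ∫ u in (-M.T)..0, |y u| = ∫ u in (-M.T)..0, |x u| := by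
  refine intervalIntegral.integral_congr fun u hu => ?_
  rw [uIcc_of_le (by linarith [hM.T_pos])] at hu
  simp only [h hu]

/-- Trajectories from a given state grow at most exponentially, uniformly in the control. -/
theorem exists_growth_bound (hM : M.Standing) (κ : ℝ) (hκ : 0 ≤ κ) (x : ℝ → ℝ) :
    ∃ Q β C₀ C₁ : ℝ, 0 ≤ Q ∧ 1 ≤ β ∧ 0 ≤ C₀ ∧ 0 ≤ C₁ ∧
      (∀ t, 0 ≤ t → |x 0| + C₀ * t + C₁ * (Q * (Real.exp (β * t) / β)) ≤ Q * Real.exp (β * t)) ∧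
      (∀ (y : ℝ → ℝ) (s : ℝ), M.LocInt y → EqOn y x (Icc (-M.T) 0) → 0 ≤ s →
        (∀ᵐ u, u ∈ Icc 0 s → |y u| ≤ Q * Real.exp (β * u)) → |y s| ≤ Q * Real.exp (β * s) →
        |M.rate κ y s| ≤ C₀ + C₁ * (Q * Real.exp (β * s))) ∧
      ∀ c y, M.IsPlan c y → EqOn y x (Icc (-M.T) 0) → ∀ t, 0 ≤ t → y t ≤ Q * Real.exp (β * t) := by
  obtain ⟨C₁, hC₁, h1⟩ := exists_rate_growth hM κ hκ
  obtain ⟨C₀, hC₀, h2⟩ := h1 (∫ u in (-M.T)..0, |x u|)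
    (intervalIntegral.integral_nonneg (by linarith [hM.T_pos]) fun _ _ => abs_nonneg _)
  -- With this exponent `C₁ / β ≤ 1 / 2`, so integration of the linear growth term recovers at most
  -- half of the bound. The factor `2` in `Q` pays for the other half, and `Q * exp (β t)` becomes a
  -- supersolution.
  set β := 1 + 2 * C₁ with hβd
  set Q := 2 * (|x 0| + C₀) with hQd
  have hβ : 1 ≤ β := by linarith
  have hQ : 0 ≤ Q := by positivity
  have hexp1 : ∀ t, 0 ≤ t → 1 ≤ Real.exp (β * t) ∧ t ≤ Real.exp (β * t) := fun t ht => by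
    have h3 := Real.add_one_le_exp (β * t)
    have h4 : t ≤ β * t := le_mul_of_one_le_left ht hβ
    constructor <;> linarith
  have hbd : ∀ q t, 0 ≤ q → 0 ≤ t → |x 0| + C₀ * t + C₁ * (q * (Real.exp (β * t) / β)) ≤
      (|x 0| + C₀) * Real.exp (β * t) + q / 2 * Real.exp (β * t) := by
    intro q t hq ht
    obtain ⟨h3, h4⟩ := hexp1 t ht
    have h5 := mul_le_mul_of_nonneg_left h3 (abs_nonneg (x 0))
    have h6 := mul_le_mul_of_nonneg_left h4 hC₀
    have h7 : C₁ * (q * (Real.exp (β * t) / β)) ≤ q / 2 * Real.exp (β * t) := by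
      have h8 : C₁ / β ≤ 1 / 2 := by rw [div_le_div_iff₀ (by linarith) two_pos]; linarith
      calc C₁ * (q * (Real.exp (β * t) / β)) = (C₁ / β) * (q * Real.exp (β * t)) := by ring
        _ ≤ 1 / 2 * (q * Real.exp (β * t)) := mul_le_mul_of_nonneg_right h8 (by positivity)
        _ = _ := by ring
    linarith
  refine ⟨Q, β, C₀, C₁, hQ, hβ, hC₀, hC₁, fun t ht => ?_, fun y s hy hyx hs ha hb => ?_,
    fun c y hp hyx t ht => ?_⟩
  · have := hbd Q t hQ ht
    have e : (|x 0| + C₀) * Real.exp (β * t) + Q / 2 * Real.exp (β * t) = Q * Real.exp (β * t) := by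
      rw [hQd]; ring
    linarith
  · exact h2 y Q β s hy (hist_integral_congr hM hyx).le hβ hs ha hb
  · have hcont : ContinuousOn (fun s => y s * Real.exp (-(β * s))) (Icc 0 t) :=
      (hp.cont.mono Icc_subset_Ici_self).mul (Continuous.continuousOn (by fun_prop))
    obtain ⟨t₁, ht₁, hmax⟩ := isCompact_Icc.exists_isMaxOn ⟨0, le_rfl, ht⟩ hcont
    -- Here `q` is the maximum of the weighted trajectory on `[0, t]`. The equation at the maximizer
    -- gives `q ≤ |x 0| + C₀ + q / 2`, hence `q ≤ Q`. Consumption only helps, so the bound does not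
    -- depend on the control.
    set q := y t₁ * Real.exp (-(β * t₁)) with hq
    have hexp : ∀ s, y s * Real.exp (-(β * s)) * Real.exp (β * s) = y s := fun s => by
      rw [mul_assoc, ← Real.exp_add]; simp
    have hyq : ∀ s ∈ Icc 0 t, |y s| ≤ q * Real.exp (β * s) := fun s hs => by
      rw [abs_of_pos (hp.pos s hs.1), ← hexp s]
      exact mul_le_mul_of_nonneg_right (hmax hs) (Real.exp_pos _).le
    have hq0 : 0 ≤ q := mul_nonneg (hp.pos _ ht₁.1).le (Real.exp_pos _).le
    have hy0 : y 0 = x 0 := hyx ⟨by linarith [hM.T_pos], le_rfl⟩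
    have hle : y t₁ ≤ |x 0| + C₀ * t₁ + C₁ * (q * (Real.exp (β * t₁) / β)) := by
      have h3 : ∫ s in (0 : ℝ)..t₁, (M.drift y s - c s) ≤
          ∫ s in (0 : ℝ)..t₁, (C₀ + C₁ * (q * Real.exp (β * s))) := by
        refine intervalIntegral.integral_mono_on ht₁.1 (hp.rate_int hM le_rfl ht₁.1)
          (Continuous.intervalIntegrable (by fun_prop) _ _) fun s hs => ?_
        have h4 := h2 y q β s hp.locInt (hist_integral_congr hM hyx).le hβ hs.1
          (Eventually.of_forall fun u hu => hyq u ⟨hu.1, hu.2.trans (hs.2.trans ht₁.2)⟩)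
          (hyq s ⟨hs.1, hs.2.trans ht₁.2⟩)
        have h5 := hp.nonneg s hs.1
        have h6 := hp.pos s hs.1
        rw [rate_eq h6.le] at h4
        have h7 := mul_nonneg hκ h6.le
        linarith [(abs_le.1 h4).2]
      rw [intervalIntegral.integral_add (Continuous.intervalIntegrable (by fun_prop) _ _)
        (Continuous.intervalIntegrable (by fun_prop) _ _), intervalIntegral.integral_const,
        intervalIntegral.integral_const_mul, intervalIntegral.integral_const_mul] at h3
      have h8 := mul_le_mul_of_nonneg_left (mul_le_mul_of_nonneg_left
        (integral_exp_mul_le (t := t₁) (by linarith : 0 < β)) hq0) hC₁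
      rw [hp.eqn t₁ ht₁.1, hy0]
      simp only [sub_zero, smul_eq_mul] at h3
      linarith [le_abs_self (x 0)]
    have h9 := hle.trans (hbd q t₁ hq0 ht₁.1)
    rw [← hexp t₁, ← hq, ← add_mul] at h9
    have h10 := le_of_mul_le_mul_right h9 (Real.exp_pos _)
    have h11 := (le_abs_self _).trans (hyq t ⟨ht, le_rfl⟩)
    refine h11.trans (mul_le_mul_of_nonneg_right ?_ (Real.exp_pos _).le)
    rw [hQd]; linarith

/-- A uniform upper bound for the drift along all trajectories from a given state. -/
theorem exists_drift_bound (hM : M.Standing) (x : ℝ → ℝ) (τ : ℝ) :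
    ∃ R, 1 ≤ R ∧ ∀ c y, M.IsPlan c y → EqOn y x (Icc (-M.T) 0) → ∀ t ∈ Icc 0 τ, M.drift y t ≤ R := by
  obtain ⟨Q, β, C₀, C₁, hQ, hβ, hC₀, hC₁, -, h1, h2⟩ := exists_growth_bound hM 0 le_rfl x
  have h0 : 0 ≤ C₁ * (Q * Real.exp (β * τ)) := by positivity
  refine ⟨1 + (C₀ + C₁ * (Q * Real.exp (β * τ))), by linarith, fun c y hp hy t ht => ?_⟩
  have hb : ∀ u, 0 ≤ u → |y u| ≤ Q * Real.exp (β * u) := fun u hu => by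
    rw [abs_of_pos (hp.pos u hu)]; exact h2 c y hp hy u hu
  have h3 := h1 y t hp.locInt hy ht.1 (Eventually.of_forall fun u hu => hb u hu.1) (hb t ht.1)
  rw [rate_eq (hp.pos t ht.1).le, zero_mul, zero_add] at h3
  have h4 : Real.exp (β * t) ≤ Real.exp (β * τ) :=
    Real.exp_le_exp.2 (mul_le_mul_of_nonneg_left ht.2 (by linarith))
  have h5 := mul_le_mul_of_nonneg_left (mul_le_mul_of_nonneg_left h4 hQ) hC₁
  linarith [(abs_le.1 h3).2]

/-- If the state utility is not integrable at zero, plans whose payoff is bounded from below stay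
uniformly away from zero on bounded time intervals. -/
theorem exists_lower_bound (hM : M.Standing) {U : ℝ → ℝ} (hU : IsUtil U)
    (hnot : ¬ IntegrableAtFilter U (𝓝[>] 0) volume) (x : ℝ → ℝ) (τ N : ℝ) :
    ∃ μ, 0 < μ ∧ ∀ c y, M.IsPlan c y → EqOn y x (Icc (-M.T) 0) →
      IntegrableOn (M.gain U c y) (Ioi 0) → -N ≤ ∫ t in Ioi 0, M.gain U c y t →
      ∀ t ∈ Icc 0 τ, μ ≤ y t := by
  obtain ⟨R, hR, hdr⟩ := exists_drift_bound hM x (τ + 1)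
  obtain ⟨B, hB⟩ := hM.U₁_bdd
  set E := ∫ t in Ioi 0, Real.exp (-M.ρ * t) with hE
  set I := R * (Real.exp (M.ρ * (τ + 1)) * (N + B * E)) with hI
  by_contra hcon
  push Not at hcon
  -- A trajectory that reaches a level `ε` at time `t₁` lies below `ε + R * (s - t₁)` during the
  -- next unit of time. Its utility loss thus controls the integral of `-U` over `(ε, R]`, while the
  -- payoff bound limits the loss by a constant independent of `ε`.
  have key : ∀ n : ℕ, ∃ ε, 0 < ε ∧ ε < 1 / ((n : ℝ) + 1) ∧ ∫ s in Ioc ε R, ‖U s‖ ≤ I := by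
    intro n
    obtain ⟨c, y, hp, hy, hi, hN, t₁, ht₁, hlt⟩ := hcon (1 / ((n : ℝ) + 1)) (by positivity)
    have hε := hp.pos t₁ ht₁.1
    set ε := y t₁ with hεd
    refine ⟨ε, hε, hlt, ?_⟩
    have hε1 : ε < 1 := hlt.trans_le (by
      rw [div_le_one (by positivity)]; linarith [(Nat.cast_nonneg n : (0 : ℝ) ≤ n)])
    have hyle : ∀ s ∈ Icc t₁ (t₁ + 1), y s ≤ ε + R * (s - t₁) := by
      intro s hs
      have h1 := hp.sub_eq hM ht₁.1 (ht₁.1.trans hs.1)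
      have h2 : ∫ u in t₁..s, (M.drift y u - c u) ≤ ∫ u in t₁..s, R := by
        refine intervalIntegral.integral_mono_on hs.1 (hp.rate_int hM ht₁.1 (ht₁.1.trans hs.1))
          intervalIntegrable_const fun u hu => ?_
        have h3 := hdr c y hp hy u ⟨ht₁.1.trans hu.1, by linarith [hu.2, hs.2, ht₁.2]⟩
        linarith [hp.nonneg u (ht₁.1.trans hu.1)]
      rw [intervalIntegral.integral_const, smul_eq_mul] at h2
      linarith
    have hgap : IntegrableOn (fun t => B * Real.exp (-M.ρ * t) - M.gain U c y t) (Ioi 0) :=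
      ((discount_integrable hM).const_mul B).sub hi
    have hUy : IntervalIntegrable (fun s => -U (y s)) volume t₁ (t₁ + 1) := by
      refine ContinuousOn.intervalIntegrable (((hp.utility_continuousOn hU).mono ?_).neg)
      rw [uIcc_of_le (by linarith)]
      exact fun s hs => ht₁.1.trans hs.1
    -- The gap between `B * exp (-ρ s)` and the gain is nonnegative, has total integral at most `N +
    -- B * E`, and dominates the discounted loss from the state utility.
    have h1 : Real.exp (-M.ρ * (τ + 1)) * ∫ s in t₁..(t₁ + 1), -U (y s) ≤ N + B * E := by
      rw [← intervalIntegral.integral_const_mul]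
      calc ∫ s in t₁..(t₁ + 1), Real.exp (-M.ρ * (τ + 1)) * -U (y s)
          ≤ ∫ s in t₁..(t₁ + 1), (B * Real.exp (-M.ρ * s) - M.gain U c y s) := by
            refine intervalIntegral.integral_mono_on (by linarith) (hUy.const_mul _)
              ((Continuous.intervalIntegrable (by fun_prop) _ _).sub
              (hp.gain_intervalIntegrable hM hU ht₁.1 (by linarith [ht₁.1]))) fun s hs => ?_
            have hs0 : 0 ≤ s := ht₁.1.trans hs.1
            have h2 := (abs_le.1 (hB _ (hp.nonneg s hs0))).2
            have h3 := hU.nonpos _ (hp.pos s hs0)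
            have h4 : Real.exp (-M.ρ * (τ + 1)) ≤ Real.exp (-M.ρ * s) :=
              Real.exp_le_exp.2 (by nlinarith [hM.ρ_pos, hs.2, ht₁.2])
            have h5 := mul_le_mul_of_nonneg_right h4 (neg_nonneg.2 h3)
            have h6 := mul_le_mul_of_nonneg_left h2 (Real.exp_pos (-M.ρ * s)).le
            simp only [gain]
            linarith
        _ ≤ ∫ t in Ioi 0, (B * Real.exp (-M.ρ * t) - M.gain U c y t) := by
            rw [intervalIntegral.integral_of_le (by linarith)]
            refine setIntegral_mono_set hgap ?_ ?_
            · filter_upwards [ae_restrict_mem measurableSet_Ioi] with t ht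
              exact sub_nonneg.2 (hp.gain_le hU hB (le_of_lt ht))
            · exact LE.le.eventuallyLE fun s hs => ht₁.1.trans_lt hs.1
        _ ≤ N + B * E := by
            rw [integral_sub ((discount_integrable hM).const_mul B) hi, integral_const_mul]
            linarith
    have h2 : ∫ s in (0 : ℝ)..1, -U (ε + R * s) ≤ ∫ s in t₁..(t₁ + 1), -U (y s) := by
      have e := intervalIntegral.integral_comp_add_left (a := 0) (b := 1) (fun s => -U (y s)) t₁
      rw [add_zero] at e
      rw [← e]
      refine intervalIntegral.integral_mono_on zero_le_one ?_ ?_ fun s hs => ?_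
      · refine ContinuousOn.intervalIntegrable (ContinuousOn.neg (hU.cont.comp (by fun_prop) ?_))
        intro s hs
        rw [uIcc_of_le zero_le_one] at hs
        exact mem_Ioi.2 (by nlinarith [hs.1])
      · have := hUy.comp_add_left t₁
        simpa using this
      · have h3 := hyle (t₁ + s) ⟨by linarith [hs.1], by linarith [hs.2]⟩
        rw [add_sub_cancel_left] at h3
        have h4 := hp.pos (t₁ + s) (by linarith [hs.1, ht₁.1])
        have := hU.mono h4 (h4.trans_le h3) h3
        linarith
    have h3 : ∫ s in ε..(R + ε), -U s = R * ∫ s in (0 : ℝ)..1, -U (ε + R * s) := by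
      have := intervalIntegral.integral_comp_add_mul (a := 0) (b := 1) (fun s => -U s)
        (by linarith : R ≠ 0) ε
      rw [this, smul_eq_mul, ← mul_assoc, mul_inv_cancel₀ (by linarith)]
      simp [add_comm]
    have h4 : ∫ s in Ioc ε R, ‖U s‖ ≤ ∫ s in ε..(R + ε), -U s := by
      have hi4 : IntervalIntegrable (fun s => -U s) volume ε (R + ε) := by
        refine ContinuousOn.intervalIntegrable (hU.cont.mono ?_).neg
        rw [uIcc_of_le (by linarith)]
        exact fun s hs => hε.trans_le hs.1
      have e : ∫ s in Ioc ε R, ‖U s‖ = ∫ s in ε..R, -U s := by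
        rw [intervalIntegral.integral_of_le (by linarith)]
        refine setIntegral_congr_fun measurableSet_Ioc fun s hs => ?_
        simp only [Real.norm_eq_abs]
        exact abs_of_nonpos (hU.nonpos s (hε.trans hs.1))
      rw [e]
      refine intervalIntegral.integral_mono_interval le_rfl (by linarith) (by linarith) ?_ hi4
      filter_upwards [ae_restrict_mem measurableSet_Ioc] with s hs
      exact neg_nonneg.2 (hU.nonpos s (hε.trans hs.1))
    have h5 : ∫ s in t₁..(t₁ + 1), -U (y s) ≤ Real.exp (M.ρ * (τ + 1)) * (N + B * E) := by
      have h6 := mul_le_mul_of_nonneg_left h1 (Real.exp_pos (M.ρ * (τ + 1))).le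
      rwa [← mul_assoc, ← Real.exp_add, neg_mul, add_neg_cancel, Real.exp_zero, one_mul] at h6
    rw [h3] at h4
    exact h4.trans (mul_le_mul_of_nonneg_left (h2.trans h5) (by linarith))
  -- As `ε → 0`, uniformly bounded integrals of `|U|` over `(ε, R]` make `U` integrable at zero,
  -- contrary to `hnot`.
  choose ε hε0 hε1 hεI using key
  have hlim : Tendsto ε atTop (𝓝 0) :=
    squeeze_zero (fun n => (hε0 n).le) (fun n => (hε1 n).le) tendsto_one_div_add_atTop_nhds_zero_nat
  apply hnot
  refine ⟨Ioc 0 R, Ioc_mem_nhdsGT (by linarith), ?_⟩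
  refine integrableOn_Ioc_of_intervalIntegral_norm_bounded_left (fun n => ?_) hlim
    (Eventually.of_forall hεI)
  refine (ContinuousOn.integrableOn_Icc (hU.cont.mono ?_)).mono_set Ioc_subset_Icc_self
  exact fun s hs => (hε0 n).trans_le hs.1

end DelayModel

/-! ### Convergence tools for maximizing sequences -/

/-- Fatou's lemma for real-valued functions. -/
theorem integrable_and_integral_le_of_tendsto_ae {α : Type*} [MeasurableSpace α] {μ : Measure α}
    {f : ℕ → α → ℝ} {g : α → ℝ} {a : ℝ} (hf : ∀ n, Integrable (f n) μ) (h0 : ∀ n, 0 ≤ᵐ[μ] f n)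
    (hg : ∀ᵐ t ∂μ, Tendsto (fun n => f n t) atTop (𝓝 (g t)))
    (ha : Tendsto (fun n => ∫ t, f n t ∂μ) atTop (𝓝 a)) :
    Integrable g μ ∧ ∫ t, g t ∂μ ≤ a := by
  have ha0 : 0 ≤ a := ge_of_tendsto' ha fun n => integral_nonneg_of_ae (h0 n)
  have hg0 : 0 ≤ᵐ[μ] g := by
    filter_upwards [hg, ae_all_iff.2 h0] with t h1 h2
    exact ge_of_tendsto' h1 h2
  have hm : AEStronglyMeasurable g μ :=
    aestronglyMeasurable_of_tendsto_ae atTop (fun n => (hf n).aestronglyMeasurable) hg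
  have hle : ∫⁻ t, ENNReal.ofReal (g t) ∂μ ≤ ENNReal.ofReal a := by
    calc ∫⁻ t, ENNReal.ofReal (g t) ∂μ
        = ∫⁻ t, liminf (fun n => ENNReal.ofReal (f n t)) atTop ∂μ := by
          refine lintegral_congr_ae ?_
          filter_upwards [hg] with t ht
          exact ((ENNReal.tendsto_ofReal ht).liminf_eq).symm
      _ ≤ liminf (fun n => ∫⁻ t, ENNReal.ofReal (f n t) ∂μ) atTop :=
          lintegral_liminf_le' fun n => (hf n).aestronglyMeasurable.aemeasurable.ennreal_ofReal
      _ = ENNReal.ofReal a := by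
          have : (fun n => ∫⁻ t, ENNReal.ofReal (f n t) ∂μ) =
              fun n => ENNReal.ofReal (∫ t, f n t ∂μ) := by
            ext n; rw [ofReal_integral_eq_lintegral_ofReal (hf n) (h0 n)]
          rw [this]
          exact (ENNReal.tendsto_ofReal ha).liminf_eq
  have hgi : Integrable g μ := (lintegral_ofReal_ne_top_iff_integrable hm hg0).1
    (hle.trans_lt ENNReal.ofReal_lt_top).ne
  refine ⟨hgi, ?_⟩
  rw [← ofReal_integral_eq_lintegral_ofReal hgi hg0] at hle
  exact (ENNReal.ofReal_le_ofReal_iff ha0).1 hle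

/-- In a family closed under taking midpoints that improve the objective, there is a maximizing
sequence along which two nonnegative convex square integrable features converge almost
everywhere. -/
theorem exists_maximizing_seq_ae_tendsto {α ι : Type*} [MeasurableSpace α] {μ : Measure α}
    {w z : ι → α → ℝ} (hw : ∀ i, MemLp (w i) 2 μ) (hz : ∀ i, MemLp (z i) 2 μ) {J : ι → ℝ} {V D : ℝ}
    (hJ : ∀ ε, 0 < ε → ∃ i, V - ε < J i)
    (hD : ∀ i, (∫ t, w i t ^ 2 ∂μ) + ∫ t, z i t ^ 2 ∂μ ≤ D)
    (hmid : ∀ i j, ∃ k, (J i + J j) / 2 ≤ J k ∧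
      (∀ᵐ t ∂μ, 0 ≤ w k t ∧ w k t ≤ (w i t + w j t) / 2) ∧
      (∀ᵐ t ∂μ, 0 ≤ z k t ∧ z k t ≤ (z i t + z j t) / 2)) :
    ∃ i : ℕ → ι, (∀ n : ℕ, V - 1 / ((n : ℝ) + 1) < J (i n)) ∧
      (∀ᵐ t ∂μ, ∃ l, Tendsto (fun n => w (i n) t) atTop (𝓝 l)) ∧
      ∀ᵐ t ∂μ, ∃ l, Tendsto (fun n => z (i n) t) atTop (𝓝 l) := by
  -- Among almost maximal indices, those of nearly minimal squared norm are selected. The infima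
  -- over the shrinking superlevel sets of `J` increase and are bounded by `D`, hence converge.
  -- Midpoints stay in a superlevel set, so the parallelogram law makes the near-minimizers Cauchy.
  set Φ : ι → ℝ := fun i => (∫ t, w i t ^ 2 ∂μ) + ∫ t, z i t ^ 2 ∂μ with hΦ
  set S : ℕ → Set ℝ := fun n => Φ '' {i | V - 1 / ((n : ℝ) + 1) < J i} with hS
  have hΦ0 : ∀ i, 0 ≤ Φ i := fun i =>
    add_nonneg (integral_nonneg fun _ => sq_nonneg _) (integral_nonneg fun _ => sq_nonneg _)
  have hSne : ∀ n, (S n).Nonempty := fun n => by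
    obtain ⟨i, hi⟩ := hJ (1 / ((n : ℝ) + 1)) (by positivity)
    exact ⟨_, i, hi, rfl⟩
  have hSb : ∀ n, BddBelow (S n) := fun n => ⟨0, by rintro _ ⟨i, -, rfl⟩; exact hΦ0 i⟩
  set d : ℕ → ℝ := fun n => sInf (S n) with hd
  have hdm : Monotone d := by
    intro m n hmn
    refine csInf_le_csInf (hSb m) (hSne n) (image_mono fun i hi => ?_)
    rw [mem_ofPred_eq] at hi ⊢
    refine lt_of_le_of_lt ?_ hi
    have : 1 / ((n : ℝ) + 1) ≤ 1 / ((m : ℝ) + 1) :=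
      one_div_le_one_div_of_le (by positivity) (by exact_mod_cast Nat.succ_le_succ hmn)
    linarith
  have hdD : BddAbove (range d) := ⟨D, by
    rintro _ ⟨n, rfl⟩
    obtain ⟨_, ⟨i, hi, rfl⟩⟩ := hSne n
    exact (csInf_le (hSb n) ⟨i, hi, rfl⟩).trans (hD i)⟩
  set d' := ⨆ n, d n with hd'
  have hlim : Tendsto d atTop (𝓝 d') := tendsto_atTop_ciSup hdm hdD
  -- With tolerance `4⁻ᴺ / 16` here and in the choice of `i N`, the parallelogram inequality bounds
  -- the squared distance by `4⁻ᴺ / 2`.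
  have hev : ∀ N : ℕ, ∀ᶠ n in atTop, d' - (1 / 4) ^ N / 16 < d n := fun N =>
    hlim.eventually (lt_mem_nhds (by linarith [show (0 : ℝ) < (1 / 4) ^ N / 16 by positivity]))
  obtain ⟨m, hm, hmd⟩ := extraction_forall_of_eventually hev
  have hch : ∀ N : ℕ, ∃ i, V - 1 / ((m N : ℝ) + 1) < J i ∧ Φ i < d (m N) + (1 / 4) ^ N / 16 := by
    intro N
    obtain ⟨_, ⟨i, hi, rfl⟩, hlt⟩ := exists_lt_of_csInf_lt (hSne (m N))
      (show sInf (S (m N)) < d (m N) + (1 / 4) ^ N / 16 by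
        linarith [show (0 : ℝ) < (1 / 4) ^ N / 16 by positivity])
    exact ⟨i, hi, hlt⟩
  choose i hiJ hiΦ using hch
  have hdist : ∀ N n k : ℕ, N ≤ n → N ≤ k →
      (∫ t, (w (i n) t - w (i k) t) ^ 2 ∂μ) + ∫ t, (z (i n) t - z (i k) t) ^ 2 ∂μ < (1 / 4) ^ N := by
    intro N n k hn hk
    obtain ⟨j, hj, hjw, hjz⟩ := hmid (i n) (i k)
    have hinv : ∀ n, N ≤ n → V - 1 / ((m N : ℝ) + 1) < J (i n) := fun n hn => by
      refine lt_of_le_of_lt ?_ (hiJ n)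
      have : 1 / ((m n : ℝ) + 1) ≤ 1 / ((m N : ℝ) + 1) :=
        one_div_le_one_div_of_le (by positivity)
          (by exact_mod_cast Nat.succ_le_succ (hm.monotone hn))
      linarith
    have hjJ : V - 1 / ((m N : ℝ) + 1) < J j := by linarith [hinv n hn, hinv k hk]
    have hjd : d (m N) ≤ Φ j := csInf_le (hSb _) ⟨j, hjJ, rfl⟩
    have hle : ∀ n, N ≤ n → Φ (i n) < d' + (1 / 4) ^ N / 16 := fun n hn => by
      have h1 : d (m n) ≤ d' := le_ciSup hdD _
      have h2 : (1 / 4 : ℝ) ^ n ≤ (1 / 4) ^ N :=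
        pow_le_pow_of_le_one (by norm_num) (by norm_num) hn
      linarith [hiΦ n]
    -- The identity `(a - b)² = 2a² + 2b² - (a + b)²` is used with `0 ≤ v j ≤ (a + b) / 2`. An
    -- inequality at the midpoint suffices, and this admits features that are convex rather than
    -- linear.
    have par : ∀ v : ι → α → ℝ, (∀ i, MemLp (v i) 2 μ) →
        (∀ᵐ t ∂μ, 0 ≤ v j t ∧ v j t ≤ (v (i n) t + v (i k) t) / 2) →
        ∫ t, (v (i n) t - v (i k) t) ^ 2 ∂μ ≤ 2 * (∫ t, v (i n) t ^ 2 ∂μ) +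
          2 * (∫ t, v (i k) t ^ 2 ∂μ) - 4 * ∫ t, v j t ^ 2 ∂μ := by
      intro v hv hvj
      have i1 := (hv (i n)).integrable_sq
      have i2 := (hv (i k)).integrable_sq
      have i3 := (hv j).integrable_sq
      have i4 : Integrable (fun t => (v (i n) t - v (i k) t) ^ 2) μ :=
        ((hv (i n)).sub (hv (i k))).integrable_sq
      have i5 : Integrable (fun t => 2 * v (i n) t ^ 2 + 2 * v (i k) t ^ 2) μ :=
        (i1.const_mul 2).add (i2.const_mul 2)
      rw [← integral_const_mul, ← integral_const_mul, ← integral_const_mul,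
        ← integral_add (i1.const_mul 2) (i2.const_mul 2), ← integral_sub i5 (i3.const_mul 4)]
      refine integral_mono_ae i4 (i5.sub (i3.const_mul 4)) ?_
      filter_upwards [hvj] with t ht
      nlinarith [ht.1, ht.2, mul_self_le_mul_self ht.1 ht.2]
    have p1 := par w hw hjw
    have p2 := par z hz hjz
    have e1 := hle n hn
    have e2 := hle k hk
    have e3 := hmd N
    have e4 : (0 : ℝ) < (1 / 4) ^ N := by positivity
    simp only [hΦ] at hjd e1 e2
    linarith
  have conv : ∀ v : ι → α → ℝ, (∀ i, MemLp (v i) 2 μ) →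
      (∀ N n k : ℕ, N ≤ n → N ≤ k → ∫ t, (v (i n) t - v (i k) t) ^ 2 ∂μ < (1 / 4) ^ N) →
      ∀ᵐ t ∂μ, ∃ l, Tendsto (fun n => v (i n) t) atTop (𝓝 l) := by
    intro v hv h
    -- The norms of the differences are below the summable sequence `2⁻ᴺ`, so the sequence itself
    -- converges almost everywhere.
    refine Lp.ae_tendsto_of_cauchy_eLpNorm (p := 2) (fun n => (hv (i n)).aestronglyMeasurable)
      (by norm_num) (B := fun N => ENNReal.ofReal ((1 / 2) ^ N)) ?_ ?_
    · rw [← ENNReal.ofReal_tsum_of_nonneg (fun n => by positivity)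
        (summable_geometric_of_lt_one (by norm_num) (by norm_num))]
      exact ENNReal.ofReal_ne_top
    · intro N n k hn hk
      rw [((hv (i n)).sub (hv (i k))).eLpNorm_eq_integral_rpow_norm (by norm_num) (by norm_num)]
      refine (ENNReal.ofReal_lt_ofReal_iff (by positivity)).2 ?_
      have e : ∫ t, ‖(v (i n) - v (i k)) t‖ ^ (ENNReal.toReal 2) ∂μ =
          ∫ t, (v (i n) t - v (i k) t) ^ 2 ∂μ := by
        congr 1; ext t
        simp [sq_abs]
      rw [e]
      have h2 : ((1 / 2 : ℝ) ^ N) = (((1 / 4 : ℝ) ^ N)) ^ ((ENNReal.toReal 2)⁻¹) := by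
        rw [show (1 / 4 : ℝ) ^ N = ((1 / 2) ^ N) ^ (2 : ℕ) by
          rw [← pow_mul, mul_comm, pow_mul]; norm_num]
        rw [show (ENNReal.toReal 2)⁻¹ = 1 / 2 by norm_num, ← Real.sqrt_eq_rpow,
          Real.sqrt_sq (by positivity)]
      rw [h2]
      exact Real.rpow_lt_rpow (integral_nonneg fun _ => sq_nonneg _) (h N n k hn hk) (by norm_num)
  refine ⟨i, fun n => lt_of_le_of_lt ?_ (hiJ n), conv w hw fun N n k hn hk => ?_,
    conv z hz fun N n k hn hk => ?_⟩
  · have : 1 / ((m n : ℝ) + 1) ≤ 1 / ((n : ℝ) + 1) :=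
      one_div_le_one_div_of_le (by positivity)
        (by exact_mod_cast Nat.succ_le_succ (hm.id_le n))
    linarith
  · have := hdist N n k hn hk
    have h0 : 0 ≤ ∫ t, (z (i n) t - z (i k) t) ^ 2 ∂μ := integral_nonneg fun _ => sq_nonneg _
    linarith
  · have := hdist N n k hn hk
    have h0 : 0 ≤ ∫ t, (w (i n) t - w (i k) t) ^ 2 ∂μ := integral_nonneg fun _ => sq_nonneg _
    linarith

/-- A sequence whose image under a strictly increasing continuous function converges, and which does
not tend to infinity, converges. -/
theorem exists_tendsto_of_strictMonoOn {f : ℝ → ℝ} (hf : StrictMonoOn f (Ici 0))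
    (hc : ContinuousOn f (Ici 0)) {u : ℕ → ℝ} (hu : ∀ n, 0 ≤ u n) {l r : ℝ}
    (hl : Tendsto (fun n => f (u n)) atTop (𝓝 l)) (hr : ∃ᶠ n in atTop, u n < r) :
    ∃ k, Tendsto u atTop (𝓝 k) := by
  obtain ⟨n₀, hn₀⟩ := hr.exists
  have hr0 : 0 ≤ r := (hu n₀).trans hn₀.le
  have hlr : l ≤ f r := by
    by_contra! hlt
    obtain ⟨n, h1, h2⟩ := (hr.and_eventually (hl.eventually (lt_mem_nhds hlt))).exists
    exact absurd (hf (hu n) hr0 h1) (not_lt.2 h2.le)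
  have hlt : ∀ᶠ n in atTop, u n < r + 1 := by
    have h1 : l < f (r + 1) := hlr.trans_lt (hf hr0 (mem_Ici.2 (by linarith)) (by linarith))
    filter_upwards [hl.eventually (gt_mem_nhds h1)] with n hn
    exact (hf.lt_iff_lt (hu n) (mem_Ici.2 (by linarith))).1 hn
  have hcl : IsClosed (f '' Icc 0 (r + 1)) :=
    (isCompact_Icc.image_of_continuousOn (hc.mono Icc_subset_Ici_self)).isClosed
  obtain ⟨k, hk, hkl⟩ := hcl.mem_of_tendsto hl
    (hlt.mono fun n hn => ⟨u n, ⟨hu n, hn.le⟩, rfl⟩)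
  refine ⟨k, tendsto_order.2 ⟨fun a ha => ?_, fun b hb => ?_⟩⟩
  · rcases lt_or_ge a 0 with h0 | h0
    · exact Eventually.of_forall fun n => h0.trans_le (hu n)
    · have h1 : f a < l := hkl ▸ hf h0 hk.1 ha
      filter_upwards [hl.eventually (lt_mem_nhds h1)] with n hn
      exact (hf.lt_iff_lt h0 (hu n)).1 hn
  · have hb0 : 0 ≤ b := hk.1.trans hb.le
    have h1 : l < f b := hkl ▸ hf hk.1 hb0 hb
    filter_upwards [hl.eventually (gt_mem_nhds h1)] with n hn
    exact (hf.lt_iff_lt (hu n) hb0).1 hn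

/-- Exponential rescaling of an absolutely continuous function. -/
theorem exp_mul_eq_integral {x φ : ℝ → ℝ} {x₀ : ℝ} (κ : ℝ) {t : ℝ} (ht : 0 ≤ t)
    (hφ : IntervalIntegrable φ volume 0 t)
    (hx : ∀ s ∈ Icc 0 t, x s = x₀ + ∫ u in (0 : ℝ)..s, φ u) :
    Real.exp (κ * t) * x t = x₀ + ∫ s in (0 : ℝ)..t, Real.exp (κ * s) * (κ * x s + φ s) := by
  set y : ℝ → ℝ := fun s => x₀ + ∫ u in (0 : ℝ)..s, φ u with hy
  have h1 : AbsolutelyContinuousOnInterval (fun s => Real.exp (κ * s)) 0 t :=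
    -- The identity is the product rule for absolutely continuous functions, integrated.
    ContDiffOn.absolutelyContinuousOnInterval (ContDiff.contDiffOn (n := 1) (by fun_prop))
  have h2 : AbsolutelyContinuousOnInterval y 0 t :=
    (LipschitzOnWith.absolutelyContinuousOnInterval (K := 0)
      ((LipschitzWith.const x₀).lipschitzOnWith)).add
      (hφ.absolutelyContinuousOnInterval_intervalIntegral left_mem_uIcc)
  have h3 := h1.integral_deriv_mul_eq_sub h2
  have h4 : ∫ s in (0 : ℝ)..t, (deriv (fun s => Real.exp (κ * s)) s * y s +
      Real.exp (κ * s) * deriv y s) =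
      ∫ s in (0 : ℝ)..t, Real.exp (κ * s) * (κ * x s + φ s) := by
    refine intervalIntegral.integral_congr_ae ?_
    filter_upwards [hφ.ae_hasDerivAt_integral] with s hs hm
    have hm' := uIoc_subset_uIcc hm
    have d1 : deriv y s = φ s := ((hs hm' 0 left_mem_uIcc).const_add x₀).deriv
    have d2 : HasDerivAt (fun s => Real.exp (κ * s)) (Real.exp (κ * s) * κ) s := by
      simpa using ((hasDerivAt_id s).const_mul κ).exp
    rw [uIcc_of_le ht] at hm'
    rw [d1, d2.deriv, hx s hm', hy]
    ring
  have h5 : y t = x t := (hx t ⟨ht, le_rfl⟩).symm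
  have h6 : y 0 = x₀ := by simp [hy]
  rw [h4, h5, h6] at h3
  simp only [mul_zero, Real.exp_zero, one_mul] at h3
  linarith

/-! ### Mild solutions and monotone iteration -/

namespace DelayModel

variable {M : DelayModel}

theorem tendsto_delayTerm (hM : M.Standing) {y : ℕ → ℝ → ℝ} {g x : ℝ → ℝ} {s : ℝ} (hs : 0 ≤ s)
    (hy : ∀ n, M.LocInt (y n)) (hg : M.LocInt g)
    (hb : ∀ n, ∀ᵐ u, u ∈ Ioo (-M.T) s → |y n u| ≤ g u)
    (hlim : ∀ᵐ u, u ∈ Ioo (-M.T) s → Tendsto (fun n => y n u) atTop (𝓝 (x u))) :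
    Tendsto (fun n => M.delayTerm (y n) s) atTop (𝓝 (M.delayTerm x s)) := by
  obtain ⟨A, hA0, hA⟩ := hM.exists_kernel_bound
  have hT := hM.T_pos
  have hne : ∀ᵐ u : ℝ, u ≠ 0 := by simp [ae_iff]
  have hmem : ∀ ξ, ξ ≠ 0 → ξ ∈ uIoc (-M.T) 0 → s + ξ ∈ Ioo (-M.T) s ∧ ξ ∈ Icc (-M.T) 0 := by
    intro ξ h0 hξ
    rw [uIoc_of_le (by linarith)] at hξ
    have := lt_of_le_of_ne hξ.2 h0
    exact ⟨⟨by linarith [hξ.1], by linarith⟩, hξ.1.le, hξ.2⟩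
  refine intervalIntegral.tendsto_integral_filter_of_dominated_convergence
    (fun ξ => A * g (s + ξ)) (Eventually.of_forall fun n => ?_) (Eventually.of_forall fun n => ?_)
    ?_ ?_
  · have := delay_intervalIntegrable hM (hy n) hs
    rw [uIoc_of_le (by linarith)]
    exact this.1.aestronglyMeasurable
  · have h := (measurePreserving_add_left volume s).quasiMeasurePreserving.ae (hb n)
    filter_upwards [h, hne] with ξ h1 h2 h3
    obtain ⟨m1, m2⟩ := hmem ξ h2 h3
    rw [Real.norm_eq_abs, abs_mul]
    exact mul_le_mul (hA ξ m2) (h1 m1) (abs_nonneg _) hA0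
  · exact ((hg.shift hT hs) 0 le_rfl).const_mul A
  · have h := (measurePreserving_add_left volume s).quasiMeasurePreserving.ae hlim
    filter_upwards [h, hne] with ξ h1 h2 h3
    exact (h1 (hmem ξ h2 h3).1).const_mul _

theorem continuous_f₀_truncated (hM : M.Standing) :
    Continuous fun p : ℝ × ℝ => M.f₀ (max p.1 0) p.2 :=
  (f₀_continuousOn hM).comp_continuous (f := fun p : ℝ × ℝ => (max p.1 0, p.2)) (by fun_prop)
    fun p => ⟨mem_Ici.2 (le_max_right _ _), mem_univ _⟩

theorem tendsto_rate (hM : M.Standing) (κ : ℝ) {y : ℕ → ℝ → ℝ} {g x : ℝ → ℝ} {s : ℝ} (hs : 0 ≤ s)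
    (hy : ∀ n, M.LocInt (y n)) (hg : M.LocInt g)
    (hb : ∀ n, ∀ᵐ u, u ∈ Ioo (-M.T) s → |y n u| ≤ g u)
    (hlim : ∀ᵐ u, u ∈ Ioo (-M.T) s → Tendsto (fun n => y n u) atTop (𝓝 (x u)))
    (hx : Tendsto (fun n => y n s) atTop (𝓝 (x s))) :
    Tendsto (fun n => M.rate κ (y n) s) atTop (𝓝 (M.rate κ x s)) :=
  (hx.const_mul _).add (((continuous_f₀_truncated hM).tendsto (x s, M.delayTerm x s)).comp
    (hx.prodMk_nhds (tendsto_delayTerm hM hs hy hg hb hlim)))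

/-- Production is nondecreasing in the delay term but only Lipschitz in the current state. Adding `κ
x` with `κ = |r| + K` compensates any decrease in the state, which makes the right-hand side
monotone. -/
theorem exists_rate_mono (hM : M.Standing) : ∃ κ, 0 ≤ κ ∧ ∀ (x y : ℝ → ℝ) (s : ℝ), M.LocInt x →
    M.LocInt y → 0 ≤ s → x s ≤ y s → (∀ᵐ u, u ∈ Icc (-M.T) s → x u ≤ y u) →
    M.rate κ x s ≤ M.rate κ y s := by
  obtain ⟨K, hK0, hK⟩ := hM.exists_lipschitz
  refine ⟨|M.r| + K, by positivity, fun x y s hx hy hs hxy hae => ?_⟩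
  have h1 := hM.f₀_mono (max (x s) 0) (le_max_right _ _) (delayTerm_mono hM hx hy hs hae)
  have h2 := hK (max (x s) 0) (max (y s) 0) (M.delayTerm y s) (M.delayTerm y s) (le_max_right _ _)
    (le_max_right _ _)
  have h3 : |max (x s) 0 - max (y s) 0| ≤ y s - x s := by
    have := abs_max_sub_max_le_abs (x s) (y s) 0
    rwa [abs_sub_comm (x s), abs_of_nonneg (sub_nonneg.2 hxy)] at this
  rw [sub_self, abs_zero, add_zero] at h2
  have h4 := (abs_le.1 (h2.trans (mul_le_mul_of_nonneg_left h3 hK0))).2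
  have h5 : 0 ≤ (|M.r| + M.r) * (y s - x s) :=
    mul_nonneg (by linarith [neg_abs_le M.r]) (sub_nonneg.2 hxy)
  simp only [rate]
  nlinarith

/-- Continuity of the trajectory is not assumed: this will be applied to almost everywhere limits of
trajectories. -/
theorem rate_intervalIntegrable (hM : M.Standing) (κ : ℝ) {x : ℝ → ℝ} (hx : M.LocInt x) {t : ℝ}
    (ht : 0 ≤ t) : IntervalIntegrable (M.rate κ x) volume 0 t := by
  obtain ⟨K, hK0, hK⟩ := hM.exists_lipschitz
  have hxi : IntervalIntegrable x volume 0 t :=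
    hx.mono_interval hM.T_pos (by linarith [hM.T_pos]) ht
  have hdc : ContinuousOn (M.delayTerm x) (uIcc 0 t) :=
    (delayTerm_continuousOn hM hx).mono (by rw [uIcc_of_le ht]; exact Icc_subset_Ici_self)
  refine (hxi.const_mul _).add ?_
  have hb : IntervalIntegrable (fun s => |M.f₀ 0 0| + K * (|x s| + |M.delayTerm x s|)) volume 0 t :=
    intervalIntegrable_const.add ((hxi.abs.add hdc.intervalIntegrable.abs).const_mul K)
  refine hb.mono_fun' ?_ (Eventually.of_forall fun s => ?_)
  · rw [uIoc_of_le ht]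
    refine (continuous_f₀_truncated hM).comp_aestronglyMeasurable
      (hxi.1.aestronglyMeasurable.prodMk ?_)
    exact ((delayTerm_continuousOn hM hx).mono fun s hs => hs.1.le).aestronglyMeasurable
      measurableSet_Ioc
  · have h1 := hK (max (x s) 0) 0 (M.delayTerm x s) 0 (le_max_right _ _) le_rfl
    rw [sub_zero, sub_zero] at h1
    have h2 : |max (x s) 0| ≤ |x s| := by
      rw [abs_of_nonneg (le_max_right _ _)]
      exact max_le (le_abs_self _) (abs_nonneg _)
    have h3 := mul_le_mul_of_nonneg_left (add_le_add_left h2 |M.delayTerm x s|) hK0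
    have h4 := abs_sub_abs_le_abs_sub (M.f₀ (max (x s) 0) (M.delayTerm x s)) (M.f₀ 0 0)
    simp only [Real.norm_eq_abs]
    linarith

/-- The mild form of the state equation with initial state `x` and control `c`. -/
noncomputable def mild (M : DelayModel) (κ : ℝ) (c x y : ℝ → ℝ) (t : ℝ) : ℝ :=
  if t ≤ 0 then x t else
    Real.exp (-(κ * t)) * (x 0 + ∫ s in (0 : ℝ)..t, Real.exp (κ * s) * (M.rate κ y s - c s))

/-- A mild subsolution is dominated by a continuous mild solution. -/
theorem exists_mild_solution_ge (hM : M.Standing) {κ Q β C₀ C₁ : ℝ} (hκ : 0 ≤ κ)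
    (hmono : ∀ (x y : ℝ → ℝ) (s : ℝ), M.LocInt x → M.LocInt y → 0 ≤ s → x s ≤ y s →
      (∀ᵐ u, u ∈ Icc (-M.T) s → x u ≤ y u) → M.rate κ x s ≤ M.rate κ y s)
    {c x y : ℝ → ℝ} (hβ : 1 ≤ β)
    (hsup : ∀ t, 0 ≤ t → |x 0| + C₀ * t + C₁ * (Q * (Real.exp (β * t) / β)) ≤ Q * Real.exp (β * t))
    (hC₀ : 0 ≤ C₀) (hC₁ : 0 ≤ C₁) (hQ : 0 ≤ Q)
    (hrate : ∀ (z : ℝ → ℝ) (s : ℝ), M.LocInt z → EqOn z x (Icc (-M.T) 0) → 0 ≤ s →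
        (∀ᵐ u, u ∈ Icc 0 s → |z u| ≤ Q * Real.exp (β * u)) → |z s| ≤ Q * Real.exp (β * s) →
        |M.rate κ z s| ≤ C₀ + C₁ * (Q * Real.exp (β * s)))
    (hc : ∀ t, 0 ≤ t → IntervalIntegrable c volume 0 t) (hc0 : ∀ t, 0 ≤ t → 0 ≤ c t)
    (hy : M.LocInt y) (hyx : EqOn y x (Icc (-M.T) 0))
    (hyb : ∀ᵐ t, 0 < t → 0 ≤ y t ∧ y t ≤ Q * Real.exp (β * t))
    (hsub : ∀ᵐ t, 0 < t → y t ≤ M.mild κ c x y t) :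
    ∃ z, M.LocInt z ∧ ContinuousOn z (Ici 0) ∧ EqOn z x (Icc (-M.T) 0) ∧
      (∀ᵐ t, 0 < t → y t ≤ z t) ∧ ∀ t, 0 ≤ t → z t = M.mild κ c x z t := by
  have hT := hM.T_pos
  have hne : ∀ᵐ u : ℝ, u ≠ 0 := by simp [ae_iff]
  have hxi : IntervalIntegrable x volume (-M.T) 0 := by
    refine (hy 0 le_rfl).congr fun s hs => ?_
    rw [uIoc_of_le (by linarith)] at hs
    exact hyx ⟨hs.1.le, hs.2⟩
  -- Functions trapped between the subsolution and the supersolution `Q * exp (β t)`. The mild map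
  -- sends this class into itself and is monotone on it.
  set Good : (ℝ → ℝ) → Prop := fun z => M.LocInt z ∧ EqOn z x (Icc (-M.T) 0) ∧
    ∀ᵐ t, 0 < t → y t ≤ z t ∧ z t ≤ Q * Real.exp (β * t) with hGood
  set P := M.mild κ c x with hP
  have habs : ∀ z, Good z → ∀ᵐ t, 0 < t → |z t| ≤ Q * Real.exp (β * t) := by
    intro z hz
    filter_upwards [hz.2.2, hyb] with t h1 h2 h3
    rw [abs_of_nonneg ((h2 h3).1.trans (h1 h3).1)]
    exact (h1 h3).2
  have hint : ∀ z, Good z → ∀ t, 0 ≤ t →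
      IntervalIntegrable (fun s => Real.exp (κ * s) * (M.rate κ z s - c s)) volume 0 t :=
    fun z hz t ht => ((rate_intervalIntegrable hM κ hz.1 ht).sub (hc t ht)).continuousOn_mul
      (Continuous.continuousOn (by fun_prop))
  have hrb : ∀ z, Good z → ∀ᵐ s, 0 < s → |M.rate κ z s| ≤ C₀ + C₁ * (Q * Real.exp (β * s)) := by
    intro z hz
    have ha := habs z hz
    filter_upwards [ha] with s hs h0
    refine hrate z s hz.1 hz.2.1 h0.le ?_ (hs h0)
    filter_upwards [ha, hne] with u hu h1 h2
    exact hu (lt_of_le_of_ne h2.1 h1.symm)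
  have hPle : ∀ t, t ≤ 0 → ∀ z, P z t = x t := fun t ht z => by simp [hP, mild, ht]
  have hPgt : ∀ t, 0 ≤ t → ∀ z, P z t = Real.exp (-(κ * t)) *
      (x 0 + ∫ s in (0 : ℝ)..t, Real.exp (κ * s) * (M.rate κ z s - c s)) := by
    intro t ht z
    rcases ht.lt_or_eq with h | h
    · simp [hP, mild, not_le.2 h]
    · subst h; simp [hP, mild]
  have hup : ∀ z, Good z → ∀ t, 0 < t → P z t ≤ Q * Real.exp (β * t) := by
    intro z hz t ht
    rw [hPgt t ht.le]
    have h1 : ∫ s in (0 : ℝ)..t, Real.exp (κ * s) * (M.rate κ z s - c s) ≤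
        ∫ s in (0 : ℝ)..t, Real.exp (κ * t) * (C₀ + C₁ * (Q * Real.exp (β * s))) := by
      refine intervalIntegral.integral_mono_ae_restrict ht.le (hint z hz t ht.le)
        (Continuous.intervalIntegrable (by fun_prop) _ _) ?_
      refine (ae_restrict_iff' measurableSet_Icc).2 ?_
      filter_upwards [hrb z hz, hne] with s h1 h2 h3
      have h4 := h1 (lt_of_le_of_ne h3.1 h2.symm)
      have h5 := hc0 s h3.1
      have h6 : Real.exp (κ * s) ≤ Real.exp (κ * t) :=
        Real.exp_le_exp.2 (mul_le_mul_of_nonneg_left h3.2 hκ)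
      have h7 : 0 ≤ C₀ + C₁ * (Q * Real.exp (β * s)) := by positivity
      calc Real.exp (κ * s) * (M.rate κ z s - c s)
          ≤ Real.exp (κ * s) * (C₀ + C₁ * (Q * Real.exp (β * s))) :=
            mul_le_mul_of_nonneg_left (by linarith [(abs_le.1 h4).2]) (Real.exp_pos _).le
        _ ≤ _ := mul_le_mul_of_nonneg_right h6 h7
    rw [intervalIntegral.integral_const_mul,
      intervalIntegral.integral_add (Continuous.intervalIntegrable (by fun_prop) _ _)
        (Continuous.intervalIntegrable (by fun_prop) _ _), intervalIntegral.integral_const,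
        intervalIntegral.integral_const_mul, intervalIntegral.integral_const_mul, sub_zero,
        smul_eq_mul] at h1
    have h2 := mul_le_mul_of_nonneg_left (mul_le_mul_of_nonneg_left
        (integral_exp_mul_le (t := t) (by linarith : 0 < β)) hQ) hC₁
    have h3 := hsup t ht.le
    have h4 : 1 ≤ Real.exp (κ * t) := Real.one_le_exp (mul_nonneg hκ ht.le)
    have h5 : x 0 ≤ Real.exp (κ * t) * |x 0| :=
      (le_abs_self _).trans (le_mul_of_one_le_left (abs_nonneg _) h4)
    calc Real.exp (-(κ * t)) * (x 0 + ∫ s in (0 : ℝ)..t, Real.exp (κ * s) * (M.rate κ z s - c s))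
        ≤ Real.exp (-(κ * t)) * (Real.exp (κ * t) * (Q * Real.exp (β * t))) := by
          refine mul_le_mul_of_nonneg_left ?_ (Real.exp_pos _).le
          have h6 : t * C₀ + C₁ * (Q * ∫ s in (0 : ℝ)..t, Real.exp (β * s)) ≤
            Q * Real.exp (β * t) - |x 0| := by linarith
          have h7 := mul_le_mul_of_nonneg_left h6 (Real.exp_pos (κ * t)).le
          linarith
      _ = Q * Real.exp (β * t) := by rw [← mul_assoc, ← Real.exp_add]; simp
  have hmon : ∀ z z', Good z → Good z' → (∀ᵐ t, 0 < t → z t ≤ z' t) → ∀ t, P z t ≤ P z' t := by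
    intro z z' hz hz' hle t
    rcases le_or_gt t 0 with ht | ht
    · rw [hPle t ht, hPle t ht]
    rw [hPgt t ht.le, hPgt t ht.le]
    refine mul_le_mul_of_nonneg_left (add_le_add_right ?_ _) (Real.exp_pos _).le
    refine intervalIntegral.integral_mono_ae_restrict ht.le (hint z hz t ht.le)
      (hint z' hz' t ht.le) ((ae_restrict_iff' measurableSet_Icc).2 ?_)
    filter_upwards [hle, hne] with s h1 h2 h3
    refine mul_le_mul_of_nonneg_left (sub_le_sub_right ?_ _) (Real.exp_pos _).le
    refine hmono z z' s hz.1 hz'.1 h3.1 (h1 (lt_of_le_of_ne h3.1 h2.symm)) ?_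
    filter_upwards [hle] with u h4 h5
    rcases le_or_gt u 0 with h6 | h6
    · rw [hz.2.1 ⟨h5.1, h6⟩, hz'.2.1 ⟨h5.1, h6⟩]
    · exact h4 h6
  have hcont : ∀ z, Good z → ContinuousOn (P z) (Ici 0) := by
    intro z hz
    have h1 : ContinuousOn (fun t => ∫ s in (0 : ℝ)..t, Real.exp (κ * s) * (M.rate κ z s - c s))
        (Ici 0) := by
      intro t ht
      have h2 := intervalIntegral.continuousOn_primitive_interval (μ := volume) (a := 0)
        (b := t + 1) (f := fun s => Real.exp (κ * s) * (M.rate κ z s - c s)) (by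
          have h0 : (0 : ℝ) ≤ t + 1 := by linarith [mem_Ici.1 ht]
          rw [uIcc_of_le h0]
          exact (intervalIntegrable_iff_integrableOn_Icc_of_le h0).1 (hint z hz _ h0))
      rw [uIcc_of_le (by linarith [mem_Ici.1 ht])] at h2
      refine (h2 t ⟨ht, by linarith⟩).mono_of_mem_nhdsWithin ?_
      rw [mem_nhdsWithin_iff_exists_mem_nhds_inter]
      exact ⟨Iio (t + 1), Iio_mem_nhds (by linarith), fun u hu => ⟨hu.2, le_of_lt hu.1⟩⟩
    refine ContinuousOn.congr (f := fun t => Real.exp (-(κ * t)) *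
      (x 0 + ∫ s in (0 : ℝ)..t, Real.exp (κ * s) * (M.rate κ z s - c s))) ?_
      fun t ht => hPgt t ht z
    exact (Continuous.continuousOn (by fun_prop)).mul (continuousOn_const.add h1)
  have hgoody : Good y := ⟨hy, hyx, by filter_upwards [hyb] with t h1 h2 using ⟨le_rfl, (h1 h2).2⟩⟩
  have hPx : ∀ z, EqOn (P z) x (Icc (-M.T) 0) := fun z t ht => hPle t ht.2 z
  have hPi : ∀ z, IntervalIntegrable (P z) volume (-M.T) 0 := fun z => by
    refine hxi.congr fun s hs => ?_
    rw [uIoc_of_le (by linarith)] at hs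
    exact (hPx z ⟨hs.1.le, hs.2⟩).symm
  have hgood : ∀ z, Good z → Good (P z) := by
    intro z hz
    refine ⟨LocInt.of_continuousOn (hPi z) (hcont z hz), hPx z, ?_⟩
    have hyz : ∀ᵐ t, 0 < t → y t ≤ z t := by
      filter_upwards [hz.2.2] with t h1 h2 using (h1 h2).1
    filter_upwards [hsub] with t h1 h2
    exact ⟨(h1 h2).trans (hmon y z hgoody hz hyz t), hup z hz t h2⟩
  -- The iteration starts from `P y`, not from `y`: the subsolution property holds only almost
  -- everywhere, whereas the iterates from `P y` on are ordered and bounded at every time.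
  set Y : ℕ → ℝ → ℝ := fun n => P^[n] (P y) with hY
  have hYs : ∀ n, Y (n + 1) = P (Y n) := fun n => Function.iterate_succ_apply' P n (P y)
  have hYg : ∀ n, Good (Y n) := by
    intro n
    induction n with
    | zero => exact hgood y hgoody
    | succ n ih => rw [hYs]; exact hgood _ ih
  have hYm : ∀ t, Monotone fun n => Y n t := by
    have h1 : ∀ n t, Y n t ≤ Y (n + 1) t := by
      intro n
      induction n with
      | zero =>
        intro t
        rw [hYs]
        exact hmon y (P y) hgoody (hgood y hgoody) hsub t
      | succ n ih =>
        intro t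
        rw [hYs, hYs (n + 1)]
        exact hmon _ _ (hYg n) (hYg (n + 1)) (Eventually.of_forall fun u _ => ih u) t
    exact fun t => monotone_nat_of_le_succ fun n => h1 n t
  have hYb : ∀ n t, 0 < t → Y n t ≤ Q * Real.exp (β * t) := by
    intro n t ht
    cases n with
    | zero => exact hup y hgoody t ht
    | succ n => rw [hYs]; exact hup _ (hYg n) t ht
  have hYx : ∀ n t, t ≤ 0 → Y n t = x t := by
    intro n t ht
    cases n with
    | zero => exact hPle t ht y
    | succ n => rw [hYs]; exact hPle t ht _
  set z : ℝ → ℝ := fun t => ⨆ n, Y n t with hz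
  have hzlim : ∀ t, Tendsto (fun n => Y n t) atTop (𝓝 (z t)) := by
    intro t
    refine tendsto_atTop_ciSup (hYm t) ?_
    rcases le_or_gt t 0 with ht | ht
    · exact ⟨x t, by rintro _ ⟨n, rfl⟩; exact (hYx n t ht).le⟩
    · exact ⟨_, by rintro _ ⟨n, rfl⟩; exact hYb n t ht⟩
  have hzx : ∀ t, t ≤ 0 → z t = x t := fun t ht => by simp [hz, hYx _ t ht]
  have hyz : ∀ᵐ t, 0 < t → y t ≤ z t := by
    filter_upwards [(hYg 0).2.2] with t h1 h2
    exact (h1 h2).1.trans ((hYm t).ge_of_tendsto (hzlim t) 0)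
  have hzl : M.LocInt z := by
    intro t ht
    refine IntervalIntegrable.trans (b := 0) ?_ ?_
    · refine hxi.congr fun s hs => ?_
      rw [uIoc_of_le (by linarith)] at hs
      exact (hzx s hs.2).symm
    · refine IntervalIntegrable.mono_fun' (g := fun s => Q * Real.exp (β * s))
        (Continuous.intervalIntegrable (by fun_prop) _ _) ?_ ?_
      · refine aestronglyMeasurable_of_tendsto_ae atTop (f := Y) (fun n => ?_)
          (Eventually.of_forall fun s => hzlim s)
        rw [uIoc_of_le ht]
        exact ((hYg n).1.mono_interval hT (by linarith) ht).1.aestronglyMeasurable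
      · rw [uIoc_of_le ht]
        refine (ae_restrict_iff' measurableSet_Ioc).2 ?_
        filter_upwards [hyz, hyb] with s h1 h2 h3
        rw [Real.norm_eq_abs, abs_of_nonneg ((h2 h3.1).1.trans (h1 h3.1))]
        exact le_of_tendsto' (hzlim s) fun n => hYb n s h3.1
  have hzg : Good z := by
    refine ⟨hzl, fun t ht => hzx t ht.2, ?_⟩
    filter_upwards [hyz] with t h1 h2
    exact ⟨h1 h2, le_of_tendsto' (hzlim t) fun n => hYb n t h2⟩
  set g : ℝ → ℝ := fun t => if t ≤ 0 then |x t| else Q * Real.exp (β * t) with hg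
  have hgl : M.LocInt g := by
    intro t ht
    refine IntervalIntegrable.trans (b := 0) ?_ ?_
    · refine hxi.abs.congr fun s hs => ?_
      rw [uIoc_of_le (by linarith)] at hs
      simp [hg, hs.2]
    · refine (Continuous.intervalIntegrable (u := fun s => Q * Real.exp (β * s)) (by fun_prop)
        0 t).congr fun s hs => ?_
      rw [uIoc_of_le ht] at hs
      simp [hg, not_le.2 hs.1]
  have hYabs : ∀ n, ∀ᵐ u, |Y n u| ≤ g u := by
    intro n
    filter_upwards [habs _ (hYg n)] with u hu
    rcases le_or_gt u 0 with h0 | h0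
    · simp [hg, h0, hYx n u h0]
    · simp [hg, not_le.2 h0, hu h0]
  have hzP : ∀ t, 0 ≤ t → z t = P z t := by
    intro t ht
    have h1 : Tendsto (fun n => Y (n + 1) t) atTop (𝓝 (z t)) :=
      (hzlim t).comp (tendsto_add_atTop_nat 1)
    refine tendsto_nhds_unique h1 ?_
    -- The fixed point equation for the pointwise supremum follows by dominated convergence, with
    -- the rate bound as majorant.
    simp only [hYs, hPgt t ht]
    refine (Tendsto.const_add _ ?_).const_mul _
    refine intervalIntegral.tendsto_integral_filter_of_dominated_convergence
      (fun s => Real.exp (κ * s) * ((C₀ + C₁ * (Q * Real.exp (β * s))) + |c s|))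
      (Eventually.of_forall fun n => ?_) (Eventually.of_forall fun n => ?_) ?_ ?_
    · rw [uIoc_of_le ht]
      exact (hint _ (hYg n) t ht).1.aestronglyMeasurable
    · filter_upwards [hrb _ (hYg n)] with s h1 h2
      rw [uIoc_of_le ht] at h2
      rw [Real.norm_eq_abs, abs_mul, abs_of_pos (Real.exp_pos _)]
      refine mul_le_mul_of_nonneg_left ?_ (Real.exp_pos _).le
      exact (abs_sub _ _).trans (add_le_add_left (h1 h2.1) _)
    · exact ((Continuous.intervalIntegrable (by fun_prop) _ _).add (hc t ht).abs).continuousOn_mul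
        (Continuous.continuousOn (by fun_prop))
    · refine Eventually.of_forall fun s hs => ?_
      rw [uIoc_of_le ht] at hs
      refine ((tendsto_rate hM κ hs.1.le (fun n => (hYg n).1) hgl (fun n => ?_)
        (Eventually.of_forall fun u _ => hzlim u) (hzlim s)).sub_const _).const_mul _
      filter_upwards [hYabs n] with u hu _ using hu
  refine ⟨z, hzl, (hcont z hzg).congr fun t ht => hzP t ht, fun t ht => hzx t ht.2, hyz, hzP⟩

end DelayModel

/-! ### Existence of optimal plans -/

/-- Along a sequence of nonnegative functions with bounded integrals, almost no point escapes to
infinity. -/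
theorem ae_exists_frequently_lt {α : Type*} [MeasurableSpace α] {μ : Measure α}
    {f : ℕ → α → ℝ} {a : ℝ} (hf : ∀ n, Integrable (f n) μ) (h0 : ∀ n, 0 ≤ᵐ[μ] f n)
    (ha : ∀ n, ∫ t, f n t ∂μ ≤ a) : ∀ᵐ t ∂μ, ∃ r, ∃ᶠ n in atTop, f n t < r := by
  have hm : ∀ n, AEMeasurable (fun t => ENNReal.ofReal (f n t)) μ :=
    fun n => (hf n).aestronglyMeasurable.aemeasurable.ennreal_ofReal
  set G : ℕ → α → ENNReal := fun n => (hm n).mk _ with hG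
  -- By Fatou's lemma the lower limit is integrable, hence finite almost everywhere.
  have hlt : ∫⁻ t, liminf (fun n => G n t) atTop ∂μ ≠ ⊤ := by
    refine (lt_of_le_of_lt (lintegral_liminf_le fun n => (hm n).measurable_mk) ?_).ne
    refine lt_of_le_of_lt (b := ENNReal.ofReal a) ?_ ENNReal.ofReal_lt_top
    refine liminf_le_of_le (by isBoundedDefault) fun b hb => ?_
    obtain ⟨n, hn⟩ := hb.exists
    refine hn.trans ?_
    rw [lintegral_congr_ae (hm n).ae_eq_mk.symm,
      ← ofReal_integral_eq_lintegral_ofReal (hf n) (h0 n)]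
    exact ENNReal.ofReal_le_ofReal (ha n)
  have hfin := ae_lt_top (Measurable.liminf fun n => (hm n).measurable_mk) hlt
  filter_upwards [hfin, ae_all_iff.2 fun n => (hm n).ae_eq_mk, ae_all_iff.2 h0] with t h1 h2 h3
  obtain ⟨r, hr1, hr2⟩ := exists_between h1
  refine ⟨r.toReal, (frequently_lt_of_liminf_lt (by isBoundedDefault) hr1).mono fun n hn => ?_⟩
  have h4 : ENNReal.ofReal (f n t) < r := by rw [h2 n]; exact hn
  exact (ENNReal.ofReal_lt_iff_lt_toReal (h3 n) hr2.ne).1 h4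

theorem memLp_two_of_le_exp {f : ℝ → ℝ} {k b : ℝ} (hb : 0 < b)
    (hf : AEStronglyMeasurable f (volume.restrict (Ioi 0)))
    (h : ∀ t, 0 < t → |f t| ≤ k * Real.exp (-b * t)) :
    MemLp f 2 (volume.restrict (Ioi 0)) ∧
      ∫ t in Ioi 0, f t ^ 2 ≤ ∫ t in Ioi 0, (k * Real.exp (-b * t)) ^ 2 := by
  have h1 : IntegrableOn (fun t => (k * Real.exp (-b * t)) ^ 2) (Ioi 0) := by
    have := (exp_neg_integrableOn_Ioi 0 (mul_pos two_pos hb)).const_mul (k ^ 2)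
    refine this.congr (Eventually.of_forall fun t => ?_)
    simp only [mul_pow, ← Real.exp_nat_mul]
    congr 2; push_cast; ring
  have h2 : MemLp (fun t => k * Real.exp (-b * t)) 2 (volume.restrict (Ioi 0)) :=
    (memLp_two_iff_integrable_sq (Continuous.aestronglyMeasurable (by fun_prop))).2 h1
  have h3 : ∀ᵐ t ∂volume.restrict (Ioi 0), |f t| ≤ k * Real.exp (-b * t) :=
    (ae_restrict_iff' measurableSet_Ioi).2 (Eventually.of_forall h)
  have h4 := h2.of_le hf (h3.mono fun t ht => by
    simp only [Real.norm_eq_abs]; exact ht.trans (le_abs_self _))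
  refine ⟨h4, integral_mono_ae h4.integrable_sq h1 (h3.mono fun t ht => ?_)⟩
  exact sq_le_sq' (by linarith [(abs_le.1 ht).1]) (abs_le.1 ht).2

namespace DelayModel

variable {M : DelayModel}

theorem locInt_piecewise (hM : M.Standing) {x f : ℝ → ℝ} (hx : IntervalIntegrable x volume (-M.T) 0)
    (hf : ∀ t, 0 ≤ t → IntervalIntegrable f volume 0 t) :
    M.LocInt (fun t => if t ≤ 0 then x t else f t) := by
  intro t ht
  refine IntervalIntegrable.trans (b := 0) (hx.congr fun s hs => ?_) ((hf t ht).congr fun s hs => ?_)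
  · rw [uIoc_of_le (by linarith [hM.T_pos])] at hs
    simp [hs.2]
  · rw [uIoc_of_le ht] at hs
    simp [not_le.2 hs.1]

theorem IsPlan.mild_eq (hM : M.Standing) {c x : ℝ → ℝ} (h : M.IsPlan c x) (κ : ℝ) {t : ℝ}
    (ht : 0 ≤ t) : Real.exp (κ * t) * x t =
      x 0 + ∫ s in (0 : ℝ)..t, Real.exp (κ * s) * (M.rate κ x s - c s) := by
  rw [exp_mul_eq_integral κ ht (h.rate_int hM le_rfl ht) fun s hs => h.eqn s hs.1]
  congr 1
  refine intervalIntegral.integral_congr fun s hs => ?_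
  rw [uIcc_of_le ht] at hs
  simp only [rate_eq (h.pos s hs.1).le]
  ring

/-- A positive continuous mild solution solves the integrated state equation. -/
theorem isPlan_of_mild (hM : M.Standing) {κ : ℝ} {c x : ℝ → ℝ} (hc0 : ∀ t, 0 ≤ t → 0 ≤ c t)
    (hc : ∀ t, 0 ≤ t → IntervalIntegrable c volume 0 t) (hx : M.LocInt x)
    (hxc : ContinuousOn x (Ici 0)) (hp : ∀ t, 0 ≤ t → 0 < x t)
    (h : ∀ t, 0 ≤ t → Real.exp (κ * t) * x t =
      x 0 + ∫ s in (0 : ℝ)..t, Real.exp (κ * s) * (M.rate κ x s - c s)) : M.IsPlan c x := by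
  refine ⟨hc0, hc, hxc, hx 0 le_rfl, hp, fun t ht => ?_⟩
  have hi : IntervalIntegrable (fun s => Real.exp (κ * s) * (M.rate κ x s - c s)) volume 0 t :=
    ((rate_intervalIntegrable hM κ hx ht).sub (hc t ht)).continuousOn_mul
      (Continuous.continuousOn (by fun_prop))
  have h1 := exp_mul_eq_integral (-κ) ht hi (x := fun s => Real.exp (κ * s) * x s)
    (x₀ := x 0) fun s hs => h s hs.1
  rw [← mul_assoc, ← Real.exp_add, neg_mul, neg_add_cancel, Real.exp_zero, one_mul] at h1
  rw [h1]
  congr 1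
  refine intervalIntegral.integral_congr fun s hs => ?_
  rw [uIcc_of_le ht] at hs
  simp only [rate_eq (hp s hs.1).le]
  have e : Real.exp (-κ * s) * Real.exp (κ * s) = 1 := by
    rw [← Real.exp_add]; simp
  calc _ = (Real.exp (-κ * s) * Real.exp (κ * s)) *
        (-κ * x s + (κ * x s + M.drift x s - c s)) := by ring
    _ = _ := by rw [e]; ring

/-- There is a maximizing sequence whose controls and trajectories converge almost everywhere. -/
theorem Feas.exists_maximizing_seq (hM : M.Standing) {U x : ℝ → ℝ} (hU : IsUtil U)
    (hx : M.Feas U x) : ∃ c y : ℕ → ℝ → ℝ, (∀ n, M.IsPlan (c n) (y n)) ∧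
      (∀ n, EqOn (y n) x (Icc (-M.T) 0)) ∧ (∀ n, IntegrableOn (M.gain U (c n) (y n)) (Ioi 0)) ∧
      (∀ n : ℕ, M.vf U x - 1 / ((n : ℝ) + 1) < ∫ t in Ioi 0, M.gain U (c n) (y n) t) ∧
      (∀ᵐ t, 0 < t → ∃ l, Tendsto (fun n => c n t) atTop (𝓝 l)) ∧
      ∀ᵐ t, 0 < t → ∃ l, Tendsto (fun n => y n t) atTop (𝓝 l) := by
  obtain ⟨B, hB⟩ := hM.U₁_bdd
  have hB0 : 0 ≤ B := (abs_nonneg _).trans (hB 0 le_rfl)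
  obtain ⟨Q, β, C₀, C₁, hQ, hβ, hC₀, hC₁, -, -, hgr⟩ := exists_growth_bound hM 0 le_rfl x
  let ι := {p : (ℝ → ℝ) × (ℝ → ℝ) // M.IsPlan p.1 p.2 ∧ EqOn p.2 x (Icc (-M.T) 0) ∧
    IntegrableOn (M.gain U p.1 p.2) (Ioi 0)}
  -- Consumption is not known to be square integrable, so the first feature uses the bounded
  -- quantity `B - U₁(c)`, convex and decreasing in `c`. The weight `exp (-(β + 1) t)` in the second
  -- beats the growth `exp (β t)` of trajectories.
  set w : ι → ℝ → ℝ := fun p t => Real.exp (-M.ρ * t) * (B - M.U₁ (p.1.1 t)) with hw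
  set z : ι → ℝ → ℝ := fun p t => Real.exp (-(β + 1) * t) * p.1.2 t with hz
  have hwb : ∀ p : ι, ∀ t, 0 < t → |w p t| ≤ 2 * B * Real.exp (-M.ρ * t) := by
    intro p t ht
    have h1 := abs_le.1 (hB _ (p.2.1.nonneg t ht.le))
    rw [hw, abs_mul, abs_of_pos (Real.exp_pos _), mul_comm,
      abs_of_nonneg (by linarith : 0 ≤ B - M.U₁ (p.1.1 t))]
    exact mul_le_mul_of_nonneg_right (by linarith) (Real.exp_pos _).le
  have hzb : ∀ p : ι, ∀ t, 0 < t → |z p t| ≤ Q * Real.exp (-1 * t) := by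
    intro p t ht
    have h1 := hgr _ _ p.2.1 p.2.2.1 t ht.le
    rw [hz, abs_mul, abs_of_pos (Real.exp_pos _), abs_of_pos (p.2.1.pos t ht.le)]
    refine (mul_le_mul_of_nonneg_left h1 (Real.exp_pos _).le).trans (le_of_eq ?_)
    rw [mul_left_comm, ← Real.exp_add]
    congr 2; ring
  have hwm := fun p : ι => memLp_two_of_le_exp hM.ρ_pos ((Continuous.aestronglyMeasurable
    (f := fun t => Real.exp (-M.ρ * t)) (by fun_prop)).mul ((aestronglyMeasurable_const (b := B)).sub
    (aesm_U₁_comp hM p.2.1.nonneg p.2.1.aesm))) (hwb p)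
  have hzm := fun p : ι => memLp_two_of_le_exp one_pos ((Continuous.aestronglyMeasurable
    (f := fun t => Real.exp (-(β + 1) * t)) (by fun_prop)).mul
    ((p.2.1.cont.mono Ioi_subset_Ici_self).aestronglyMeasurable measurableSet_Ioi)) (hzb p)
  obtain ⟨i, hi, hiw, hiz⟩ := exists_maximizing_seq_ae_tendsto (μ := volume.restrict (Ioi 0))
    (w := w) (z := z) (fun p => (hwm p).1) (fun p => (hzm p).1)
    (J := fun p : ι => ∫ t in Ioi 0, M.gain U p.1.1 p.1.2 t) (V := M.vf U x)
    (D := (∫ t in Ioi 0, (2 * B * Real.exp (-M.ρ * t)) ^ 2) + ∫ t in Ioi 0, (Q * Real.exp (-1 * t)) ^ 2)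
    (fun ε hε => by
      obtain ⟨c, y, h1, h2, h3, h4⟩ := hx.exists_lt hM hU hε
      exact ⟨⟨(c, y), h1, h2, h3⟩, h4⟩)
    (fun p => add_le_add (hwm p).2 (hzm p).2)
    (fun p q => by
      obtain ⟨e, he, hle⟩ := p.2.1.mix hM q.2.1 (k := 1 / 2) (l := 1 / 2) (by norm_num)
        (by norm_num) (by norm_num)
      have hgc : ∀ t, 0 < t → 1 / 2 * M.gain U p.1.1 p.1.2 t + 1 / 2 * M.gain U q.1.1 q.1.2 t ≤
          M.gain U e (fun u => 1 / 2 * p.1.2 u + 1 / 2 * q.1.2 u) t := fun t ht =>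
        gain_concave hM hU p.2.1 q.2.1 (by norm_num) (by norm_num) (by norm_num) ht.le (hle t ht.le)
      have hpi := p.2.2.2.const_mul (1 / 2)
      have hqi := q.2.2.2.const_mul (1 / 2)
      have hei := he.integrableOn_of_le hM hU (hpi.add hqi) (Eventually.of_forall hgc)
      refine ⟨⟨(e, fun u => 1 / 2 * p.1.2 u + 1 / 2 * q.1.2 u), he, fun u hu => ?_, hei⟩, ?_, ?_, ?_⟩
      · simp only [p.2.2.1 hu, q.2.2.1 hu]; ring
      · have h1 := setIntegral_mono_on (hpi.add hqi) hei measurableSet_Ioi fun t ht => hgc t ht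
        simp only [Pi.add_apply] at h1
        rw [integral_add hpi hqi, integral_const_mul, integral_const_mul] at h1
        simp only
        linarith
      · refine (ae_restrict_iff' measurableSet_Ioi).2 (Eventually.of_forall fun t ht => ?_)
        have ht0 : 0 ≤ t := le_of_lt ht
        have h0 : 0 ≤ 1 / 2 * p.1.1 t + 1 / 2 * q.1.1 t := by
          linarith [p.2.1.nonneg t ht0, q.2.1.nonneg t ht0]
        have h1 := (U₁_strictMono hM).monotoneOn h0 (he.nonneg t ht0) (hle t ht0)
        have h2 := (U₁_strictConcave hM).concaveOn.2 (p.2.1.nonneg t ht0) (q.2.1.nonneg t ht0)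
          (by norm_num : (0 : ℝ) ≤ 1 / 2) (by norm_num : (0 : ℝ) ≤ 1 / 2) (by norm_num)
        simp only [smul_eq_mul] at h2
        have h3 := abs_le.1 (hB _ (he.nonneg t ht0))
        have h4 := Real.exp_pos (-M.ρ * t)
        refine ⟨mul_nonneg h4.le (by linarith), ?_⟩
        simp only [hw]
        have h5 := mul_le_mul_of_nonneg_left (show B - M.U₁ (e t) ≤
          ((B - M.U₁ (p.1.1 t)) + (B - M.U₁ (q.1.1 t))) / 2 by linarith) h4.le
        linarith
      · refine (ae_restrict_iff' measurableSet_Ioi).2 (Eventually.of_forall fun t ht => ?_)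
        have ht0 : 0 ≤ t := le_of_lt ht
        refine ⟨mul_nonneg (Real.exp_pos _).le (he.pos t ht0).le, le_of_eq ?_⟩
        simp only [hz]
        ring)
  rw [ae_restrict_iff' measurableSet_Ioi] at hiw hiz
  refine ⟨fun n => (i n).1.1, fun n => (i n).1.2, fun n => (i n).2.1, fun n => (i n).2.2.1,
    fun n => (i n).2.2.2, hi, ?_, ?_⟩
  -- Convergence of `U₁(c n t)` does not exclude `c n t → ∞`, as `U₁` is bounded. Total consumption
  -- on `[0, k]` is bounded by initial capital plus accumulated drift, so at almost every time the
  -- controls return infinitely often below some finite level.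
  · have hfr : ∀ k : ℕ, ∀ᵐ t, t ∈ Ioc (0 : ℝ) k → ∃ r, ∃ᶠ n in atTop, (i n).1.1 t < r := by
      intro k
      obtain ⟨R, hR, hdr⟩ := exists_drift_bound hM x k
      rw [← ae_restrict_iff' measurableSet_Ioc]
      refine ae_exists_frequently_lt (a := x 0 + R * k)
        (fun n => ((i n).2.1.ctrl k (Nat.cast_nonneg k)).1) (fun n => ?_) fun n => ?_
      · filter_upwards [ae_restrict_mem measurableSet_Ioc] with t ht
        exact (i n).2.1.nonneg t ht.1.le
      · have hp := (i n).2.1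
        have hk : (0 : ℝ) ≤ k := Nat.cast_nonneg k
        have h1 := hp.eqn k hk
        rw [intervalIntegral.integral_sub (hp.drift_int hM le_rfl hk) (hp.ctrl k hk)] at h1
        have h2 : ∫ s in (0 : ℝ)..k, M.drift (i n).1.2 s ≤ ∫ s in (0 : ℝ)..k, R :=
          intervalIntegral.integral_mono_on hk (hp.drift_int hM le_rfl hk) intervalIntegrable_const
            fun s hs => hdr _ _ hp (i n).2.2.1 s hs
        rw [intervalIntegral.integral_const, smul_eq_mul, sub_zero] at h2
        have h3 := hp.pos k hk
        have h4 : (i n).1.2 0 = x 0 := (i n).2.2.1 ⟨by linarith [hM.T_pos], le_rfl⟩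
        rw [← intervalIntegral.integral_of_le hk]
        linarith
    filter_upwards [hiw, ae_all_iff.2 hfr] with t h1 h2 ht
    obtain ⟨k, hk⟩ := exists_nat_ge t
    obtain ⟨r, hr⟩ := h2 k ⟨ht, hk⟩
    obtain ⟨l, hl⟩ := h1 ht
    refine exists_tendsto_of_strictMonoOn (U₁_strictMono hM) hM.U₁_cont
      (fun n => (i n).2.1.nonneg t ht.le) (l := B - Real.exp (M.ρ * t) * l) ?_ hr
    refine ((hl.const_mul (Real.exp (M.ρ * t))).const_sub B).congr fun n => ?_
    simp only [hw]
    rw [← mul_assoc, ← Real.exp_add]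
    simp
  · filter_upwards [hiz] with t h1 ht
    obtain ⟨l, hl⟩ := h1 ht
    refine ⟨_, (hl.const_mul (Real.exp ((β + 1) * t))).congr fun n => ?_⟩
    simp only [hz]
    rw [← mul_assoc, ← Real.exp_add]
    rw [show (β + 1) * t + -(β + 1) * t = 0 by ring, Real.exp_zero, one_mul]

/-- Existence of an optimal plan. -/
theorem Feas.exists_isOpt (hM : M.Standing) {U x : ℝ → ℝ} (hU : IsUtil U)
    (hnot : ¬ IntegrableAtFilter U (𝓝[>] 0) volume) (hx : M.Feas U x) :
    ∃ c y, EqOn y x (Icc (-M.T) 0) ∧ M.IsOpt U c y := by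
  have hT := hM.T_pos
  have hxi := hx.hist hM
  obtain ⟨c, y, hp, hyx, hgi, hJ, hcl, hyl⟩ := hx.exists_maximizing_seq hM hU
  obtain ⟨κ, hκ0, hmono⟩ := exists_rate_mono hM
  obtain ⟨Q, β, C₀, C₁, hQ, hβ, hC₀, hC₁, hsup, hrate, hgr⟩ := exists_growth_bound hM κ hκ0 x
  obtain ⟨c₀, -, hc₀⟩ := measurable_limit_of_tendsto_metrizable_ae
    (μ := volume.restrict (Ioi (0 : ℝ))) (fun n => (hp n).aesm.aemeasurable)
    ((ae_restrict_iff' measurableSet_Ioi).2 hcl)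
  obtain ⟨y₀, hy₀m, hy₀⟩ := measurable_limit_of_tendsto_metrizable_ae
    (μ := volume.restrict (Ioi (0 : ℝ))) (fun n => (((hp n).cont.mono
      Ioi_subset_Ici_self).aestronglyMeasurable measurableSet_Ioi).aemeasurable)
    ((ae_restrict_iff' measurableSet_Ioi).2 hyl)
  rw [ae_restrict_iff' measurableSet_Ioi] at hc₀ hy₀
  set d : ℝ → ℝ := fun t => max (c₀ t) 0 with hd
  set z : ℝ → ℝ := fun t => if t ≤ 0 then x t else y₀ t with hz
  have hd0 : ∀ t, 0 ≤ t → 0 ≤ d t := fun t _ => le_max_right _ _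
  have hcd : ∀ᵐ t, 0 < t → Tendsto (fun n => c n t) atTop (𝓝 (d t)) := by
    filter_upwards [hc₀] with t h1 h2
    have h3 := h1 h2
    have : 0 ≤ c₀ t := ge_of_tendsto' h3 fun n => (hp n).nonneg t h2.le
    simpa [hd, this] using h3
  have hyz : ∀ᵐ t, 0 < t → Tendsto (fun n => y n t) atTop (𝓝 (z t)) := by
    filter_upwards [hy₀] with t h1 h2
    simpa [hz, not_le.2 h2] using h1 h2
  have hyb : ∀ n t, 0 < t → |y n t| ≤ Q * Real.exp (β * t) := fun n t ht => by
    rw [abs_of_pos ((hp n).pos t ht.le)]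
    exact hgr _ _ (hp n) (hyx n) t ht.le
  have hzb : ∀ᵐ t, 0 < t → 0 ≤ z t ∧ z t ≤ Q * Real.exp (β * t) := by
    filter_upwards [hyz] with t h1 h2
    exact ⟨ge_of_tendsto' (h1 h2) fun n => ((hp n).pos t h2.le).le,
      le_of_tendsto' (h1 h2) fun n => (le_abs_self _).trans (hyb n t h2)⟩
  have hzl : M.LocInt z := by
    refine locInt_piecewise hM hxi fun t ht => ?_
    refine IntervalIntegrable.mono_fun' (g := fun s => Q * Real.exp (β * s))
      (Continuous.intervalIntegrable (by fun_prop) _ _) hy₀m.aestronglyMeasurable ?_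
    rw [uIoc_of_le ht]
    refine (ae_restrict_iff' measurableSet_Ioc).2 ?_
    filter_upwards [hzb] with s h1 h2
    have h3 := h1 h2.1
    simp only [hz, not_le.2 h2.1, if_false] at h3
    rw [Real.norm_eq_abs, abs_of_nonneg h3.1]
    exact h3.2
  have hgl : M.LocInt (fun t => if t ≤ 0 then |x t| else Q * Real.exp (β * t)) :=
    locInt_piecewise hM hxi.abs fun t ht => Continuous.intervalIntegrable (by fun_prop) _ _
  have hx0 : ∀ n, y n 0 = x 0 := fun n => hyx n ⟨by linarith, le_rfl⟩
  -- The drift terms converge by dominated convergence. For consumption Fatou's lemma gives only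
  -- that the limit consumes at most the limit of the integrals, so `z` is merely a mild
  -- subsolution.
  have hgood : ∀ᵐ t, 0 < t → IntervalIntegrable d volume 0 t ∧ z t ≤ M.mild κ d x z t := by
    filter_upwards [hyz] with t hyt ht
    have hmeas : ∀ n, AEStronglyMeasurable (fun s => Real.exp (κ * s) * M.rate κ (y n) s)
        (volume.restrict (uIoc 0 t)) := fun n => by
      rw [uIoc_of_le ht.le]
      exact ((rate_intervalIntegrable hM κ (hp n).locInt ht.le).continuousOn_mul
        (Continuous.continuousOn (f := fun s => Real.exp (κ * s)) (by fun_prop))).1.aestronglyMeasurable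
    have hA : Tendsto (fun n => ∫ s in (0 : ℝ)..t, Real.exp (κ * s) * M.rate κ (y n) s) atTop
        (𝓝 (∫ s in (0 : ℝ)..t, Real.exp (κ * s) * M.rate κ z s)) := by
      refine intervalIntegral.tendsto_integral_filter_of_dominated_convergence
        (fun s => Real.exp (κ * s) * (C₀ + C₁ * (Q * Real.exp (β * s))))
        (Eventually.of_forall hmeas) (Eventually.of_forall fun n => ?_)
        (Continuous.intervalIntegrable (by fun_prop) _ _) ?_
      · refine Eventually.of_forall fun s hs => ?_
        rw [uIoc_of_le ht.le] at hs
        rw [Real.norm_eq_abs, abs_mul, abs_of_pos (Real.exp_pos _)]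
        refine mul_le_mul_of_nonneg_left ?_ (Real.exp_pos _).le
        refine hrate (y n) s (hp n).locInt (hyx n) hs.1.le ?_ (hyb n s hs.1)
        have hne : ∀ᵐ u : ℝ, u ≠ 0 := by simp [ae_iff]
        filter_upwards [hne] with u h1 h2
        exact hyb n u (lt_of_le_of_ne h2.1 h1.symm)
      · filter_upwards [hyz] with s h1 hs
        rw [uIoc_of_le ht.le] at hs
        refine (tendsto_rate hM κ hs.1.le (fun n => (hp n).locInt) hgl (fun n => ?_) ?_
          (h1 hs.1)).const_mul _
        · refine Eventually.of_forall fun u hu => ?_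
          by_cases h0 : u ≤ 0
          · simp only [h0, if_true]
            rw [hyx n ⟨hu.1.le, h0⟩]
          · simp only [h0, if_false]
            exact hyb n u (not_le.1 h0)
        · filter_upwards [hyz] with u h2 hu
          by_cases h0 : u ≤ 0
          · have : z u = x u := by simp [hz, h0]
            rw [this]
            exact tendsto_const_nhds.congr fun n => (hyx n ⟨hu.1.le, h0⟩).symm
          · exact h2 (not_le.1 h0)
    have hci : ∀ n, IntervalIntegrable (fun s => Real.exp (κ * s) * c n s) volume 0 t := fun n =>
      ((hp n).ctrl t ht.le).continuousOn_mul (Continuous.continuousOn (by fun_prop))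
    have ha : ∀ n, ∫ s in (0 : ℝ)..t, Real.exp (κ * s) * c n s = x 0 +
        (∫ s in (0 : ℝ)..t, Real.exp (κ * s) * M.rate κ (y n) s) - Real.exp (κ * t) * y n t := by
      intro n
      have h1 := (hp n).mild_eq hM κ ht.le
      have h2 : IntervalIntegrable (fun s => Real.exp (κ * s) * M.rate κ (y n) s) volume 0 t :=
        (rate_intervalIntegrable hM κ (hp n).locInt ht.le).continuousOn_mul
          (Continuous.continuousOn (by fun_prop))
      simp only [mul_sub] at h1
      rw [intervalIntegral.integral_sub h2 (hci n), hx0 n] at h1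
      linarith
    have hlim := ((hA.const_add (x 0)).sub ((hyt ht).const_mul (Real.exp (κ * t)))).congr
      fun n => (ha n).symm
    simp only [intervalIntegral.integral_of_le ht.le] at hlim
    have hF := integrable_and_integral_le_of_tendsto_ae (μ := volume.restrict (Ioc 0 t))
      (f := fun n s => Real.exp (κ * s) * c n s) (g := fun s => Real.exp (κ * s) * d s)
      (fun n => (hci n).1) (fun n => by
        filter_upwards [ae_restrict_mem measurableSet_Ioc] with s hs
        exact mul_nonneg (Real.exp_pos _).le ((hp n).nonneg s hs.1.le)) (by
        refine (ae_restrict_iff' measurableSet_Ioc).2 ?_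
        filter_upwards [hcd] with s h1 hs
        exact (h1 hs.1).const_mul _) hlim
    rw [← intervalIntegral.integral_of_le ht.le, ← intervalIntegral.integral_of_le ht.le] at hF
    have hdi : IntervalIntegrable (fun s => Real.exp (κ * s) * d s) volume 0 t :=
      (intervalIntegrable_iff_integrableOn_Ioc_of_le ht.le).2 hF.1
    have hd' : IntervalIntegrable d volume 0 t := by
      refine (hdi.continuousOn_mul (g := fun s => Real.exp (-(κ * s)))
        (Continuous.continuousOn (by fun_prop))).congr fun s _ => ?_
      rw [← mul_assoc, ← Real.exp_add]
      simp
    refine ⟨hd', ?_⟩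
    have h2 : IntervalIntegrable (fun s => Real.exp (κ * s) * M.rate κ z s) volume 0 t :=
      (rate_intervalIntegrable hM κ hzl ht.le).continuousOn_mul
        (Continuous.continuousOn (by fun_prop))
    simp only [mild, not_le.2 ht, if_false, mul_sub]
    rw [intervalIntegral.integral_sub h2 hdi]
    have h3 : Real.exp (κ * t) * z t ≤ x 0 + ((∫ s in (0 : ℝ)..t, Real.exp (κ * s) * M.rate κ z s) -
        ∫ s in (0 : ℝ)..t, Real.exp (κ * s) * d s) := by linarith [hF.2]
    have h4 := mul_le_mul_of_nonneg_left h3 (Real.exp_pos (-(κ * t))).le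
    rwa [← mul_assoc, ← Real.exp_add, neg_add_cancel, Real.exp_zero, one_mul] at h4
  have hdi : ∀ t, 0 ≤ t → IntervalIntegrable d volume 0 t := by
    intro t ht
    -- Good times are dense, and integrability up to a later time is enough.
    obtain ⟨t', h1, h2⟩ := (Measure.dense_of_ae hgood).exists_gt t
    refine (h1 (ht.trans_lt h2)).1.mono_set ?_
    rw [uIcc_of_le ht, uIcc_of_le (ht.trans h2.le)]
    exact Icc_subset_Icc_right h2.le
  obtain ⟨X, hXl, hXc, hXx, hzX, hXm⟩ := exists_mild_solution_ge hM hκ0 hmono hβ hsup hC₀ hC₁ hQ hrate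
    hdi hd0 hzl (fun t ht => by simp [hz, ht.2]) hzb (hgood.mono fun t h1 h2 => (h1 h2).2)
  have hX0 : X 0 = x 0 := hXx ⟨by linarith, le_rfl⟩
  have hV : ∀ n, -(|M.vf U x| + 1) ≤ ∫ t in Ioi 0, M.gain U (c n) (y n) t := fun n => by
    have h1 : 1 / ((n : ℝ) + 1) ≤ 1 := by
      rw [div_le_one (by positivity)]; linarith [(Nat.cast_nonneg n : (0 : ℝ) ≤ n)]
    linarith [hJ n, neg_abs_le (M.vf U x)]
  have hlow : ∀ τ, ∃ μ, 0 < μ ∧ ∀ᵐ t, 0 < t → t < τ → μ ≤ z t := by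
    intro τ
    obtain ⟨μ, hμ, h⟩ := exists_lower_bound hM hU hnot x τ (|M.vf U x| + 1)
    refine ⟨μ, hμ, ?_⟩
    filter_upwards [hyz] with t h1 h2 h3
    exact ge_of_tendsto' (h1 h2) fun n => h _ _ (hp n) (hyx n) (hgi n) (hV n) t ⟨h2.le, h3.le⟩
  -- The approximating trajectories are bounded below on bounded intervals, so `z` is, and `X`
  -- dominates `z` almost everywhere. Continuity of `X` removes the exceptional set.
  have hXpos : ∀ t, 0 ≤ t → 0 < X t := by
    intro t ht
    rcases ht.eq_or_lt with h0 | h0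
    · rw [← h0, hX0, ← hx0 0]; exact (hp 0).pos 0 le_rfl
    obtain ⟨μ, hμ, hμz⟩ := hlow (t + 1)
    by_contra! hneg
    have hdense := Measure.dense_of_ae (hμz.and hzX)
    have hcat : ContinuousAt X t := hXc.continuousAt (Ici_mem_nhds h0)
    have hev : ∀ᶠ s in 𝓝 t, X s < μ ∧ 0 < s ∧ s < t + 1 :=
      (hcat.eventually (gt_mem_nhds (hneg.trans_lt hμ))).and
        ((lt_mem_nhds h0).and (gt_mem_nhds (by linarith)))
    obtain ⟨s, hs1, hs2⟩ := hdense.inter_nhds_nonempty hev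
    obtain ⟨hs3, hs4, hs5⟩ := hs2
    linarith [hs1.1 hs4 hs5, hs1.2 hs4]
  have hplan : M.IsPlan d X := by
    refine isPlan_of_mild hM (κ := κ) hd0 hdi hXl hXc hXpos fun t ht => ?_
    rcases ht.eq_or_lt with h0 | h0
    · rw [← h0]; simp
    have h1 := hXm t ht
    simp only [mild, not_le.2 h0, if_false] at h1
    rw [h1, ← mul_assoc, ← Real.exp_add, add_neg_cancel, Real.exp_zero, one_mul, hX0]
  have hzpos : ∀ᵐ t, 0 < t → 0 < z t := by
    have h1 : ∀ᵐ t : ℝ, ∀ k : ℕ, 0 < t → t < k → 0 < z t := by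
      rw [ae_all_iff]
      intro k
      obtain ⟨μ, hμ, h⟩ := hlow k
      filter_upwards [h] with t h2 h3 h4 using hμ.trans_le (h2 h3 h4)
    filter_upwards [h1] with t h2 h3
    obtain ⟨k, hk⟩ := exists_nat_gt t
    exact h2 k h3 hk
  obtain ⟨B, hB⟩ := hM.U₁_bdd
  have hE := (discount_integrable hM).const_mul B
  have hJlim : Tendsto (fun n => ∫ t in Ioi 0, M.gain U (c n) (y n) t) atTop (𝓝 (M.vf U x)) := by
    refine tendsto_of_tendsto_of_tendsto_of_le_of_le
      (g := fun n : ℕ => M.vf U x - 1 / ((n : ℝ) + 1)) (h := fun _ => M.vf U x) ?_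
      tendsto_const_nhds (fun n => (hJ n).le) fun n => (hp n).le_vf hM hU (hyx n) (hgi n)
    simpa using tendsto_one_div_add_atTop_nhds_zero_nat.const_sub (M.vf U x)
  -- Fatou's lemma is applied to the nonnegative gaps `B * exp (-ρ t) - gain`, which yields upper
  -- semicontinuity of the payoff.
  have hfat := integrable_and_integral_le_of_tendsto_ae (μ := volume.restrict (Ioi 0))
    (f := fun n t => B * Real.exp (-M.ρ * t) - M.gain U (c n) (y n) t)
    (g := fun t => B * Real.exp (-M.ρ * t) - M.gain U d z t) (fun n => hE.sub (hgi n))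
    (fun n => by
      filter_upwards [ae_restrict_mem measurableSet_Ioi] with t ht
      exact sub_nonneg.2 ((hp n).gain_le hU hB (le_of_lt ht)))
    (by
      refine (ae_restrict_iff' measurableSet_Ioi).2 ?_
      filter_upwards [hcd, hyz, hzpos] with t h1 h2 h3 ht
      have e1 : Tendsto (fun n => M.U₁ (c n t)) atTop (𝓝 (M.U₁ (d t))) :=
        (hM.U₁_cont (d t) (hd0 t (le_of_lt ht))).tendsto.comp (tendsto_nhdsWithin_iff.2
          ⟨h1 ht, Eventually.of_forall fun n => (hp n).nonneg t (le_of_lt ht)⟩)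
      have e2 : Tendsto (fun n => U (y n t)) atTop (𝓝 (U (z t))) :=
        (hU.cont.continuousAt (Ioi_mem_nhds (h3 ht))).tendsto.comp (h2 ht)
      exact ((e1.add e2).const_mul _).const_sub _)
    ((hJlim.const_sub (∫ t in Ioi 0, B * Real.exp (-M.ρ * t))).congr fun n =>
      (integral_sub hE (hgi n)).symm)
  have hgz : IntegrableOn (M.gain U d z) (Ioi 0) := by
    refine (hE.sub hfat.1).congr (Eventually.of_forall fun t => ?_)
    simp
  have hge : M.vf U x ≤ ∫ t in Ioi 0, M.gain U d z t := by
    have := hfat.2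
    rw [integral_sub hE hgz] at this
    linarith
  -- Replacing `z` by the larger true trajectory keeps the control and can only raise the state
  -- utility.
  have hle : ∀ᵐ t, 0 < t → M.gain U d z t ≤ M.gain U d X t := by
    filter_upwards [hzX, hzpos] with t h1 h2 ht
    have h3 := hU.mono (h2 ht) (hXpos t ht.le) (h1 ht)
    exact mul_le_mul_of_nonneg_left (by linarith) (Real.exp_pos _).le
  have hXi := hplan.integrableOn_of_le hM hU hgz hle
  refine ⟨d, X, hXx, hplan, hXi, le_antisymm (hplan.le_vf hM hU (fun _ _ => rfl) hXi) ?_⟩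
  rw [← vf_congr hM hXx]
  exact hge.trans (setIntegral_mono_ae_restrict hgz hXi
    ((ae_restrict_iff' measurableSet_Ioi).2 hle))

/-! ### Marginal utility of consumption -/

theorem U₁_hasDerivAt (hM : M.Standing) {c : ℝ} (hc : 0 < c) :
    HasDerivAt M.U₁ (deriv M.U₁ c) c :=
  ((hM.U₁_contDiff.differentiableOn (by norm_num)).differentiableAt (Ioi_mem_nhds hc)).hasDerivAt

theorem deriv_U₁_continuousOn (hM : M.Standing) : ContinuousOn (deriv M.U₁) (Ioi 0) :=
  hM.U₁_contDiff.continuousOn_deriv_of_isOpen isOpen_Ioi (by norm_num)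

theorem deriv_U₁_strictAnti (hM : M.Standing) : StrictAntiOn (deriv M.U₁) (Ioi 0) :=
  strictAntiOn_of_deriv_neg (convex_Ioi 0) (deriv_U₁_continuousOn hM) fun x hx => by
    rw [interior_Ioi] at hx; exact hM.U₁_deriv2_neg x hx

theorem mul_deriv_U₁_le (hM : M.Standing) {c k : ℝ} (hc : 0 ≤ c) (hk : 0 < k) :
    k * deriv M.U₁ (c + k) ≤ M.U₁ (c + k) - M.U₁ c := by
  have h := (U₁_strictConcave hM).concaveOn.le_slope_of_hasDerivAt (x := c) (y := c + k) hc
    (mem_Ici.2 (by linarith)) (by linarith) (U₁_hasDerivAt hM (by linarith))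
  rw [slope_def_field, le_div_iff₀ (by linarith)] at h
  linarith

theorem U₁_sub_le (hM : M.Standing) {c k : ℝ} (hc : 0 < c) (hk : 0 ≤ k) :
    M.U₁ k - M.U₁ c ≤ deriv M.U₁ c * (k - c) := by
  rcases lt_trichotomy k c with h | h | h
  · have := mul_deriv_U₁_le hM hk (sub_pos.2 h)
    rw [add_sub_cancel] at this
    linarith
  · simp [h]
  · have h1 := (U₁_strictConcave hM).concaveOn.slope_le_of_hasDerivAt (x := c) (y := k)
      (mem_Ici.2 hc.le) hk h (U₁_hasDerivAt hM hc)
    rwa [slope_def_field, div_le_iff₀ (by linarith)] at h1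

/-- Boundedness of the utility: a marginal utility of at least `p` along an interval of length `2B/p
+ 1` would raise it by more than `2B`. -/
theorem exists_deriv_U₁_lt (hM : M.Standing) {p : ℝ} (hp : 0 < p) :
    ∃ c, 0 < c ∧ deriv M.U₁ c < p := by
  obtain ⟨B, hB⟩ := hM.U₁_bdd
  have hB0 : 0 ≤ B := (abs_nonneg _).trans (hB 0 le_rfl)
  have hk : 0 < 2 * B / p + 1 := by positivity
  refine ⟨0 + (2 * B / p + 1), by linarith, ?_⟩
  have h := mul_deriv_U₁_le hM (c := 0) le_rfl hk
  have h1 := abs_le.1 (hB (0 + (2 * B / p + 1)) (by linarith))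
  have h2 := abs_le.1 (hB 0 le_rfl)
  by_contra! hle
  have h3 := mul_le_mul_of_nonneg_left hle hk.le
  have h4 : (2 * B / p + 1) * p = 2 * B + p := by field_simp
  linarith

/-- The first order condition for the consumption rate is solvable. -/
theorem exists_deriv_U₁_eq (hM : M.Standing) {p : ℝ} (hp : 0 < p) :
    ∃ c, 0 < c ∧ deriv M.U₁ c = p := by
  obtain ⟨c₁, hc₁, h1⟩ := exists_deriv_U₁_lt hM hp
  obtain ⟨c₂, hc₂, h2⟩ := ((hM.U₁_deriv_zero.eventually_gt_atTop p).and
    (Ioo_mem_nhdsGT hc₁)).exists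
  have hsub : Icc c₂ c₁ ⊆ Ioi 0 := fun u hu => h2.1.trans_le hu.1
  obtain ⟨c, hc, h3⟩ := intermediate_value_Icc' h2.2.le ((deriv_U₁_continuousOn hM).mono hsub)
    ⟨h1.le, hc₂.le⟩
  exact ⟨c, hsub hc, h3⟩

/-! ### Lower bound for optimal consumption -/

/-- Lipschitz estimate for the drift along trajectories that differ by a function which vanishes
before time zero and is monotone. -/
theorem exists_drift_lipschitz (hM : M.Standing) : ∃ L, 0 ≤ L ∧ ∀ (x ψ : ℝ → ℝ) (s : ℝ),
    M.LocInt x → Continuous ψ → Monotone ψ → (∀ s, 0 ≤ ψ s) → 0 ≤ s → 0 ≤ x s → ψ s ≤ x s →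
    M.drift x s - L * ψ s ≤ M.drift (fun u => x u - ψ u) s := by
  obtain ⟨A, hA0, hA⟩ := hM.exists_kernel_bound
  obtain ⟨K, hK0, hK⟩ := hM.exists_lipschitz
  have hT := hM.T_pos
  -- Since `ψ` is nondecreasing, its integral over the history window is at most `T * ψ s`. The
  -- nonlocal estimate thus becomes pointwise.
  refine ⟨|M.r| + K + K * A * M.T, by positivity, fun x ψ s hx hψ hm h0 hs hxs hψx => ?_⟩
  have hψl : M.LocInt ψ := fun t _ => hψ.intervalIntegrable _ _
  have h := abs_drift_sub_le hM hA hK0 hK (hx.sub hψl) hx hs (sub_nonneg.2 hψx) hxs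
  have e : ∀ u, |x u - ψ u - x u| = ψ u := fun u => by
    rw [sub_sub_cancel_left, abs_neg, abs_of_nonneg (h0 u)]
  simp only [e] at h
  have h2 : ∫ ξ in (-M.T)..0, ψ (s + ξ) ≤ ∫ ξ in (-M.T)..0, ψ s :=
    intervalIntegral.integral_mono_on (by linarith)
      ((hψ.comp (continuous_const.add continuous_id)).intervalIntegrable _ _)
      intervalIntegrable_const fun ξ hξ => hm (by linarith [hξ.2])
  rw [intervalIntegral.integral_const, smul_eq_mul, zero_sub, neg_neg] at h2
  have h3 := mul_le_mul_of_nonneg_left h2 (mul_nonneg hK0 hA0)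
  linarith [(abs_le.1 h).1]

/-- Stop the trajectory of a plan at time `τ ≥ T`. -/
theorem IsPlan.exists_stopped (hM : M.Standing) {c x : ℝ → ℝ} (h : M.IsPlan c x) {τ : ℝ}
    (hτ : M.T ≤ τ) : ∃ d y, M.IsPlan d y ∧ (∀ t, t ≤ τ → y t = x t) ∧ (∀ t, τ ≤ t → y t = x τ) ∧
      (∀ t, t < τ → d t = c t) ∧ ∀ t, τ ≤ t → d t = M.drift y t := by
  have hT := hM.T_pos
  have hs := h.shift hM (hT.le.trans hτ)
  -- Because `τ ≥ T`, the history window at time `τ` contains only positive values, as freezing the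
  -- state requires.
  have hf := isPlan_freeze hM hs.hist (fun u hu => (h.pos _ (by linarith [hu.1])).le) (hs.pos 0 le_rfl)
  set z : ℝ → ℝ := fun u => if u < 0 then x (τ + u) else x (τ + 0) with hz
  have hzx : EqOn z (fun u => x (τ + u)) (Icc (-M.T) 0) := by
    intro u hu
    rcases hu.2.lt_or_eq with h1 | h1
    · simp [hz, h1]
    · simp [hz, h1]
  have hc := h.concat hM hf (hT.le.trans hτ) hzx
  have e1 : ∀ t, t ≤ τ → (if t < τ then x t else z (t - τ)) = x t := by
    intro t ht
    rcases ht.lt_or_eq with h1 | h1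
    · simp [h1]
    · simp [h1, hz]
  refine ⟨_, _, hc, e1, fun t ht => ?_, fun t ht => ?_, fun t ht => ?_⟩
  · simp [not_lt.2 ht, hz]
  · simp [ht]
  · simp only [not_lt.2 ht, if_false]
    have e2 : t = τ + (t - τ) := by ring
    conv_rhs => rw [e2]
    rw [← drift_shift]
    refine drift_congr_ae hM ?_ (Eventually.of_forall fun u hu => ?_)
    · simp [ht]
    · rcases lt_or_ge u 0 with h1 | h1
      · simp [hz, h1]
      · simp [not_lt.2 h1]

/-- Optimal consumption is bounded away from zero on bounded time intervals. -/
theorem IsOpt.exists_consumption_lower_bound (hM : M.Standing) {U c x : ℝ → ℝ} (hU : IsUtil U)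
    (h : M.IsOpt U c x) (τ₀ : ℝ) : ∃ m, 0 < m ∧ ∀ᵐ t, t ∈ Ioc 0 τ₀ → m ≤ c t := by
  have hT := hM.T_pos
  set τ := max τ₀ M.T with hτd
  have hτ : M.T ≤ τ := le_max_right _ _
  have hτ0 : 0 < τ := hT.trans_le hτ
  obtain ⟨B, hB⟩ := hM.U₁_bdd
  obtain ⟨L, hL0, hL⟩ := exists_drift_lipschitz hM
  -- Stopping at `τ` gives a comparison plan bounded below for all time. It agrees with the optimal
  -- one before `τ`, where the extra consumption takes place.
  obtain ⟨d, y, hp, hyx, hyc, hdc, hdd⟩ := h.plan.exists_stopped hM hτ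
  obtain ⟨t₁, ht₁, hmin⟩ := isCompact_Icc.exists_isMinOn (nonempty_Icc.2 hτ0.le)
    (h.plan.cont.mono fun u (hu : u ∈ Icc 0 τ) => hu.1)
  set μ := x t₁ with hμd
  have hμ : 0 < μ := h.plan.pos _ ht₁.1
  have hyμ : ∀ t, 0 ≤ t → μ ≤ y t := by
    intro t ht
    rcases le_total t τ with h1 | h1
    · rw [hyx t h1]; exact hmin ⟨ht, h1⟩
    · rw [hyc t h1]; exact hmin ⟨hτ0.le, le_rfl⟩
  -- Total extra consumption. The capital it costs grows at most by the factor `exp (L τ)`, so at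
  -- most `μ / 2` is lost.
  set δ := μ / 2 * Real.exp (-(L * τ)) with hδ
  have hδ0 : 0 < δ := by positivity
  set b := U (μ / 2) with hb
  set E₁ := ∫ t in Ioi 0, Real.exp (-M.ρ * t) with hE₁
  -- A threshold for marginal utility: at this level the discounted benefit of consuming `δ` more
  -- exceeds by one the loss caused by leaving the optimal plan.
  set G := (M.vf U x + (B - b) * E₁ + 1) * Real.exp (M.ρ * τ) / δ with hG
  obtain ⟨m₂, hm₂G, hm₂⟩ := ((hM.U₁_deriv_zero.eventually_gt_atTop G).and
    self_mem_nhdsWithin).exists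
  set m := m₂ / 2 with hm
  have hm0 : 0 < m := half_pos hm₂
  refine ⟨m, hm0, ?_⟩
  by_contra hcon
  set c' := h.plan.aesm.mk c with hc'
  have hcc' : ∀ᵐ t, t ∈ Ioi (0 : ℝ) → c t = c' t :=
    (ae_restrict_iff' measurableSet_Ioi).1 h.plan.aesm.ae_eq_mk
  -- If the claim fails, low consumption occurs on a set of positive measure. The measurable version
  -- of the control makes this set measurable; the extra amount `δ` is spread over it at the
  -- constant rate `k`.
  set E : Set ℝ := Ioc 0 τ ∩ c' ⁻¹' Iio m with hE
  have hEm : MeasurableSet E :=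
    measurableSet_Ioc.inter (h.plan.aesm.stronglyMeasurable_mk.measurable measurableSet_Iio)
  have hE0 : volume E ≠ 0 := by
    intro h0
    apply hcon
    filter_upwards [hcc', measure_eq_zero_iff_ae_notMem.1 h0] with t h1 h2 h3
    by_contra! hlt
    exact h2 ⟨⟨h3.1, h3.2.trans (le_max_left _ _)⟩, by rw [mem_preimage, ← h1 h3.1]; exact hlt⟩
  have hEfin : volume E ≠ ⊤ := ((measure_mono inter_subset_left).trans_lt measure_Ioc_lt_top).ne
  set w := volume.real E with hw
  have hw0 : 0 < w := ENNReal.toReal_pos hE0 hEfin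
  set k := δ / w with hk
  have hk0 : 0 < k := div_pos hδ0 hw0
  have hkw : k * w = δ := div_mul_cancel₀ _ hw0.ne'
  -- The rate at which the trajectory is lowered: extra consumption on `E`, plus `L * δ * exp (L
  -- u)`, which covers the drift lost through the lower state. The exponential closes the Gronwall
  -- estimate `ψ s ≤ δ * exp (L s)`.
  set θ : ℝ → ℝ := (Ioc 0 τ).indicator fun u => E.indicator (fun _ => k) u + L * (δ * Real.exp (L * u))
    with hθ
  have hEi : Integrable (E.indicator fun _ => k) :=
    (integrable_indicator_iff hEm).2 (integrableOn_const hEfin)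
  have hEn : ∀ u, 0 ≤ E.indicator (fun _ => k) u := fun u => indicator_nonneg (fun _ _ => hk0.le) u
  have hθi : Integrable θ := by
    refine (integrable_indicator_iff measurableSet_Ioc).2 (hEi.integrableOn.add ?_)
    exact (Continuous.integrableOn_Icc (by fun_prop)).mono_set Ioc_subset_Icc_self
  have hθ0 : ∀ u, 0 ≤ θ u := fun u => indicator_nonneg
    (fun v _ => add_nonneg (hEn v) (by positivity)) u
  set ψ : ℝ → ℝ := fun s => ∫ u in (0 : ℝ)..s, θ u with hψ
  have hψc : Continuous ψ := intervalIntegral.continuous_primitive (fun a b => hθi.intervalIntegrable) 0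
  have hψm : Monotone ψ := by
    intro s t hst
    have e : ψ t - ψ s = ∫ u in s..t, θ u :=
      intervalIntegral.integral_interval_sub_left hθi.intervalIntegrable hθi.intervalIntegrable
    have := intervalIntegral.integral_nonneg (μ := volume) hst fun u _ => hθ0 u
    linarith
  have hψneg : ∀ s, s ≤ 0 → ψ s = 0 := by
    intro s hs
    have : ∀ u ∈ uIcc 0 s, θ u = (fun _ => (0 : ℝ)) u := fun u hu => by
      rw [uIcc_of_ge hs] at hu
      exact indicator_of_notMem (fun h => absurd h.1 (not_lt.2 hu.2)) _
    simp only [hψ]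
    rw [intervalIntegral.integral_congr this]
    simp
  have hψ0 : ∀ s, 0 ≤ ψ s := by
    intro s
    rcases le_total s 0 with h1 | h1
    · rw [hψneg s h1]
    · exact intervalIntegral.integral_nonneg h1 fun u _ => hθ0 u
  have hψle : ∀ s ∈ Icc 0 τ, ψ s ≤ δ * Real.exp (L * s) := by
    intro s hs
    have h1 : ψ s ≤ ∫ u in (0 : ℝ)..s, (E.indicator (fun _ => k) u + L * (δ * Real.exp (L * u))) := by
      refine intervalIntegral.integral_mono_on hs.1 hθi.intervalIntegrable
        (hEi.intervalIntegrable.add (Continuous.intervalIntegrable (by fun_prop) _ _)) fun u _ => ?_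
      refine indicator_le_self' (fun v _ => add_nonneg (hEn v) (by positivity)) u
    have h2 : ∫ u in (0 : ℝ)..s, E.indicator (fun _ => k) u ≤ δ := by
      rw [intervalIntegral.integral_of_le hs.1]
      refine (setIntegral_le_integral hEi (Eventually.of_forall hEn)).trans (le_of_eq ?_)
      rw [integral_indicator hEm, setIntegral_const, smul_eq_mul, mul_comm]
      exact hkw
    have h3 : ∫ u in (0 : ℝ)..s, L * (δ * Real.exp (L * u)) = δ * Real.exp (L * s) - δ := by
      have hder : ∀ u ∈ uIcc 0 s, HasDerivAt (fun v => δ * Real.exp (L * v))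
          (L * (δ * Real.exp (L * u))) u := fun u _ => by
        have := (((hasDerivAt_id u).const_mul L).exp).const_mul δ
        refine this.congr_deriv ?_
        simp; ring
      rw [intervalIntegral.integral_eq_sub_of_hasDerivAt hder
        (Continuous.intervalIntegrable (by fun_prop) _ _)]
      simp
    rw [intervalIntegral.integral_add hEi.intervalIntegrable
      (Continuous.intervalIntegrable (by fun_prop) _ _), h3] at h1
    linarith
  have hψμ : ∀ s, ψ s ≤ μ / 2 := by
    have hτψ : ∀ s, s ≤ τ → ψ s ≤ μ / 2 := by
      intro s hs
      refine (hψm hs).trans ((hψle τ ⟨hτ0.le, le_rfl⟩).trans (le_of_eq ?_))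
      rw [hδ, mul_assoc, ← Real.exp_add]
      simp
    intro s
    rcases le_total s τ with h1 | h1
    · exact hτψ s h1
    · have e : ψ s - ψ τ = ∫ u in τ..s, θ u :=
        intervalIntegral.integral_interval_sub_left hθi.intervalIntegrable hθi.intervalIntegrable
      have e0 : ∫ u in τ..s, θ u = 0 := by
        rw [intervalIntegral.integral_of_le h1]
        refine setIntegral_eq_zero_of_forall_eq_zero fun u hu => ?_
        exact indicator_of_notMem (fun h => absurd h.2 (not_le.2 hu.1)) _
      linarith [hτψ τ le_rfl]
  set z : ℝ → ℝ := fun s => y s - ψ s with hzd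
  have hzμ : ∀ s, 0 ≤ s → μ / 2 ≤ z s := fun s hs => by
    have := hyμ s hs
    have := hψμ s
    simp only [hzd]; linarith
  have hzi : IntervalIntegrable z volume (-M.T) 0 := hp.hist.sub (hψc.intervalIntegrable _ _)
  have hzc : ContinuousOn z (Ici 0) := hp.cont.sub hψc.continuousOn
  have hzl : M.LocInt z := LocInt.of_continuousOn hzi hzc
  -- After `τ` both the stopped trajectory and the perturbation are constant. The lowered trajectory
  -- is kept constant by consuming its drift, nonnegative because the window still lies in positive
  -- times.
  have hdz : ∀ s, τ < s → 0 ≤ M.drift z s := by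
    intro s hs
    have hs0 : 0 ≤ s := hτ0.le.trans hs.le
    have hzs : 0 ≤ z s := (half_pos hμ).le.trans (hzμ s hs0)
    have h1 : 0 ≤ M.delayTerm z s := delayTerm_nonneg hM fun u hu =>
      (half_pos hμ).le.trans (hzμ u (by linarith [hu.1]))
    have h2 := hM.f₀_mono (z s) hzs h1
    have h3 := hM.drift_nonneg (z s) hzs
    simp only [drift]
    linarith
  have hLz : ∀ s, 0 ≤ s → M.drift y s - L * ψ s ≤ M.drift z s := fun s hs =>
    hL y ψ s hp.locInt hψc hψm hψ0 hs (hp.pos s hs).le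
      ((hψμ s).trans (by linarith [hyμ s hs]))
  have hθE : ∀ s ∈ Ioc 0 τ, E.indicator (fun _ => k) s + L * ψ s ≤ θ s := by
    intro s hs
    rw [hθ, indicator_of_mem hs]
    exact add_le_add_right (mul_le_mul_of_nonneg_left (hψle s ⟨hs.1.le, hs.2⟩) hL0) _
  have hpz := hp.perturb hM (y := z) (θ := fun u => -θ u) (fun t _ => hθi.neg.intervalIntegrable)
    hzi hzc (fun t ht => (half_pos hμ).trans_le (hzμ t ht)) (fun t ht => by
      rw [intervalIntegral.integral_neg]
      simp only [hzd, hψneg 0 le_rfl]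
      simp only [hψ]
      ring) (by
      have hne : ∀ᵐ u : ℝ, u ≠ 0 := by simp [ae_iff]
      filter_upwards [hne] with s hs0 hs
      have hs' : 0 < s := lt_of_le_of_ne hs hs0.symm
      rcases le_or_gt s τ with h1 | h1
      · linarith [hLz s hs, hθE s ⟨hs', h1⟩, hEn s, hp.nonneg s hs]
      · rw [hdd s h1.le]
        linarith [hdz s h1, hθ0 s])
  set e := fun s => max (d s + M.drift z s - M.drift y s - -θ s) 0 with he
  have heE : ∀ᵐ s, s ∈ E → c s + k ≤ e s ∧ c s < m := by
    have hne : ∀ᵐ u : ℝ, u ≠ τ := by simp [ae_iff]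
    filter_upwards [hne, hcc'] with s hs hs1 hsE
    have h1 := hθE s hsE.1
    rw [indicator_of_mem hsE] at h1
    refine ⟨le_max_of_le_left ?_, ?_⟩
    · rw [hdc s (lt_of_le_of_ne hsE.1.2 hs)]
      linarith [hLz s hsE.1.1.le]
    · rw [hs1 hsE.1.1]; exact hsE.2
  -- The mixing weight keeps consumption on `E` below `m + m = m₂`, where marginal utility is at
  -- least `D > G`. Benefit and loss are both proportional to `ε`, which therefore cancels in the
  -- final inequality.
  set ε := min 1 (m / k) with hε
  have hε0 : 0 < ε := lt_min one_pos (div_pos hm0 hk0)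
  have hε1 : ε ≤ 1 := min_le_left _ _
  have hεk : ε * k ≤ m := by
    have := mul_le_mul_of_nonneg_right (min_le_right 1 (m / k)) hk0.le
    rwa [div_mul_cancel₀ _ hk0.ne'] at this
  have hεk0 : 0 < ε * k := mul_pos hε0 hk0
  obtain ⟨q, hq, hqle⟩ := h.plan.mix hM hpz (k := 1 - ε) (l := ε) (by linarith) hε0.le (by ring)
  have hqx : EqOn (fun u => (1 - ε) * x u + ε * z u) x (Icc (-M.T) 0) := by
    intro u hu
    simp only [hzd, hψneg u hu.2, hyx u (hu.2.trans hτ0.le)]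
    ring
  have hbn : b ≤ 0 := hU.nonpos _ (half_pos hμ)
  set D := deriv M.U₁ m₂ with hDd
  have hD0 : 0 < D := hM.U₁_deriv_pos _ hm₂
  have hi1 : IntegrableOn (fun t => (1 - ε) * M.gain U c x t) (Ioi 0) := h.integrable.const_mul _
  have hi2 : IntegrableOn (fun t => ε * (-B + b) * Real.exp (-M.ρ * t)) (Ioi 0) :=
    (discount_integrable hM).const_mul _
  have hi3 : IntegrableOn (E.indicator fun _ => Real.exp (-M.ρ * τ) * (ε * k * D)) (Ioi 0) :=
    ((integrable_indicator_iff hEm).2 (integrableOn_const hEfin)).integrableOn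
  have hfin := hq.le_vf_of_le hM hU hqx ((hi1.add hi2).add hi3) (by
    filter_upwards [heE] with t h1 ht
    simp only [Pi.add_apply]
    have ht0 := ht.le
    have hx0 := h.plan.pos t ht0
    have hz0 : 0 < z t := (half_pos hμ).trans_le (hzμ t ht0)
    have hUc := hU.concave.2 hx0 hz0 (by linarith : 0 ≤ 1 - ε) hε0.le (by ring)
    simp only [smul_eq_mul] at hUc
    have hUz : b ≤ U (z t) := hU.mono (half_pos hμ) hz0 (hzμ t ht0)
    have hUz' := mul_le_mul_of_nonneg_left hUz hε0.le
    have hc0 := h.plan.nonneg t ht0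
    have he0 := hpz.nonneg t ht0
    have hcB := abs_le.1 (hB _ hc0)
    have hex := Real.exp_pos (-M.ρ * t)
    have hq0 := hqle t ht0
    have hconv0 : 0 ≤ (1 - ε) * c t + ε * e t :=
      add_nonneg (mul_nonneg (by linarith) hc0) (mul_nonneg hε0.le he0)
    by_cases htE : t ∈ E
    · obtain ⟨h2, h3⟩ := h1 htE
      rw [indicator_of_mem htE]
      have h4 : c t + ε * k ≤ q t := by
        have := mul_le_mul_of_nonneg_left h2 hε0.le
        linarith
      have h5 := (U₁_strictMono hM).monotoneOn (mem_Ici.2 (by linarith)) (hq.nonneg t ht0) h4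
      have h6 := mul_deriv_U₁_le hM hc0 hεk0
      have h7 : D ≤ deriv M.U₁ (c t + ε * k) :=
        (deriv_U₁_strictAnti hM).antitoneOn (mem_Ioi.2 (by linarith)) hm₂ (by
          have : m₂ = m + m := by rw [hm]; ring
          linarith)
      have h8 := mul_le_mul_of_nonneg_left h7 hεk0.le
      have h9 : Real.exp (-M.ρ * τ) ≤ Real.exp (-M.ρ * t) :=
        Real.exp_le_exp.2 (by nlinarith [hM.ρ_pos, htE.1.2])
      have h10 := mul_le_mul_of_nonneg_right h9 (mul_pos hεk0 hD0).le
      have h11 : ε * -B ≤ ε * M.U₁ (c t) := mul_le_mul_of_nonneg_left hcB.1 hε0.le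
      have h12 : (1 - ε) * (M.U₁ (c t) + U (x t)) + ε * (-B + b) + ε * k * D ≤
          M.U₁ (q t) + U ((1 - ε) * x t + ε * z t) := by linarith
      have h13 := mul_le_mul_of_nonneg_left h12 hex.le
      simp only [gain]
      linarith
    · rw [indicator_of_notMem htE, add_zero]
      have h5 := (U₁_strictMono hM).monotoneOn hconv0 (hq.nonneg t ht0) hq0
      have h6 := (U₁_strictConcave hM).concaveOn.2 hc0 he0 (by linarith : 0 ≤ 1 - ε) hε0.le (by ring)
      simp only [smul_eq_mul] at h6
      have h7 : ε * -B ≤ ε * M.U₁ (e t) :=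
        mul_le_mul_of_nonneg_left (abs_le.1 (hB _ he0)).1 hε0.le
      have h12 : (1 - ε) * (M.U₁ (c t) + U (x t)) + ε * (-B + b) ≤
          M.U₁ (q t) + U ((1 - ε) * x t + ε * z t) := by linarith
      have h13 := mul_le_mul_of_nonneg_left h12 hex.le
      simp only [gain]
      linarith)
  have hval := hfin.2
  simp only [Pi.add_apply] at hval
  have hi12 : IntegrableOn (fun t => (1 - ε) * M.gain U c x t + ε * (-B + b) * Real.exp (-M.ρ * t))
      (Ioi 0) := hi1.add hi2
  rw [integral_add hi12 hi3, integral_add hi1 hi2, integral_const_mul, integral_const_mul, h.eq,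
    setIntegral_indicator hEm, inter_eq_self_of_subset_right (s := Ioi 0) (t := E)
      (fun u hu => hu.1.1), setIntegral_const, smul_eq_mul, ← hw, ← hE₁] at hval
  have hexpτ : Real.exp (M.ρ * τ) * Real.exp (-M.ρ * τ) = 1 := by rw [← Real.exp_add]; simp
  have h1 : w * (Real.exp (-M.ρ * τ) * (ε * k * D)) = ε * (Real.exp (-M.ρ * τ) * (δ * D)) := by
    rw [← hkw]; ring
  rw [h1] at hval
  have h2 : ε * (Real.exp (-M.ρ * τ) * (δ * D)) ≤ ε * (M.vf U x + (B - b) * E₁) := by linarith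
  have h3 := le_of_mul_le_mul_left h2 hε0
  have h4 : G * δ = (M.vf U x + (B - b) * E₁ + 1) * Real.exp (M.ρ * τ) := by
    rw [hG, div_mul_cancel₀ _ hδ0.ne']
  have h5 : G * δ < D * δ := mul_lt_mul_of_pos_right hm₂G hδ0
  have h6 := mul_lt_mul_of_pos_left h5 (Real.exp_pos (-M.ρ * τ))
  rw [h4] at h6
  have h7 : Real.exp (-M.ρ * τ) * ((M.vf U x + (B - b) * E₁ + 1) * Real.exp (M.ρ * τ)) =
      (M.vf U x + (B - b) * E₁ + 1) * (Real.exp (M.ρ * τ) * Real.exp (-M.ρ * τ)) := by ring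
  rw [h7, hexpτ] at h6
  linarith

end DelayModel

/-! ### Merging nearby initial states into a given trajectory -/

theorem intervalIntegrable_ite_lt (k δ a b : ℝ) :
    IntervalIntegrable (fun s : ℝ => if s < δ then k else 0) volume a b := by
  have h : (fun s : ℝ => if s < δ then k else 0) = (Iio δ).indicator fun _ => k := by
    ext s; simp [indicator_apply]
  rw [h, intervalIntegrable_iff]
  exact (integrableOn_const (by simp)).indicator measurableSet_Iio

theorem integral_ite_lt (k : ℝ) {δ t : ℝ} (hδ : 0 ≤ δ) (ht : 0 ≤ t) :
    ∫ s in (0 : ℝ)..t, (if s < δ then k else 0) = k * min t δ := by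
  have h : (fun s : ℝ => if s < δ then k else 0) = (Iio δ).indicator fun _ => k := by
    ext s; simp [indicator_apply]
  rw [h, intervalIntegral.integral_of_le ht, setIntegral_indicator measurableSet_Iio,
    setIntegral_congr_set (t := Ioc 0 (min t δ))]
  · rw [setIntegral_const]
    simp [le_min ht hδ, mul_comm]
  · have e : Ioc 0 (min t δ) = Ioc 0 t ∩ Iic δ := by ext u; simp
    rw [e]
    exact ae_eq_set_inter (ae_eq_refl _) Iio_ae_eq_Iic

namespace DelayModel

variable {M : DelayModel}

/-- The trajectory with initial state `y|_{[-T, 0]}` that merges linearly into `x` over `[0, δ]`. -/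
noncomputable def mergeInto (x y : ℝ → ℝ) (δ : ℝ) (u : ℝ) : ℝ :=
  if u < 0 then y u else x u + (y 0 - x 0) * max (1 - u / δ) 0

theorem mergeInto_of_neg {x y : ℝ → ℝ} {δ u : ℝ} (hu : u < 0) : mergeInto x y δ u = y u := by
  simp [mergeInto, hu]

theorem mergeInto_of_nonneg {x y : ℝ → ℝ} {δ u : ℝ} (hu : 0 ≤ u) :
    mergeInto x y δ u = x u + (y 0 - x 0) * max (1 - u / δ) 0 := by
  simp [mergeInto, not_lt.2 hu]

theorem mergeInto_eqOn (x y : ℝ → ℝ) (δ : ℝ) : EqOn (mergeInto x y δ) y (Icc (-M.T) 0) := by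
  intro u hu
  rcases hu.2.lt_or_eq with h | h
  · exact mergeInto_of_neg h
  · subst h
    simp [mergeInto]

theorem mergeInto_of_ge {x y : ℝ → ℝ} {δ u : ℝ} (hδ : 0 < δ) (hu : δ ≤ u) :
    mergeInto x y δ u = x u := by
  rw [mergeInto_of_nonneg (hδ.le.trans hu), max_eq_right, mul_zero, add_zero]
  rw [sub_nonpos, le_div_iff₀ hδ, one_mul]
  exact hu

theorem abs_mergeInto_sub_le {x y : ℝ → ℝ} {δ u : ℝ} (hδ : 0 < δ) (hu : 0 ≤ u) :
    |mergeInto x y δ u - x u| ≤ if u < δ then |y 0 - x 0| else 0 := by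
  split_ifs with h
  · rw [mergeInto_of_nonneg hu, add_sub_cancel_left, abs_mul]
    refine mul_le_of_le_one_right (abs_nonneg _) ?_
    rw [abs_of_nonneg (le_max_right _ _)]
    exact max_le (by linarith [div_nonneg hu hδ.le]) zero_le_one
  · rw [mergeInto_of_ge hδ (not_lt.1 h)]; simp

theorem mergeInto_continuousOn {x y : ℝ → ℝ} (hx : ContinuousOn x (Ici 0)) (δ : ℝ) :
    ContinuousOn (mergeInto x y δ) (Ici 0) := by
  have h : ContinuousOn (fun u => x u + (y 0 - x 0) * max (1 - u / δ) 0) (Ici 0) :=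
    hx.add (Continuous.continuousOn (by fun_prop))
  exact h.congr fun u hu => mergeInto_of_nonneg hu

theorem mergeInto_hist {x y : ℝ → ℝ} (hy : IntervalIntegrable y volume (-M.T) 0)
    (hT : 0 < M.T) (δ : ℝ) : IntervalIntegrable (mergeInto x y δ) volume (-M.T) 0 := by
  refine hy.congr fun u hu => ?_
  rw [uIoc_of_le (by linarith)] at hu
  exact (mergeInto_eqOn (M := M) x y δ ⟨hu.1.le, hu.2⟩).symm

theorem mergeInto_locInt {x y : ℝ → ℝ} (hx : ContinuousOn x (Ici 0)) (hT : 0 < M.T)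
    (hy : IntervalIntegrable y volume (-M.T) 0) (δ : ℝ) : M.LocInt (mergeInto x y δ) :=
  LocInt.of_continuousOn (mergeInto_hist hy hT δ) (mergeInto_continuousOn hx δ)

/-- The window `[s - T, s]` lies in `[-T, s]`. There the discrepancy consists of that of the initial
histories and a ramp of height at most `|y 0 - x 0|` and length `δ`. -/
theorem mergeInto_history_le (hM : M.Standing) {c x y : ℝ → ℝ} (h : M.IsPlan c x)
    (hy : IntervalIntegrable y volume (-M.T) 0) {δ s : ℝ} (hδ : 0 < δ) (hs : 0 ≤ s) :
    ∫ ξ in (-M.T)..0, |mergeInto x y δ (s + ξ) - x (s + ξ)| ≤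
      (∫ ξ in (-M.T)..0, |y ξ - x ξ|) + δ * |y 0 - x 0| := by
  have hT := hM.T_pos
  have hl := (mergeInto_locInt h.cont hT hy δ).sub h.locInt
  have hi : ∀ {a b : ℝ}, -M.T ≤ a → a ≤ b →
      IntervalIntegrable (fun u => |mergeInto x y δ u - x u|) volume a b := fun ha hab =>
    (hl.mono_interval hT ha hab).abs
  rw [intervalIntegral.integral_comp_add_left (fun u => |mergeInto x y δ u - x u|) s, add_zero]
  have h1 : ∫ u in (s + -M.T)..s, |mergeInto x y δ u - x u| ≤
      ∫ u in (-M.T)..s, |mergeInto x y δ u - x u| := by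
    rw [← intervalIntegral.integral_add_adjacent_intervals (hi le_rfl (by linarith : -M.T ≤ s + -M.T))
      (hi (by linarith) (by linarith))]
    have := intervalIntegral.integral_nonneg (by linarith : -M.T ≤ s + -M.T) (μ := volume)
      fun u _ => abs_nonneg (mergeInto x y δ u - x u)
    linarith
  refine h1.trans ?_
  rw [← intervalIntegral.integral_add_adjacent_intervals (hi le_rfl (by linarith : -M.T ≤ 0))
      (hi (by linarith) hs)]
  refine add_le_add (le_of_eq ?_) ?_
  · refine intervalIntegral.integral_congr fun u hu => ?_
    rw [uIcc_of_le (by linarith)] at hu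
    simp only [mergeInto_eqOn (M := M) x y δ hu]
  · calc ∫ u in (0 : ℝ)..s, |mergeInto x y δ u - x u|
        ≤ ∫ u in (0 : ℝ)..s, (if u < δ then |y 0 - x 0| else 0) :=
          intervalIntegral.integral_mono_on hs (hi (by linarith) hs)
            (intervalIntegrable_ite_lt _ _ _ _) fun u hu => abs_mergeInto_sub_le hδ hu.1
      _ = |y 0 - x 0| * min s δ := integral_ite_lt _ hδ.le hs
      _ ≤ δ * |y 0 - x 0| := by
          rw [mul_comm]
          exact mul_le_mul_of_nonneg_right (min_le_right _ _) (abs_nonneg _)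

/-- The ramp has slope `-(y 0 - x 0) / δ`, so capital in excess of `x 0` is released as consumption
at the opposite rate during `[0, δ)`, up to the change in drift. -/
theorem IsPlan.merge (hM : M.Standing) {c x y : ℝ → ℝ} (h : M.IsPlan c x)
    (hy : IntervalIntegrable y volume (-M.T) 0) {δ : ℝ} (hδ : 0 < δ)
    (hp : ∀ s, 0 ≤ s → 0 < mergeInto x y δ s)
    (hc : ∀ᵐ s, 0 ≤ s → 0 ≤ c s + M.drift (mergeInto x y δ) s - M.drift x s +
      (if s < δ then (y 0 - x 0) / δ else 0)) :
    M.IsPlan (fun s => max (c s + M.drift (mergeInto x y δ) s - M.drift x s +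
      (if s < δ then (y 0 - x 0) / δ else 0)) 0) (mergeInto x y δ) := by
  have e0 : mergeInto x y δ 0 = y 0 := by simp [mergeInto]
  have key := h.perturb hM (y := mergeInto x y δ)
    (θ := fun s => if s < δ then -((y 0 - x 0) / δ) else 0)
    (fun t _ => intervalIntegrable_ite_lt _ _ _ _) (mergeInto_hist hy hM.T_pos δ)
    (mergeInto_continuousOn h.cont δ) hp (fun t ht => ?_) ?_
  · convert key using 4 with s
    split_ifs <;> ring
  · rw [integral_ite_lt _ hδ.le ht, e0, mergeInto_of_nonneg ht]
    rcases le_total t δ with h1 | h1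
    · rw [min_eq_left h1, max_eq_left]
      · field_simp; ring
      · rw [sub_nonneg, div_le_iff₀ hδ]; linarith
    · rw [min_eq_right h1, max_eq_right]
      · field_simp; ring
      · rw [sub_nonpos, le_div_iff₀ hδ]; linarith
  · filter_upwards [hc] with s hs hs0
    have := hs hs0
    split_ifs at this ⊢ <;> linarith

/-- By concavity the slopes beyond `μ` are at most that of a chord from `μ / 2`, whose rise is at
most `-U (μ / 2)` since `U ≤ 0`. -/
theorem IsUtil.exists_lipschitz {U : ℝ → ℝ} (hU : IsUtil U) {μ : ℝ} (hμ : 0 < μ) :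
    ∃ K, 0 ≤ K ∧ ∀ u v, μ ≤ u → μ ≤ v → U u - U v ≤ K * |u - v| := by
  have h0 : U (μ / 2) ≤ 0 := hU.nonpos _ (half_pos hμ)
  have hK : 0 ≤ -U (μ / 2) / (μ / 2) := div_nonneg (by linarith) (by linarith)
  refine ⟨_, hK, fun u v hu hv => ?_⟩
  rcases le_or_gt u v with h | h
  · have := hU.mono (mem_Ioi.2 (hμ.trans_le hu)) (mem_Ioi.2 (hμ.trans_le hv)) h
    have := mul_nonneg hK (abs_nonneg (u - v))
    linarith
  · have h1 := hU.concave.slope_anti_adjacent (mem_Ioi.2 (half_pos hμ))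
      (mem_Ioi.2 (hμ.trans_le hu)) (by linarith : μ / 2 < v) h
    have hv0 : U v ≤ 0 := hU.nonpos _ (hμ.trans_le hv)
    have h2 : (U v - U (μ / 2)) / (v - μ / 2) ≤ -U (μ / 2) / (μ / 2) := by
      refine (div_le_div_of_nonneg_right (by linarith : U v - U (μ / 2) ≤ -U (μ / 2))
        (by linarith)).trans ?_
      exact div_le_div_of_nonneg_left (by linarith) (by linarith) (by linarith)
    rw [abs_of_pos (sub_pos.2 h)]
    exact (div_le_iff₀ (sub_pos.2 h)).1 (h1.trans h2)

/-- The tangent at `q` does the work, so only `q`, the consumption of the perturbed plan, has to be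
bounded away from zero. -/
theorem U₁_sub_le_of_le (hM : M.Standing) {m p q E : ℝ} (hm : 0 < m) (hp : 0 ≤ p) (hq : m ≤ q)
    (hE : 0 ≤ E) (hpq : p - E ≤ q) : M.U₁ p - M.U₁ q ≤ deriv M.U₁ m * E := by
  have hq0 := hm.trans_le hq
  have h1 := U₁_sub_le hM hq0 hp
  have h2 : deriv M.U₁ q ≤ deriv M.U₁ m :=
    (deriv_U₁_strictAnti hM).antitoneOn (mem_Ioi.2 hm) (mem_Ioi.2 hq0) hq
  have h3 := hM.U₁_deriv_pos q hq0
  have h4 := hM.U₁_deriv_pos m hm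
  rcases le_total (p - q) 0 with h | h
  · nlinarith [mul_nonneg h4.le hE]
  · calc M.U₁ p - M.U₁ q ≤ deriv M.U₁ q * (p - q) := h1
      _ ≤ deriv M.U₁ m * E := mul_le_mul h2 (by linarith) h h4.le

theorem IsPlan.discount_U₁_integrableOn (hM : M.Standing) {c x : ℝ → ℝ} (h : M.IsPlan c x) (k : ℝ) :
    IntegrableOn (fun t => Real.exp (-M.ρ * t) * M.U₁ (max (c t + k) 0)) (Ioi 0) := by
  obtain ⟨B, hB⟩ := hM.U₁_bdd
  refine Integrable.mono' ((discount_integrable hM).const_mul B) ?_ ?_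
  · refine AEStronglyMeasurable.mul (Continuous.aestronglyMeasurable (by fun_prop)) ?_
    have hc : Continuous fun k => M.U₁ (max k 0) :=
      hM.U₁_cont.comp_continuous (by fun_prop) fun k =>
        mem_Ici.2 (le_max_right _ _)
    exact hc.comp_aestronglyMeasurable (h.aesm.add aestronglyMeasurable_const)
  · refine Eventually.of_forall fun t => ?_
    rw [Real.norm_eq_abs, abs_mul, abs_of_pos (Real.exp_pos _), mul_comm]
    exact mul_le_mul_of_nonneg_right (hB _ (le_max_right _ _)) (Real.exp_pos _).le

theorem IsPlan.discount_U₁_diff_intervalIntegrable (hM : M.Standing) {c x : ℝ → ℝ}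
    (h : M.IsPlan c x) (k : ℝ) {δ : ℝ} (hδ : 0 ≤ δ) :
    IntervalIntegrable (fun t => Real.exp (-M.ρ * t) * (M.U₁ (max (c t + k) 0) - M.U₁ (c t)))
      volume 0 δ := by
  have h1 := ((h.discount_U₁_integrableOn hM k).sub (h.discount_U₁_integrableOn hM 0)).mono_set
    (Ioc_subset_Ioi_self : Ioc 0 δ ⊆ Ioi 0)
  rw [intervalIntegrable_iff_integrableOn_Ioc_of_le hδ]
  refine h1.congr_fun (fun t ht => ?_) measurableSet_Ioc
  simp only [Pi.sub_apply, add_zero, max_eq_left (h.nonneg t ht.1.le)]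
  ring

/-- Integrated comparison of two plans whose gains differ by at least `G` on `(0, δ]` minus a
constant loss `k` on `(0, τ]`. -/
theorem IsPlan.add_le_vf (hM : M.Standing) {U c x e z y G : ℝ → ℝ} (hU : IsUtil U)
    (hz : M.IsPlan e z) (hzy : EqOn z y (Icc (-M.T) 0)) (hi : IntegrableOn (M.gain U c x) (Ioi 0))
    {δ τ k : ℝ} (hδ : 0 ≤ δ) (hτ : 0 ≤ τ) (hG : IntervalIntegrable G volume 0 δ)
    (hle : ∀ᵐ t, 0 < t → M.gain U c x t + ((Ioc 0 δ).indicator G t - (Ioc 0 τ).indicator (fun _ => k) t)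
      ≤ M.gain U e z t) :
    M.Feas U y ∧ (∫ t in Ioi 0, M.gain U c x t) + ((∫ t in (0 : ℝ)..δ, G t) - τ * k) ≤ M.vf U y := by
  have h1 : IntegrableOn ((Ioc 0 δ).indicator G) (Ioi 0) :=
    (((intervalIntegrable_iff_integrableOn_Ioc_of_le hδ).1 hG).integrable_indicator
      measurableSet_Ioc).integrableOn
  have h2 : IntegrableOn ((Ioc 0 τ).indicator fun _ => k) (Ioi 0) :=
    ((integrableOn_const (by simp)).integrable_indicator measurableSet_Ioc).integrableOn
  have h12 : IntegrableOn (fun t => (Ioc 0 δ).indicator G t - (Ioc 0 τ).indicator (fun _ => k) t)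
      (Ioi 0) := h1.sub h2
  have key := hz.le_vf_of_le hM hU hzy (hi.add h12) hle
  refine ⟨key.1, le_of_eq_of_le ?_ key.2⟩
  have e1 : ∀ a : ℝ, Ioi (0 : ℝ) ∩ Ioc 0 a = Ioc 0 a := fun a =>
    inter_eq_self_of_subset_right Ioc_subset_Ioi_self
  rw [integral_add' hi h12, integral_sub h1 h2, setIntegral_indicator measurableSet_Ioc,
    setIntegral_indicator measurableSet_Ioc, e1, e1, intervalIntegral.integral_of_le hδ,
    setIntegral_const]
  simp [hτ]

/-- Lower bound for the value near a state along which a plan keeps consumption and the state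
bounded away from zero. -/
theorem exists_merge_estimate (hM : M.Standing) {U : ℝ → ℝ} (hU : IsUtil U) {m μ : ℝ} (hm : 0 < m)
    (hμ : 0 < μ) : ∃ C, 0 ≤ C ∧ ∀ δ, 0 < δ → δ ≤ M.T → ∃ d₁, 0 < d₁ ∧ ∀ c x y : ℝ → ℝ,
      M.IsPlan c x → IntegrableOn (M.gain U c x) (Ioi 0) →
      (∀ᵐ t, t ∈ Ioc 0 (2 * M.T) → m ≤ c t) → (∀ t ∈ Icc 0 M.T, μ ≤ x t) →
      IntervalIntegrable y volume (-M.T) 0 → |y 0 - x 0| ≤ d₁ →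
      (∫ ξ in (-M.T)..0, |y ξ - x ξ|) ≤ d₁ →
      M.Feas U y ∧ (∫ t in Ioi 0, M.gain U c x t) +
        (∫ t in (0 : ℝ)..δ, Real.exp (-M.ρ * t) *
          (M.U₁ (max (c t + (y 0 - x 0) / δ) 0) - M.U₁ (c t))) -
        C * (δ * |y 0 - x 0| + ∫ ξ in (-M.T)..0, |y ξ - x ξ|) ≤ M.vf U y := by
  have hT := hM.T_pos
  obtain ⟨A, hA0, hA⟩ := hM.exists_kernel_bound
  obtain ⟨K, hK0, hK⟩ := hM.exists_lipschitz
  obtain ⟨K₂, hK₂0, hK₂⟩ := hU.exists_lipschitz (half_pos hμ)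
  have hm2 := half_pos hm
  set b := deriv M.U₁ (m / 2) with hb
  have hb0 : 0 < b := hM.U₁_deriv_pos _ hm2
  set L₁ := |M.r| + K with hL₁
  have hL₁0 : 0 ≤ L₁ := by positivity
  set L₂ := K * A with hL₂
  have hL₂0 : 0 ≤ L₂ := by positivity
  -- The losses are priced at marginal utility `b` and at the Lipschitz constant `K₂` of the state
  -- utility. Terms in the current state last for time `δ`, terms in the history for time `2T`.
  refine ⟨b * L₁ + K₂ + 2 * M.T * (b * L₂), by positivity, fun δ hδ hδT => ?_⟩
  -- If both discrepancies are at most `m / 2 / S`, consumption changes by at most `m / 2` and stays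
  -- above `m / 2`.
  set S := 1 / δ + L₁ + L₂ * (1 + δ) with hS
  have hS0 : 0 < S := by positivity
  refine ⟨min (μ / 2) (m / 2 / S), by positivity, ?_⟩
  intro c x y h hi hcm hxμ hy hd hD
  set d := y 0 - x 0 with hdd
  set D := ∫ ξ in (-M.T)..0, |y ξ - x ξ| with hDD
  have hD0 : 0 ≤ D := intervalIntegral.integral_nonneg (by linarith) fun _ _ => abs_nonneg _
  have hdμ : |d| ≤ μ / 2 := hd.trans (min_le_left _ _)
  have hsmall : |d| / δ + (L₁ * |d| + L₂ * (D + δ * |d|)) ≤ m / 2 := by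
    have h1 : |d| ≤ m / 2 / S := hd.trans (min_le_right _ _)
    have h2 : D ≤ m / 2 / S := hD.trans (min_le_right _ _)
    calc |d| / δ + (L₁ * |d| + L₂ * (D + δ * |d|))
        ≤ (m / 2 / S) / δ + (L₁ * (m / 2 / S) + L₂ * (m / 2 / S + δ * (m / 2 / S))) := by gcongr
      _ = m / 2 / S * S := by rw [hS]; ring
      _ = m / 2 := div_mul_cancel₀ _ hS0.ne'
  set z := mergeInto x y δ with hz
  have hlz : M.LocInt z := mergeInto_locInt h.cont hT hy δ
  have hzx : ∀ t, 0 ≤ t → |z t - x t| ≤ if t < δ then |d| else 0 := fun t ht =>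
    abs_mergeInto_sub_le hδ ht
  have hzμ : ∀ t, 0 ≤ t → t < δ → μ / 2 ≤ z t := by
    intro t ht htδ
    have h1 := hzx t ht
    rw [if_pos htδ] at h1
    linarith [abs_le.1 h1, hxμ t ⟨ht, htδ.le.trans hδT⟩]
  have hzp : ∀ t, 0 ≤ t → 0 < z t := by
    intro t ht
    rcases lt_or_ge t δ with h1 | h1
    · linarith [hzμ t ht h1]
    · rw [hz, mergeInto_of_ge hδ h1]; exact h.pos t ht
  have hdr : ∀ t, 0 ≤ t → |M.drift z t - M.drift x t| ≤
      L₁ * (if t < δ then |d| else 0) + L₂ * (D + δ * |d|) := by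
    intro t ht
    refine (abs_drift_sub_le hM hA hK0 hK hlz h.locInt ht (hzp t ht).le (h.pos t ht).le).trans ?_
    have := hzx t ht
    have := mergeInto_history_le hM h hy hδ ht
    gcongr
  -- From time `δ + T ≤ 2T` on, the history window no longer sees the ramp.
  have hdr0 : ∀ t, 2 * M.T ≤ t → M.drift z t = M.drift x t := by
    intro t ht
    refine drift_congr_ae hM (mergeInto_of_ge hδ (by linarith)) (Eventually.of_forall fun u hu => ?_)
    exact mergeInto_of_ge hδ (by linarith [hu.1])
  set w : ℝ → ℝ := fun s => c s + M.drift z s - M.drift x s + (if s < δ then d / δ else 0) with hw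
  have hpt : ∀ᵐ t, 0 < t → 0 ≤ w t ∧ M.gain U c x t + ((Ioc 0 δ).indicator
      (fun t => Real.exp (-M.ρ * t) * (M.U₁ (max (c t + d / δ) 0) - M.U₁ (c t)) -
        (b * L₁ + K₂) * |d|) t - (Ioc 0 (2 * M.T)).indicator (fun _ => b * L₂ * (D + δ * |d|)) t)
      ≤ M.gain U (fun s => max (w s) 0) z t := by
    have hne : ∀ᵐ t : ℝ, t ≠ δ := by simp [ae_iff, measure_singleton]
    filter_upwards [hcm, hne] with t hct htδ ht
    have hex : 0 < Real.exp (-M.ρ * t) := Real.exp_pos _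
    have hex1 : Real.exp (-M.ρ * t) ≤ 1 := Real.exp_le_one_iff.2 (by nlinarith [hM.ρ_pos])
    have hc0 := h.nonneg t ht.le
    have hE2 : 0 ≤ L₂ * (D + δ * |d|) := by positivity
    rcases lt_or_gt_of_ne htδ with h1 | h1
    · have hmem : t ∈ Ioc 0 (2 * M.T) := ⟨ht, by linarith⟩
      rw [indicator_of_mem (show t ∈ Ioc 0 δ from ⟨ht, h1.le⟩), indicator_of_mem hmem]
      have h2 := hdr t ht.le
      rw [if_pos h1] at h2
      have h3 := hct hmem
      have hwt : w t = c t + M.drift z t - M.drift x t + d / δ := by simp [hw, h1]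
      have h4 : |d / δ| ≤ |d| / δ := by rw [abs_div, abs_of_pos hδ]
      have h5 := abs_le.1 h4
      have h6 := abs_le.1 h2
      have hwm : m / 2 ≤ w t := by rw [hwt]; linarith
      have h7 : max (c t + d / δ) 0 = c t + d / δ := max_eq_left (by
        have : 0 ≤ L₁ * |d| := by positivity
        linarith)
      have hE0 : 0 ≤ L₁ * |d| + L₂ * (D + δ * |d|) := by positivity
      have h8 := U₁_sub_le_of_le hM (p := c t + d / δ) (q := w t) hm2
        (by rw [← h7]; exact le_max_right _ _) hwm hE0 (by rw [hwt]; linarith)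
      have h9 := hK₂ (x t) (z t) (by linarith [hxμ t ⟨ht.le, by linarith⟩]) (hzμ t ht.le h1)
      have h10 := hzx t ht.le
      rw [if_pos h1, abs_sub_comm] at h10
      have h11 := h9.trans (mul_le_mul_of_nonneg_left h10 hK₂0)
      refine ⟨by linarith, ?_⟩
      simp only [gain]
      rw [h7, max_eq_left (by linarith : 0 ≤ w t)]
      have h12 := mul_le_mul_of_nonneg_left (add_le_add h8 h11) hex.le
      have h13 : Real.exp (-M.ρ * t) * (b * (L₁ * |d| + L₂ * (D + δ * |d|)) + K₂ * |d|) ≤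
          b * (L₁ * |d| + L₂ * (D + δ * |d|)) + K₂ * |d| :=
        mul_le_of_le_one_left (by positivity) hex1
      linarith
    · rw [indicator_of_notMem (fun hh : t ∈ Ioc 0 δ => absurd hh.2 (not_le.2 h1))]
      have hwt : w t = c t + M.drift z t - M.drift x t := by simp [hw, not_lt.2 h1.le]
      have hzt : z t = x t := mergeInto_of_ge hδ h1.le
      simp only [gain, hzt]
      rcases le_or_gt t (2 * M.T) with h2 | h2
      · have hmem : t ∈ Ioc 0 (2 * M.T) := ⟨ht, h2⟩
        rw [indicator_of_mem hmem]
        have h3 := hct hmem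
        have h4 := hdr t ht.le
        rw [if_neg (not_lt.2 h1.le), mul_zero, zero_add] at h4
        have h5 := abs_le.1 h4
        have h6 : 0 ≤ L₁ * |d| := by positivity
        have h7 : 0 ≤ |d| / δ := by positivity
        have hwm : m / 2 ≤ w t := by rw [hwt]; linarith
        have h8 := U₁_sub_le_of_le hM (p := c t) (q := w t) hm2 hc0 hwm hE2 (by rw [hwt]; linarith)
        refine ⟨by linarith, ?_⟩
        rw [max_eq_left (by linarith : 0 ≤ w t)]
        have h12 := mul_le_mul_of_nonneg_left h8 hex.le
        have h13 : Real.exp (-M.ρ * t) * (b * (L₂ * (D + δ * |d|))) ≤ b * (L₂ * (D + δ * |d|)) :=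
          mul_le_of_le_one_left (by positivity) hex1
        linarith
      · rw [indicator_of_notMem (fun hh : t ∈ Ioc 0 (2 * M.T) => absurd hh.2 (not_le.2 h2))]
        have h3 : w t = c t := by rw [hwt, hdr0 t h2.le]; ring
        rw [h3, max_eq_left hc0]
        exact ⟨hc0, by linarith⟩
  have hplan : M.IsPlan (fun s => max (w s) 0) z := by
    refine h.merge hM hy hδ hzp ?_
    have hne : ∀ᵐ t : ℝ, t ≠ 0 := by simp [ae_iff, measure_singleton]
    filter_upwards [hpt, hne] with t ht ht0 h0
    exact (ht (lt_of_le_of_ne h0 ht0.symm)).1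
  have hGi := h.discount_U₁_diff_intervalIntegrable hM (d / δ) hδ.le
  have key := hplan.add_le_vf hM hU (mergeInto_eqOn x y δ) hi hδ.le (by linarith : 0 ≤ 2 * M.T)
    (hGi.sub intervalIntegrable_const) (hpt.mono fun t ht h0 => (ht h0).2)
  have hval := key.2
  rw [intervalIntegral.integral_sub hGi intervalIntegrable_const,
    intervalIntegral.integral_const, smul_eq_mul] at hval
  refine ⟨key.1, ?_⟩
  have h1 : 0 ≤ (b * L₁ + K₂) * D := by positivity
  linarith

theorem hist_integral_sub_eq_zero {x y : ℝ → ℝ} (hT : 0 < M.T) (h : EqOn y x (Ico (-M.T) 0)) :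
    ∫ ξ in (-M.T)..0, |y ξ - x ξ| = 0 := by
  refine intervalIntegral.integral_zero_ae ?_
  have hne : ∀ᵐ t : ℝ, t ≠ 0 := by simp [ae_iff, measure_singleton]
  filter_upwards [hne] with t ht hm
  rw [uIoc_of_le (by linarith)] at hm
  rw [h ⟨hm.1.le, lt_of_le_of_ne hm.2 ht⟩]; simp

theorem hist_intervalIntegrable_of_eqOn {x y : ℝ → ℝ} (hT : 0 < M.T)
    (hx : IntervalIntegrable x volume (-M.T) 0) (h : EqOn y x (Ico (-M.T) 0)) :
    IntervalIntegrable y volume (-M.T) 0 := by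
  refine hx.congr_ae ((ae_restrict_iff' measurableSet_uIoc).2 ?_)
  have hne : ∀ᵐ t : ℝ, t ≠ 0 := by simp [ae_iff, measure_singleton]
  filter_upwards [hne] with t ht hm
  rw [uIoc_of_le (by linarith)] at hm
  exact (h ⟨hm.1.le, lt_of_le_of_ne hm.2 ht⟩).symm

/-- Raising the initial capital raises the value strictly above the payoff of any given plan. -/
theorem IsPlan.lt_vf_of_lt (hM : M.Standing) {U c x y : ℝ → ℝ} (hU : IsUtil U) (h : M.IsPlan c x)
    (hi : IntegrableOn (M.gain U c x) (Ioi 0)) (hyx : EqOn y x (Ico (-M.T) 0))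
    (hlt : x 0 < y 0) : M.Feas U y ∧ ∫ t in Ioi 0, M.gain U c x t < M.vf U y := by
  have hT := hM.T_pos
  obtain ⟨A, hA0, hA⟩ := hM.exists_kernel_bound
  obtain ⟨K, hK0, hK⟩ := hM.exists_lipschitz
  have hy := hist_intervalIntegrable_of_eqOn hT h.hist hyx
  set d := y 0 - x 0 with hdd
  have hd : 0 < d := sub_pos.2 hlt
  set L₁ := |M.r| + K with hL₁
  have hL₁0 : 0 ≤ L₁ := by positivity
  set L₂ := K * A with hL₂
  have hL₂0 : 0 ≤ L₂ := by positivity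
  -- The ramp releases `(L₁ + L₂ + 1) * d` while the drift falls by at most `(L₁ + L₂) * d`, which
  -- leaves at least `d` of additional consumption on `[0, δ)`.
  set δ := 1 / (L₁ + L₂ + 1) with hδd
  have hS : 0 < L₁ + L₂ + 1 := by positivity
  have hδ : 0 < δ := by positivity
  have hδ1 : δ ≤ 1 := by rw [hδd, div_le_one hS]; linarith
  have hdδ : d / δ = (L₁ + L₂ + 1) * d := by rw [hδd]; field_simp
  set z := mergeInto x y δ with hz
  have hlz : M.LocInt z := mergeInto_locInt h.cont hT hy δ
  have hxz : ∀ u, -M.T ≤ u → x u ≤ z u := by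
    intro u hu
    rcases lt_or_ge u 0 with h1 | h1
    · rw [hz, mergeInto_of_neg h1, hyx ⟨hu, h1⟩]
    · rw [hz, mergeInto_of_nonneg h1]
      have : 0 ≤ d * max (1 - u / δ) 0 := mul_nonneg hd.le (le_max_right _ _)
      linarith
  have hzp : ∀ t, 0 ≤ t → 0 < z t := fun t ht => (h.pos t ht).trans_le (hxz t (by linarith))
  set w : ℝ → ℝ := fun s => c s + M.drift z s - M.drift x s + (if s < δ then d / δ else 0) with hw
  have hcw : ∀ t, 0 ≤ t → c t + (if t < δ then d else 0) ≤ w t := by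
    intro t ht
    rcases lt_or_ge t δ with h1 | h1
    · have h2 := abs_drift_sub_le hM hA hK0 hK hlz h.locInt ht (hzp t ht).le (h.pos t ht).le
      have h3 : |z t - x t| ≤ _ := abs_mergeInto_sub_le hδ ht
      have h4 := mergeInto_history_le hM h hy hδ ht
      rw [if_pos h1, ← hdd, abs_of_pos hd] at h3
      rw [hist_integral_sub_eq_zero hT hyx, zero_add, ← hdd, abs_of_pos hd] at h4
      have h5 : |M.drift z t - M.drift x t| ≤ L₁ * d + L₂ * (δ * d) := h2.trans (by gcongr)
      have h6 : L₂ * (δ * d) ≤ L₂ * d :=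
        mul_le_mul_of_nonneg_left (mul_le_of_le_one_left hd.le hδ1) hL₂0
      simp only [hw, h1, if_true, hdδ]
      linarith [abs_le.1 h5]
    -- After the merger the states agree and the larger history can only increase production.
    · have h2 : M.delayTerm x t ≤ M.delayTerm z t :=
        delayTerm_mono hM h.locInt hlz ht (Eventually.of_forall fun u hu => hxz u hu.1)
      have h3 : z t = x t := mergeInto_of_ge hδ h1
      have h4 := hM.f₀_mono (x t) (h.pos t ht).le h2
      simp only [hw, not_lt.2 h1, if_false, drift, h3]
      linarith
  have hw0 : ∀ t, 0 ≤ t → 0 ≤ w t := by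
    intro t ht
    have := hcw t ht
    have := h.nonneg t ht
    split_ifs at * <;> linarith
  have hplan : M.IsPlan (fun s => max (w s) 0) z :=
    h.merge hM hy hδ hzp (Eventually.of_forall hw0)
  have hpos : ∀ t ∈ Ioo 0 δ,
      0 < Real.exp (-M.ρ * t) * (M.U₁ (max (c t + d) 0) - M.U₁ (c t)) := by
    intro t ht
    have h0 := h.nonneg t ht.1.le
    rw [max_eq_left (by linarith)]
    exact mul_pos (Real.exp_pos _) (sub_pos.2 (U₁_strictMono hM (mem_Ici.2 h0)
      (mem_Ici.2 (by linarith)) (by linarith)))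
  have hGi := h.discount_U₁_diff_intervalIntegrable hM d hδ.le
  have hne : ∀ᵐ t : ℝ, t ≠ δ := by simp [ae_iff, measure_singleton]
  have key := hplan.add_le_vf hM hU (mergeInto_eqOn x y δ) hi (k := 0) hδ.le le_rfl hGi (by
    filter_upwards [hne] with t htδ ht
    have h0 := h.nonneg t ht.le
    have h1 := hcw t ht.le
    have hUU : U (x t) ≤ U (z t) := hU.mono (mem_Ioi.2 (h.pos t ht.le)) (mem_Ioi.2 (hzp t ht.le))
      (hxz t (by linarith))
    have hex : 0 < Real.exp (-M.ρ * t) := Real.exp_pos _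
    simp only [gain, max_eq_left (hw0 t ht.le), indicator_zero, sub_zero]
    rcases lt_or_gt_of_ne htδ with h2 | h2
    · rw [indicator_of_mem (show t ∈ Ioc 0 δ from ⟨ht, h2.le⟩), max_eq_left (by linarith)]
      rw [if_pos h2] at h1
      have h3 := (U₁_strictMono hM).monotoneOn (mem_Ici.2 (by linarith : 0 ≤ c t + d))
        (mem_Ici.2 (hw0 t ht.le)) h1
      have := mul_le_mul_of_nonneg_left (add_le_add h3 hUU) hex.le
      linarith
    · rw [indicator_of_notMem (fun hh : t ∈ Ioc 0 δ => absurd hh.2 (not_le.2 h2)), add_zero]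
      rw [if_neg (not_lt.2 h2.le), add_zero] at h1
      have h3 := (U₁_strictMono hM).monotoneOn (mem_Ici.2 h0) (mem_Ici.2 (hw0 t ht.le)) h1
      exact mul_le_mul_of_nonneg_left (add_le_add h3 hUU) hex.le)
  refine ⟨key.1, lt_of_lt_of_le ?_ key.2⟩
  have := intervalIntegral.intervalIntegral_pos_of_pos_on hGi hpos hδ
  linarith

/-! ### First order expansion of the value function -/

/-- Differentiation under the integral: for small `d` the shifted consumption stays above `m / 2`,
where marginal utility is bounded. -/
theorem IsPlan.hasDerivAt_integral_U₁ (hM : M.Standing) {c x : ℝ → ℝ} (h : M.IsPlan c x) {m δ : ℝ}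
    (hm : 0 < m) (hδ : 0 < δ) (hc : ∀ᵐ t, t ∈ Ioc 0 δ → m ≤ c t) :
    HasDerivAt (fun d => ∫ t in (0 : ℝ)..δ, Real.exp (-M.ρ * t) * M.U₁ (max (c t + d / δ) 0))
        (δ⁻¹ * ∫ t in (0 : ℝ)..δ, Real.exp (-M.ρ * t) * deriv M.U₁ (c t)) 0 := by
  have hm2 := half_pos hm
  have hb0 := hM.U₁_deriv_pos _ hm2
  have hint : ∀ k, IntervalIntegrable
      (fun t => Real.exp (-M.ρ * t) * M.U₁ (max (c t + k) 0)) volume 0 δ := fun k => by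
    rw [intervalIntegrable_iff_integrableOn_Ioc_of_le hδ.le]
    exact (h.discount_U₁_integrableOn hM k).mono_set Ioc_subset_Ioi_self
  have hΙ : uIoc (0 : ℝ) δ = Ioc 0 δ := uIoc_of_le hδ.le
  have hpt : ∀ t, t ∈ Ioc 0 δ → m ≤ c t → ∀ d ∈ Metric.ball (0 : ℝ) (δ * (m / 2)),
      m / 2 < c t + d / δ := by
    intro t _ hct d hd
    rw [mem_ball_zero_iff, Real.norm_eq_abs] at hd
    have h1 : -(m / 2) < d / δ := by
      rw [lt_div_iff₀ hδ]; linarith [(abs_lt.1 hd).1]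
    linarith
  have key := intervalIntegral.hasDerivAt_integral_of_dominated_loc_of_deriv_le (μ := volume)
    (a := 0) (b := δ) (x₀ := (0 : ℝ)) (s := Metric.ball (0 : ℝ) (δ * (m / 2)))
    (F := fun d t => Real.exp (-M.ρ * t) * M.U₁ (max (c t + d / δ) 0))
    (F' := fun d t => Real.exp (-M.ρ * t) * (deriv M.U₁ (c t + d / δ) * δ⁻¹))
    (bound := fun _ => deriv M.U₁ (m / 2) * δ⁻¹)
    (Metric.ball_mem_nhds _ (by positivity))
    (Eventually.of_forall fun d => by rw [hΙ]; exact (hint _).1.aestronglyMeasurable)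
    (hint _) ?_ ?_ intervalIntegrable_const ?_
  · refine key.2.congr_deriv ?_
    rw [← intervalIntegral.integral_const_mul]
    refine intervalIntegral.integral_congr fun t _ => ?_
    simp only [zero_div, add_zero]
    ring
  · rw [hΙ]
    have h1 : Continuous fun k => deriv M.U₁ (max k (m / 2)) :=
      (deriv_U₁_continuousOn hM).comp_continuous (by fun_prop) fun k =>
        mem_Ioi.2 (lt_max_of_lt_right hm2)
    have h2 : AEStronglyMeasurable c (volume.restrict (Ioc 0 δ)) :=
      h.aesm.mono_measure (Measure.restrict_mono Ioc_subset_Ioi_self le_rfl)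
    have h3 : AEStronglyMeasurable (fun t => Real.exp (-M.ρ * t) *
        (deriv M.U₁ (max (c t) (m / 2)) * δ⁻¹)) (volume.restrict (Ioc 0 δ)) :=
      (Continuous.aestronglyMeasurable (by fun_prop)).mul
        ((h1.comp_aestronglyMeasurable h2).mul_const _)
    refine h3.congr ((ae_restrict_iff' measurableSet_Ioc).2 ?_)
    filter_upwards [hc] with t ht htm
    rw [max_eq_left (by linarith [ht htm])]
    simp
  · filter_upwards [hc] with t ht htm d hd
    rw [hΙ] at htm
    have h1 := hpt t htm (ht htm) d hd
    have h2 : deriv M.U₁ (c t + d / δ) ≤ deriv M.U₁ (m / 2) :=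
      (deriv_U₁_strictAnti hM).antitoneOn (mem_Ioi.2 hm2) (mem_Ioi.2 (hm2.trans h1)) h1.le
    have h3 := hM.U₁_deriv_pos _ (hm2.trans h1)
    have h4 : Real.exp (-M.ρ * t) ≤ 1 := Real.exp_le_one_iff.2 (by nlinarith [hM.ρ_pos, htm.1])
    rw [Real.norm_eq_abs, abs_of_nonneg (by positivity)]
    calc Real.exp (-M.ρ * t) * (deriv M.U₁ (c t + d / δ) * δ⁻¹)
        ≤ 1 * (deriv M.U₁ (m / 2) * δ⁻¹) := by gcongr
      _ = _ := one_mul _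
  · filter_upwards [hc] with t ht htm d hd
    rw [hΙ] at htm
    have h1 : 0 < c t + d / δ := hm2.trans (hpt t htm (ht htm) d hd)
    have h2 : HasDerivAt (fun d => c t + d / δ) δ⁻¹ d := by
      simpa [div_eq_mul_inv] using ((hasDerivAt_id d).mul_const δ⁻¹).const_add (c t)
    have h3 : HasDerivAt (fun d => M.U₁ (c t + d / δ)) (deriv M.U₁ (c t + d / δ) * δ⁻¹) d :=
      (U₁_hasDerivAt hM h1).comp d h2
    refine (h3.const_mul (Real.exp (-M.ρ * t))).congr_of_eventuallyEq ?_
    filter_upwards [h2.continuousAt.eventually (lt_mem_nhds h1)] with d' hd'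
    rw [max_eq_left hd'.le]

theorem IsPlan.exists_state_lower_bound {c x : ℝ → ℝ} (h : M.IsPlan c x) {τ : ℝ} (hτ : 0 ≤ τ) :
    ∃ μ, 0 < μ ∧ ∀ t ∈ Icc 0 τ, μ ≤ x t := by
  obtain ⟨t₁, ht₁, hmin⟩ := isCompact_Icc.exists_isMinOn (nonempty_Icc.2 hτ)
    (h.cont.mono fun u (hu : u ∈ Icc 0 τ) => hu.1)
  exact ⟨x t₁, h.pos _ ht₁.1, fun t ht => hmin ht⟩

/-- The merging estimate is linearized in the capital increment `d`. Half of `ε` absorbs its error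
`C δ |d|`, by smallness of `δ`; the other half absorbs the remainder of the derivative at `d = 0`.
The history error keeps a fixed constant. -/
theorem IsOpt.exists_expansion_below (hM : M.Standing) {U c x : ℝ → ℝ} (hU : IsUtil U)
    (h : M.IsOpt U c x) : ∃ C, 0 ≤ C ∧ ∀ ε, 0 < ε → ∃ δ₀, 0 < δ₀ ∧ ∀ δ, 0 < δ → δ ≤ δ₀ →
      ∃ d₀, 0 < d₀ ∧ ∀ y : ℝ → ℝ, IntervalIntegrable y volume (-M.T) 0 → |y 0 - x 0| ≤ d₀ →
      (∫ ξ in (-M.T)..0, |y ξ - x ξ|) ≤ d₀ → M.Feas U y ∧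
      (δ⁻¹ * ∫ t in (0 : ℝ)..δ, Real.exp (-M.ρ * t) * deriv M.U₁ (c t)) * (y 0 - x 0) -
        ε * |y 0 - x 0| - C * (∫ ξ in (-M.T)..0, |y ξ - x ξ|) ≤ M.vf U y - M.vf U x := by
  have hT := hM.T_pos
  obtain ⟨m, hm, hcm⟩ := h.exists_consumption_lower_bound hM hU (2 * M.T)
  obtain ⟨μ, hμ, hxμ⟩ := h.plan.exists_state_lower_bound hT.le
  obtain ⟨C, hC, hmerge⟩ := exists_merge_estimate hM hU hm hμ
  refine ⟨C, hC, fun ε hε => ⟨min M.T (ε / 2 / (C + 1)), by positivity, fun δ hδ hδ₀ => ?_⟩⟩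
  have hδT : δ ≤ M.T := hδ₀.trans (min_le_left _ _)
  have hCδ : C * δ ≤ ε / 2 := by
    have h1 := (le_div_iff₀ (by positivity)).1 (hδ₀.trans (min_le_right _ _))
    nlinarith
  obtain ⟨d₁, hd₁, hest⟩ := hmerge δ hδ hδT
  have hder := h.plan.hasDerivAt_integral_U₁ hM hm hδ (hcm.mono fun t ht hmem =>
    ht ⟨hmem.1, by linarith [hmem.2]⟩)
  have hlit := (hasDerivAt_iff_isLittleO.1 hder).def (half_pos hε)
  obtain ⟨d₂, hd₂, hball⟩ := Metric.eventually_nhds_iff.1 hlit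
  refine ⟨min d₁ (d₂ / 2), by positivity, fun y hy hd hD => ?_⟩
  set d := y 0 - x 0 with hdd
  obtain ⟨hf, hv⟩ := hest c x y h.plan h.integrable hcm hxμ hy (hd.trans (min_le_left _ _))
    (hD.trans (min_le_left _ _))
  refine ⟨hf, ?_⟩
  have h1 := hball (y := d) (by
    rw [Real.dist_eq, sub_zero]
    linarith [hd.trans (min_le_right _ _)])
  simp only [sub_zero, smul_eq_mul, Real.norm_eq_abs] at h1
  have hint : ∀ k, IntervalIntegrable
      (fun t => Real.exp (-M.ρ * t) * M.U₁ (max (c t + k) 0)) volume 0 δ := fun k => by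
    rw [intervalIntegrable_iff_integrableOn_Ioc_of_le hδ.le]
    exact (h.plan.discount_U₁_integrableOn hM k).mono_set Ioc_subset_Ioi_self
  rw [← intervalIntegral.integral_sub (hint _) (hint _)] at h1
  have h2 : ∫ t in (0 : ℝ)..δ, (Real.exp (-M.ρ * t) * M.U₁ (max (c t + d / δ) 0) -
      Real.exp (-M.ρ * t) * M.U₁ (max (c t + 0 / δ) 0)) =
      ∫ t in (0 : ℝ)..δ, Real.exp (-M.ρ * t) * (M.U₁ (max (c t + d / δ) 0) - M.U₁ (c t)) := by
    refine intervalIntegral.integral_congr fun t ht => ?_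
    rw [uIcc_of_le hδ.le] at ht
    simp only [zero_div, add_zero, max_eq_left (h.plan.nonneg t ht.1)]
    ring
  rw [h2] at h1
  rw [h.eq] at hv
  have h3 := (abs_le.1 h1).1
  have h4 : C * δ * |d| ≤ ε / 2 * |d| := mul_le_mul_of_nonneg_right hCδ (abs_nonneg _)
  linarith

/-- First order expansion of the value function at a state with an optimal plan: the value is
differentiable in the initial capital, the derivative is the initial mean marginal utility of
consumption, and the dependence on the history is Lipschitz in `L¹`. -/
theorem IsOpt.exists_expansion (hM : M.Standing) {U c x : ℝ → ℝ} (hU : IsUtil U)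
    (h : M.IsOpt U c x) : ∃ p C, 0 ≤ C ∧
      Tendsto (fun δ => δ⁻¹ * ∫ t in (0 : ℝ)..δ, Real.exp (-M.ρ * t) * deriv M.U₁ (c t))
        (𝓝[>] 0) (𝓝 p) ∧
      ∀ ε, 0 < ε → ∃ d₀, 0 < d₀ ∧ ∀ y : ℝ → ℝ, IntervalIntegrable y volume (-M.T) 0 →
        |y 0 - x 0| ≤ d₀ → (∫ ξ in (-M.T)..0, |y ξ - x ξ|) ≤ d₀ → M.Feas U y ∧
        |M.vf U y - M.vf U x - p * (y 0 - x 0)| ≤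
          ε * |y 0 - x 0| + C * ∫ ξ in (-M.T)..0, |y ξ - x ξ| := by
  have hT := hM.T_pos
  obtain ⟨C, hC, hbelow⟩ := h.exists_expansion_below hM hU
  set q : ℝ → ℝ := fun δ => δ⁻¹ * ∫ t in (0 : ℝ)..δ, Real.exp (-M.ρ * t) * deriv M.U₁ (c t) with hq
  have hx := h.plan.hist
  have htwo : ∀ ε, 0 < ε → ∃ δ₀, 0 < δ₀ ∧ ∀ δ, 0 < δ → δ ≤ δ₀ →
      ∃ d₀, 0 < d₀ ∧ ∀ y : ℝ → ℝ, IntervalIntegrable y volume (-M.T) 0 → |y 0 - x 0| ≤ d₀ →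
      (∫ ξ in (-M.T)..0, |y ξ - x ξ|) ≤ d₀ → M.Feas U y ∧
      |M.vf U y - M.vf U x - q δ * (y 0 - x 0)| ≤
          ε * |y 0 - x 0| + C * ∫ ξ in (-M.T)..0, |y ξ - x ξ| := by
    intro ε hε
    obtain ⟨δ₀, hδ₀, hb⟩ := hbelow ε hε
    refine ⟨δ₀, hδ₀, fun δ hδ hδ' => ?_⟩
    obtain ⟨d₀, hd₀, hb⟩ := hb δ hδ hδ'
    refine ⟨d₀, hd₀, fun y hy hd hD => ?_⟩
    obtain ⟨hf, h1⟩ := hb y hy hd hD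
    -- Reflection of `y` in `x`. As `x` is the midpoint, concavity turns the lower bound at the
    -- reflected state into an upper bound at `y`.
    set y' : ℝ → ℝ := fun u => 2 * x u - y u with hy'
    have e1 : ∀ u, y' u - x u = -(y u - x u) := fun u => by simp only [hy']; ring
    have e2 : ∀ u, |y' u - x u| = |y u - x u| := fun u => by rw [e1, abs_neg]
    obtain ⟨hf', h2⟩ := hb y' ((hx.const_mul 2).sub hy) (by rw [e2]; exact hd)
      (by simp only [e2]; exact hD)
    simp only [e1, abs_neg] at h2
    have h3 := (vf_concave hM hU hf hf' (k := 1 / 2) (l := 1 / 2) (by norm_num) (by norm_num)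
      (by norm_num)).2
    have h4 : (fun u => 1 / 2 * y u + 1 / 2 * y' u) = x := by
      ext u; simp only [hy']; ring
    rw [h4] at h3
    refine ⟨hf, abs_le.2 ⟨?_, ?_⟩⟩ <;> linarith
  -- Means over different short intervals are approximate slopes of the same function, so they are
  -- close to each other. This gives their limit without knowing that the control has one at time
  -- zero.
  have hcauchy : ∀ ε, 0 < ε → ∃ δ₀, 0 < δ₀ ∧ ∀ δ δ', 0 < δ → δ ≤ δ₀ → 0 < δ' → δ' ≤ δ₀ →
      |q δ - q δ'| ≤ ε := by
    intro ε hε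
    obtain ⟨δ₀, hδ₀, hb⟩ := htwo (ε / 2) (half_pos hε)
    refine ⟨δ₀, hδ₀, fun δ δ' hδ hδ1 hδ' hδ1' => ?_⟩
    obtain ⟨d₁, hd₁, hb1⟩ := hb δ hδ hδ1
    obtain ⟨d₂, hd₂, hb2⟩ := hb δ' hδ' hδ1'
    set d := min d₁ d₂ with hd
    have hd0 : 0 < d := lt_min hd₁ hd₂
    set y : ℝ → ℝ := fun u => if u < 0 then x u else x 0 + d with hy
    have hyx : EqOn y x (Ico (-M.T) 0) := fun u hu => by simp [hy, hu.2]
    have e0 : y 0 - x 0 = d := by simp [hy]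
    have e1 := hist_integral_sub_eq_zero hT hyx
    have hyi := hist_intervalIntegrable_of_eqOn hT hx hyx
    have h1 := (hb1 y hyi (by rw [e0, abs_of_pos hd0]; exact min_le_left _ _)
      (by rw [e1]; exact hd₁.le)).2
    have h2 := (hb2 y hyi (by rw [e0, abs_of_pos hd0]; exact min_le_right _ _)
      (by rw [e1]; exact hd₂.le)).2
    rw [e0, e1, abs_of_pos hd0, mul_zero, add_zero] at h1 h2
    have h3 : |q δ - q δ'| * d ≤ ε * d := by
      rw [← abs_of_pos hd0, ← abs_mul, abs_of_pos hd0]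
      have e : (q δ - q δ') * d = (M.vf U y - M.vf U x - q δ' * d) -
          (M.vf U y - M.vf U x - q δ * d) := by ring
      rw [e]
      refine (abs_sub _ _).trans ?_
      linarith
    exact le_of_mul_le_mul_right h3 hd0
  have hC' : Cauchy (map q (𝓝[>] 0)) := by
    rw [Metric.cauchy_iff]
    refine ⟨inferInstance, fun ε hε => ?_⟩
    obtain ⟨δ₀, hδ₀, hb⟩ := hcauchy (ε / 2) (half_pos hε)
    refine ⟨q '' Ioc 0 δ₀, image_mem_map (Ioc_mem_nhdsGT hδ₀), ?_⟩
    rintro _ ⟨δ, hδ, rfl⟩ _ ⟨δ', hδ', rfl⟩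
    rw [Real.dist_eq]
    linarith [hb δ δ' hδ.1 hδ.2 hδ'.1 hδ'.2]
  obtain ⟨p, hp⟩ := cauchy_map_iff_exists_tendsto.1 hC'
  refine ⟨p, C, hC, hp, fun ε hε => ?_⟩
  obtain ⟨δ₀, hδ₀, hb⟩ := htwo (ε / 2) (half_pos hε)
  have h1 := (Metric.tendsto_nhds.1 hp (ε / 2) (half_pos hε)).and (Ioc_mem_nhdsGT hδ₀)
  obtain ⟨δ, hδp, hδ⟩ := h1.exists
  obtain ⟨d₀, hd₀, hb⟩ := hb δ hδ.1 hδ.2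
  refine ⟨d₀, hd₀, fun y hy hd hD => ⟨(hb y hy hd hD).1, ?_⟩⟩
  have h2 := (hb y hy hd hD).2
  rw [Real.dist_eq] at hδp
  have e : M.vf U y - M.vf U x - p * (y 0 - x 0) = (M.vf U y - M.vf U x - q δ * (y 0 - x 0)) +
      (q δ - p) * (y 0 - x 0) := by ring
  rw [e]
  refine (abs_add_le _ _).trans ?_
  rw [abs_mul]
  have h3 := mul_le_mul_of_nonneg_right hδp.le (abs_nonneg (y 0 - x 0))
  linarith

/-! ### Marginal value of capital -/

/-- The value function is finite near the state `x|_{[-T, 0]}`, differentiable there in the initial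
capital with derivative `p`, and Lipschitz there in the history with respect to the `L¹` norm. -/
def HasExpansion (M : DelayModel) (U x : ℝ → ℝ) (p : ℝ) : Prop :=
  IntervalIntegrable x volume (-M.T) 0 ∧ ∃ C, 0 ≤ C ∧
    ∀ ε, 0 < ε → ∃ d₀, 0 < d₀ ∧ ∀ y : ℝ → ℝ, IntervalIntegrable y volume (-M.T) 0 →
      |y 0 - x 0| ≤ d₀ → (∫ ξ in (-M.T)..0, |y ξ - x ξ|) ≤ d₀ → M.Feas U y ∧
      |M.vf U y - M.vf U x - p * (y 0 - x 0)| ≤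
        ε * |y 0 - x 0| + C * ∫ ξ in (-M.T)..0, |y ξ - x ξ|

theorem HasExpansion.feas {U x : ℝ → ℝ} {p : ℝ} (h : M.HasExpansion U x p) : M.Feas U x := by
  obtain ⟨hx, C, -, h⟩ := h
  obtain ⟨d₀, hd₀, h⟩ := h 1 one_pos
  exact (h x hx (by simpa using hd₀.le) (by simpa using hd₀.le)).1

theorem HasExpansion.congr (hM : M.Standing) {U x y : ℝ → ℝ} {p : ℝ} (h : M.HasExpansion U x p)
    (hyx : EqOn y x (Icc (-M.T) 0)) : M.HasExpansion U y p := by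
  have hT := hM.T_pos
  have h0 : y 0 = x 0 := hyx ⟨by linarith, le_rfl⟩
  obtain ⟨hx, C, hC, h⟩ := h
  refine ⟨hist_intervalIntegrable_of_eqOn hT hx (hyx.mono Ico_subset_Icc_self), C, hC,
    fun ε hε => ?_⟩
  obtain ⟨d₀, hd₀, h⟩ := h ε hε
  have e : ∀ z : ℝ → ℝ, ∫ ξ in (-M.T)..0, |z ξ - y ξ| = ∫ ξ in (-M.T)..0, |z ξ - x ξ| := by
    intro z
    refine intervalIntegral.integral_congr fun u hu => ?_
    rw [uIcc_of_le (by linarith)] at hu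
    simp only [hyx hu]
  refine ⟨d₀, hd₀, fun z hz hd hD => ?_⟩
  rw [e, h0, ← vf_congr hM hyx]
  rw [h0] at hd
  rw [e] at hD
  exact h z hz hd hD

/-- The local slope is a global supergradient in the capital direction: along the segment from `x`
to `y` concavity reduces the claim to points near `x`, where the expansion holds. -/
theorem HasExpansion.vf_le (hM : M.Standing) {U x y : ℝ → ℝ} {p : ℝ} (hU : IsUtil U)
    (h : M.HasExpansion U x p) (hy : M.Feas U y) (hyx : EqOn y x (Ico (-M.T) 0)) :
    M.vf U y ≤ M.vf U x + p * (y 0 - x 0) := by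
  have hT := hM.T_pos
  have hx := h.feas
  obtain ⟨hxi, C, -, h⟩ := h
  set d := y 0 - x 0 with hd
  refine le_of_forall_pos_le_add fun ε hε => ?_
  obtain ⟨d₀, hd₀, h⟩ := h (ε / (|d| + 1)) (by positivity)
  set s := min 1 (d₀ / (|d| + 1)) with hs
  have hs0 : 0 < s := by positivity
  have hs1 : s ≤ 1 := min_le_left _ _
  have hsd : s * |d| ≤ d₀ := by
    have h1 := (le_div_iff₀ (by positivity)).1 (min_le_right 1 (d₀ / (|d| + 1)))
    rw [← hs] at h1
    linarith
  obtain ⟨hf, hv⟩ := vf_concave hM hU hx hy (sub_nonneg.2 hs1) hs0.le (by ring)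
  set z : ℝ → ℝ := fun u => (1 - s) * x u + s * y u with hz
  have hzx : EqOn z x (Ico (-M.T) 0) := fun u hu => by simp only [hz, hyx hu]; ring
  have e0 : z 0 - x 0 = s * d := by simp only [hz, hd]; ring
  have e1 := hist_integral_sub_eq_zero hT hzx
  have h1 := (h z (hist_intervalIntegrable_of_eqOn hT hxi hzx)
    (by rw [e0, abs_mul, abs_of_pos hs0]; exact hsd) (by rw [e1]; exact hd₀.le)).2
  rw [e0, e1, mul_zero, add_zero, abs_mul s, abs_of_pos hs0] at h1
  have h2 := (abs_le.1 h1).2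
  have h3 : ε / (|d| + 1) * (s * |d|) ≤ s * ε := by
    rw [div_mul_eq_mul_div, div_le_iff₀ (by positivity)]
    nlinarith [mul_pos hs0 hε]
  have h4 : s * M.vf U y ≤ s * (M.vf U x + p * d + ε) := by linarith
  exact le_of_mul_le_mul_left h4 hs0

/-- One more unit of capital gives a value strictly above the payoff of the optimal plan, and the
supergradient inequality bounds the increase by `p`. -/
theorem HasExpansion.pos (hM : M.Standing) {U c x : ℝ → ℝ} {p : ℝ} (hU : IsUtil U)
    (hopt : M.IsOpt U c x) (h : M.HasExpansion U x p) : 0 < p := by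
  set y : ℝ → ℝ := fun u => if u < 0 then x u else x 0 + 1 with hy
  have hyx : EqOn y x (Ico (-M.T) 0) := fun u hu => by simp [hy, hu.2]
  have e0 : y 0 = x 0 + 1 := by simp [hy]
  obtain ⟨hf, hlt⟩ := hopt.plan.lt_vf_of_lt hM hU hopt.integrable hyx (by rw [e0]; linarith)
  have := h.vf_le hM hU hf hyx
  rw [hopt.eq] at hlt
  rw [e0] at this
  linarith

theorem HasExpansion.hasDerivAt (hM : M.Standing) {U x η₁ : ℝ → ℝ} {p : ℝ}
    (h : M.HasExpansion U x p) (hx : EqOn x η₁ (Ico (-M.T) 0)) :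
    HasDerivAt (fun s => (M.value U s η₁).toReal) p (x 0) := by
  have hT := hM.T_pos
  set y : ℝ → ℝ → ℝ := fun s u => if u < 0 then x u else s with hy
  have hyx : ∀ s, EqOn (y s) x (Ico (-M.T) 0) := fun s u hu => by simp [hy, hu.2]
  have e0 : ∀ s, y s 0 = s := fun s => by simp [hy]
  have hval : (fun s => (M.value U s η₁).toReal) = fun s => M.vf U (y s) := by
    ext s
    rw [vf, value_congr (e0 s) fun u hu => (hyx s hu).trans (hx hu)]
  have hvx : M.vf U (y (x 0)) = M.vf U x :=
    vf_congr hM (fun u hu => by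
      rcases hu.2.lt_or_eq with h1 | h1
      · exact (hyx (x 0) ⟨hu.1, h1⟩).symm
      · subst h1; exact (e0 _).symm)
  obtain ⟨hxi, C, -, h⟩ := h
  rw [hval, hasDerivAt_iff_isLittleO, Asymptotics.isLittleO_iff]
  intro ε hε
  obtain ⟨d₀, hd₀, h⟩ := h ε hε
  filter_upwards [Metric.closedBall_mem_nhds (x 0) hd₀] with s hs
  rw [Metric.mem_closedBall, Real.dist_eq] at hs
  have e1 := hist_integral_sub_eq_zero hT (hyx s)
  have h1 := (h (y s) (hist_intervalIntegrable_of_eqOn hT hxi (hyx s)) (by rw [e0]; exact hs)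
    (by rw [e1]; exact hd₀.le)).2
  rw [e0, e1, mul_zero, add_zero] at h1
  simp only [hvx, Real.norm_eq_abs, smul_eq_mul]
  rwa [mul_comm (s - x 0)]

theorem tendsto_history_sub_nhdsWithin_Ici {x : ℝ → ℝ} (hT : 0 < M.T) (hx : M.LocInt x) {s₀ : ℝ}
    (hs₀ : 0 ≤ s₀) :
    Tendsto (fun s => ∫ ξ in (-M.T)..0, |x (s + ξ) - x (s₀ + ξ)|) (𝓝[Ici 0] s₀) (𝓝 0) := by
  refine (tendsto_history_sub hT hx hs₀).mono_left ?_
  rw [← nhdsWithin_union]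
  refine nhdsWithin_mono _ fun u hu => ?_
  rcases le_total s₀ u with h | h
  · exact Or.inl h
  · exact Or.inr ⟨hu, h⟩

theorem hist_shift {x : ℝ → ℝ} (hT : 0 < M.T) (hx : M.LocInt x) {t : ℝ} (ht : 0 ≤ t) :
    IntervalIntegrable (fun u => x (t + u)) volume (-M.T) 0 := hx.shift hT ht 0 le_rfl

theorem HasExpansion.tendsto_vf (hM : M.Standing) {U x : ℝ → ℝ} {p t₀ : ℝ} (hx : M.LocInt x)
    (hxc : ContinuousOn x (Ici 0)) (ht₀ : 0 ≤ t₀) (h : M.HasExpansion U (fun u => x (t₀ + u)) p) :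
    Tendsto (fun t => M.vf U (fun u => x (t + u))) (𝓝[Ici 0] t₀)
      (𝓝 (M.vf U (fun u => x (t₀ + u)))) := by
  have hT := hM.T_pos
  obtain ⟨-, C, hC, h⟩ := h
  obtain ⟨d₀, hd₀, h⟩ := h 1 one_pos
  have hη : Tendsto (fun t => |x t - x t₀|) (𝓝[Ici 0] t₀) (𝓝 0) := by
    have : Tendsto (fun t => |x t - x t₀|) (𝓝[Ici 0] t₀) (𝓝 |x t₀ - x t₀|) :=
      (Tendsto.sub_const (hxc t₀ ht₀) _).abs
    simpa using this
  have hD := tendsto_history_sub_nhdsWithin_Ici hT hx ht₀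
  have hb : Tendsto (fun t => (|p| + 1) * |x t - x t₀| +
      C * ∫ ξ in (-M.T)..0, |x (t + ξ) - x (t₀ + ξ)|) (𝓝[Ici 0] t₀) (𝓝 0) := by
    simpa using (hη.const_mul (|p| + 1)).add (hD.const_mul C)
  rw [tendsto_iff_norm_sub_tendsto_zero]
  refine squeeze_zero' (Eventually.of_forall fun t => norm_nonneg _) ?_ hb
  filter_upwards [self_mem_nhdsWithin, hη.eventually (ge_mem_nhds hd₀), hD.eventually (ge_mem_nhds hd₀)]
    with t ht h1 h2
  have h3 := (h (fun u => x (t + u)) (hist_shift hT hx ht) (by simpa using h1) h2).2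
  simp only [add_zero] at h3
  rw [Real.norm_eq_abs]
  have e : M.vf U (fun u => x (t + u)) - M.vf U (fun u => x (t₀ + u)) =
      (M.vf U (fun u => x (t + u)) - M.vf U (fun u => x (t₀ + u)) - p * (x t - x t₀)) +
      p * (x t - x t₀) := by ring
  rw [e]
  refine (abs_add_le _ _).trans ?_
  rw [abs_mul p]
  linarith

/-- The marginal value of capital is continuous along trajectories. -/
theorem tendsto_marginal_value (hM : M.Standing) {U x p : ℝ → ℝ} (hU : IsUtil U) (hx : M.LocInt x)
    (hxc : ContinuousOn x (Ici 0))
    (h : ∀ t, 0 ≤ t → M.HasExpansion U (fun u => x (t + u)) (p t)) {t₀ : ℝ} (ht₀ : 0 ≤ t₀) :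
    Tendsto p (𝓝[Ici 0] t₀) (𝓝 (p t₀)) := by
  have hT := hM.T_pos
  rw [Metric.tendsto_nhds]
  intro ε hε
  obtain ⟨-, C, hC, h₀⟩ := h t₀ ht₀
  set e := ε / 4 with he
  have he0 : 0 < e := by positivity
  obtain ⟨d₀, hd₀, h₀⟩ := h₀ e he0
  -- The increments `±l` of capital at time `t` are tested against the supergradient `p t` and
  -- against the expansion at `t₀`. The total error is `3 * e * l`, so division by `l` leaves `3 * e
  -- < ε`.
  set l := d₀ / 2 with hl
  have hl0 : 0 < l := by positivity
  have hη : Tendsto (fun t => |x t - x t₀|) (𝓝[Ici 0] t₀) (𝓝 0) := by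
    have : Tendsto (fun t => |x t - x t₀|) (𝓝[Ici 0] t₀) (𝓝 |x t₀ - x t₀|) :=
      (Tendsto.sub_const (hxc t₀ ht₀) _).abs
    simpa using this
  have hD := tendsto_history_sub_nhdsWithin_Ici hT hx ht₀
  filter_upwards [self_mem_nhdsWithin, hη.eventually (ge_mem_nhds (half_pos hl0)),
    hD.eventually (ge_mem_nhds hd₀),
    hD.eventually (ge_mem_nhds (by positivity : 0 < e * l / (2 * C + 1)))] with t ht h1 h2 h3
  set D := ∫ ξ in (-M.T)..0, |x (t + ξ) - x (t₀ + ξ)| with hDD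
  have hD0 : 0 ≤ D := intervalIntegral.integral_nonneg (by linarith) fun _ _ => abs_nonneg _
  have hCD : 2 * (C * D) ≤ e * l := by
    have := (le_div_iff₀ (by positivity)).1 h3
    linarith
  have hxt := hist_shift hT hx ht
  have h4 := (h₀ (fun u => x (t + u)) hxt (by simp only [add_zero]; linarith) h2).2
  simp only [add_zero] at h4
  rw [← hDD] at h4
  have hk : ∀ k, |k| = l → p t₀ * k - 3 * e * l ≤ p t * k := by
    intro k hk
    set y : ℝ → ℝ := fun u => if u < 0 then x (t + u) else x t + k with hy
    have hyx : EqOn y (fun u => x (t + u)) (Ico (-M.T) 0) := fun u hu => by simp [hy, hu.2]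
    have e0 : y 0 = x t + k := by simp [hy]
    have e1 : ∫ ξ in (-M.T)..0, |y ξ - x (t₀ + ξ)| = D := by
      refine intervalIntegral.integral_congr_ae ?_
      have hne : ∀ᵐ t : ℝ, t ≠ 0 := by simp [ae_iff, measure_singleton]
      filter_upwards [hne] with u hu0 hu
      rw [uIoc_of_le (by linarith)] at hu
      rw [hyx ⟨hu.1.le, lt_of_le_of_ne hu.2 hu0⟩]
    have h5 : |x t + k - x t₀| ≤ |x t - x t₀| + l := by
      rw [← hk, show x t + k - x t₀ = (x t - x t₀) + k by ring]
      exact abs_add_le _ _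
    obtain ⟨hf, h6⟩ := h₀ y (hist_intervalIntegrable_of_eqOn hT hxt hyx)
      (by simp only [e0, add_zero]; linarith) (by rw [e1]; exact h2)
    simp only [e0, e1, add_zero] at h6
    have h7 := (h t ht).vf_le hM hU hf hyx
    simp only [e0, add_zero] at h7
    have h8 := (abs_le.1 h6).1
    have h9 := (abs_le.1 h4).2
    have h10 := mul_le_mul_of_nonneg_left h5 he0.le
    have h11 := mul_le_mul_of_nonneg_left h1 he0.le
    linarith
  have h5 := hk l (abs_of_pos hl0)
  have h6 := hk (-l) (by rw [abs_neg, abs_of_pos hl0])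
  have h7 : p t₀ - 3 * e ≤ p t := le_of_mul_le_mul_right (by linarith) hl0
  have h8 : p t ≤ p t₀ + 3 * e := le_of_mul_le_mul_right (by linarith) hl0
  rw [Real.dist_eq, abs_lt]
  constructor <;> linarith

/-! ### Marginal plans -/

theorem IsPlan.congr_ctrl {c c' x : ℝ → ℝ} (h : M.IsPlan c x) (h0 : ∀ t, 0 ≤ t → 0 ≤ c' t)
    (hae : ∀ᵐ t, 0 < t → c' t = c t) : M.IsPlan c' x := by
  refine ⟨h0, fun t ht => ?_, h.cont, h.hist, h.pos, fun t ht => ?_⟩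
  · refine (h.ctrl t ht).congr_ae ((ae_restrict_iff' measurableSet_uIoc).2 ?_)
    filter_upwards [hae] with s hs hm
    rw [uIoc_of_le ht] at hm
    exact (hs hm.1).symm
  · rw [h.eqn t ht]
    congr 1
    refine intervalIntegral.integral_congr_ae ?_
    filter_upwards [hae] with s hs hm
    rw [uIoc_of_le ht] at hm
    rw [hs hm.1]

theorem IsOpt.congr_ctrl {U c c' x : ℝ → ℝ} (h : M.IsOpt U c x)
    (h0 : ∀ t, 0 ≤ t → 0 ≤ c' t) (hae : ∀ᵐ t, 0 < t → c' t = c t) : M.IsOpt U c' x := by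
  have e : M.gain U c x =ᵐ[volume.restrict (Ioi 0)] M.gain U c' x := by
    refine (ae_restrict_iff' measurableSet_Ioi).2 ?_
    filter_upwards [hae] with t ht ht0
    simp only [gain, ht ht0]
  refine ⟨h.plan.congr_ctrl h0 hae, h.integrable.congr e, ?_⟩
  rw [← integral_congr_ae e, h.eq]

/-- A plan along which the marginal utility of consumption equals the marginal value of capital at
every time. -/
structure IsMarginalPlan (M : DelayModel) (U c x : ℝ → ℝ) : Prop where
  plan : M.IsPlan c x
  pos : ∀ t, 0 ≤ t → 0 < c t
  expansion : ∀ t, 0 ≤ t → M.HasExpansion U (fun u => x (t + u)) (deriv M.U₁ (c t))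

theorem IsMarginalPlan.shift (hM : M.Standing) {U c x : ℝ → ℝ} (h : M.IsMarginalPlan U c x) {t : ℝ}
    (ht : 0 ≤ t) : M.IsMarginalPlan U (fun u => c (t + u)) (fun u => x (t + u)) := by
  refine ⟨h.plan.shift hM ht, fun s hs => h.pos _ (by linarith), fun s hs => ?_⟩
  have := h.expansion (t + s) (by linarith)
  simpa only [add_assoc] using this

/-- Marginal utility along the plan is the marginal value of capital, which varies continuously.
Strict monotonicity of `U₁'` carries continuity over to the control. -/
theorem IsMarginalPlan.tendsto_ctrl (hM : M.Standing) {U c x : ℝ → ℝ} (hU : IsUtil U)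
    (h : M.IsMarginalPlan U c x) {t₀ : ℝ} (ht₀ : 0 ≤ t₀) :
    Tendsto c (𝓝[Ici 0] t₀) (𝓝 (c t₀)) := by
  have hp := tendsto_marginal_value hM hU h.plan.locInt h.plan.cont h.expansion ht₀
  have hanti := deriv_U₁_strictAnti hM
  have hc0 := h.pos t₀ ht₀
  refine tendsto_order.2 ⟨fun a ha => ?_, fun a ha => ?_⟩
  · rcases le_or_gt a 0 with h1 | h1
    · filter_upwards [self_mem_nhdsWithin] with t ht using h1.trans_lt (h.pos t ht)
    · filter_upwards [self_mem_nhdsWithin,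
        hp.eventually (gt_mem_nhds (hanti (mem_Ioi.2 h1) (mem_Ioi.2 hc0) ha))] with t ht h2
      exact (hanti.lt_iff_gt (mem_Ioi.2 (h.pos t ht)) (mem_Ioi.2 h1)).1 h2
  · filter_upwards [self_mem_nhdsWithin,
      hp.eventually (lt_mem_nhds (hanti (mem_Ioi.2 hc0) (mem_Ioi.2 (hc0.trans ha)) ha))] with t ht h2
    exact (hanti.lt_iff_gt (mem_Ioi.2 (hc0.trans ha)) (mem_Ioi.2 (h.pos t ht))).1 h2

theorem IsOpt.marginal_intervalIntegrable (hM : M.Standing) {U c x : ℝ → ℝ} (hU : IsUtil U)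
    (h : M.IsOpt U c x) {τ : ℝ} (hτ : 0 ≤ τ) :
    IntervalIntegrable (fun t => Real.exp (-M.ρ * t) * deriv M.U₁ (c t)) volume 0 τ := by
  obtain ⟨m, hm, hcm⟩ := h.exists_consumption_lower_bound hM hU τ
  have h1 : Continuous fun k => deriv M.U₁ (max k m) :=
    (deriv_U₁_continuousOn hM).comp_continuous (by fun_prop) fun k =>
      mem_Ioi.2 (lt_max_of_lt_right hm)
  have h2 : AEStronglyMeasurable c (volume.restrict (Ioc 0 τ)) :=
    h.plan.aesm.mono_measure (Measure.restrict_mono Ioc_subset_Ioi_self le_rfl)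
  rw [intervalIntegrable_iff_integrableOn_Ioc_of_le hτ]
  have h3 : IntegrableOn (fun t => Real.exp (-M.ρ * t) * deriv M.U₁ (max (c t) m)) (Ioc 0 τ) := by
    refine Integrable.of_bound ((Continuous.aestronglyMeasurable (by fun_prop)).mul
      (h1.comp_aestronglyMeasurable h2)) (deriv M.U₁ m) ?_
    refine (ae_restrict_iff' measurableSet_Ioc).2 (Eventually.of_forall fun t ht => ?_)
    have h4 : m ≤ max (c t) m := le_max_right _ _
    have h5 : deriv M.U₁ (max (c t) m) ≤ deriv M.U₁ m :=
      (deriv_U₁_strictAnti hM).antitoneOn (mem_Ioi.2 hm) (mem_Ioi.2 (hm.trans_le h4)) h4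
    have h6 := hM.U₁_deriv_pos _ (hm.trans_le h4)
    have h7 : Real.exp (-M.ρ * t) ≤ 1 := Real.exp_le_one_iff.2 (by nlinarith [hM.ρ_pos, ht.1])
    rw [Real.norm_eq_abs, abs_of_nonneg (by positivity)]
    exact (mul_le_of_le_one_left h6.le h7).trans h5
  refine h3.congr ((ae_restrict_iff' measurableSet_Ioc).2 ?_)
  filter_upwards [hcm] with t ht hmem
  simp only [max_eq_left (ht hmem)]

/-- The control of an optimal plan can be modified on a null set so that the marginal utility of
consumption equals the marginal value of capital at every time. -/
theorem IsOpt.exists_isMarginalPlan (hM : M.Standing) {U c x : ℝ → ℝ} (hU : IsUtil U)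
    (h : M.IsOpt U c x) : ∃ c', M.IsMarginalPlan U c' x ∧ M.IsOpt U c' x := by
  have hexp : ∀ t, ∃ p, 0 ≤ t → 0 < p ∧ M.HasExpansion U (fun u => x (t + u)) p ∧
      Tendsto (fun δ => δ⁻¹ * ∫ s in (0 : ℝ)..δ, Real.exp (-M.ρ * s) * deriv M.U₁ (c (t + s)))
        (𝓝[>] 0) (𝓝 p) := by
    intro t
    by_cases ht : 0 ≤ t
    · have ho := h.shift hM hU ht
      obtain ⟨p, C, hC, hlim, he⟩ := ho.exists_expansion hM hU
      have he' : M.HasExpansion U (fun u => x (t + u)) p := ⟨ho.plan.hist, C, hC, he⟩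
      exact ⟨p, fun _ => ⟨he'.pos hM hU ho, he', hlim⟩⟩
    · exact ⟨0, fun h => absurd h ht⟩
  choose p hp using hexp
  have hinv : ∀ t, ∃ k, 0 ≤ t → 0 < k ∧ deriv M.U₁ k = p t := by
    intro t
    by_cases ht : 0 ≤ t
    · obtain ⟨k, hk, hk'⟩ := exists_deriv_U₁_eq hM (hp t ht).1
      exact ⟨k, fun _ => ⟨hk, hk'⟩⟩
    · exact ⟨0, fun h => absurd h ht⟩
  choose c' hc' using hinv
  set g : ℝ → ℝ := fun t => Real.exp (-M.ρ * t) * deriv M.U₁ (c t) with hg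
  have hgi : ∀ {a b : ℝ}, 0 ≤ a → 0 ≤ b → IntervalIntegrable g volume a b := fun ha hb =>
    (h.marginal_intervalIntegrable hM hU ha).symm.trans (h.marginal_intervalIntegrable hM hU hb)
  -- By Lebesgue differentiation the limit of the means of marginal utility started at `t` is `U₁'(c
  -- t)` at almost every `t`. There the prescribed control `c' t` must equal `c t`.
  have hleb : ∀ᵐ t, 0 < t → HasDerivAt (fun y => ∫ s in (0 : ℝ)..y, g s) (g t) t := by
    have h1 := ae_all_iff.2 fun n : ℕ =>
      (hgi le_rfl (Nat.cast_nonneg n : (0 : ℝ) ≤ n)).ae_hasDerivAt_integral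
    filter_upwards [h1] with t ht ht0
    obtain ⟨n, hn⟩ := exists_nat_ge t
    refine ht n ?_ 0 left_mem_uIcc
    rw [uIcc_of_le (Nat.cast_nonneg n)]
    exact ⟨ht0.le, hn⟩
  have hcm : ∀ᵐ t, 0 < t → 0 < c t := by
    have h1 := ae_all_iff.2 fun n : ℕ =>
      (h.exists_consumption_lower_bound hM hU n).choose_spec.2
    filter_upwards [h1] with t ht ht0
    obtain ⟨n, hn⟩ := exists_nat_ge t
    exact (h.exists_consumption_lower_bound hM hU n).choose_spec.1.trans_le (ht n ⟨ht0, hn⟩)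
  have hae : ∀ᵐ t, 0 < t → c' t = c t := by
    filter_upwards [hleb, hcm] with t ht hct ht0
    obtain ⟨hk, hk'⟩ := hc' t ht0.le
    have h1 : Tendsto (fun δ => δ⁻¹ * ∫ s in (0 : ℝ)..δ,
        Real.exp (-M.ρ * s) * deriv M.U₁ (c (t + s))) (𝓝[>] 0)
        (𝓝 (Real.exp (M.ρ * t) * g t)) := by
      refine ((ht ht0).tendsto_slope_zero_right.const_mul (Real.exp (M.ρ * t))).congr' ?_
      filter_upwards [self_mem_nhdsWithin] with δ hδ
      have hδ' : 0 < δ := hδ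
      rw [intervalIntegral.integral_interval_sub_left (hgi le_rfl (by linarith))
        (hgi le_rfl ht0.le)]
      have e : ∫ s in t..(t + δ), g s = ∫ s in (0 : ℝ)..δ, g (t + s) := by
        rw [intervalIntegral.integral_comp_add_left g t, add_zero]
      rw [e, smul_eq_mul, mul_left_comm, ← intervalIntegral.integral_const_mul]
      congr 1
      refine intervalIntegral.integral_congr fun s _ => ?_
      simp only [hg]
      rw [← mul_assoc, ← Real.exp_add]
      ring_nf
    have h2 := tendsto_nhds_unique (hp t ht0.le).2.2 h1
    have h3 : Real.exp (M.ρ * t) * g t = deriv M.U₁ (c t) := by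
      simp only [hg]
      rw [← mul_assoc, ← Real.exp_add]
      simp
    exact (deriv_U₁_strictAnti hM).injOn (mem_Ioi.2 hk) (mem_Ioi.2 (hct ht0))
      (by rw [hk', h2, h3])
  have h0 : ∀ t, 0 ≤ t → 0 ≤ c' t := fun t ht => (hc' t ht).1.le
  refine ⟨c', ⟨h.plan.congr_ctrl h0 hae, fun t ht => (hc' t ht).1, fun t ht => ?_⟩,
    h.congr_ctrl h0 hae⟩
  rw [(hc' t ht).2]
  exact (hp t ht).2.1

end DelayModel

/-! ### Verification: marginal plans are optimal -/

theorem eventually_abs_integral_le {f : ℝ → ℝ} (hf : Tendsto f (𝓝[>] 0) (𝓝 0)) {ε : ℝ}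
    (hε : 0 < ε) : ∀ᶠ h in 𝓝[>] (0 : ℝ), ∀ s ∈ Icc 0 h, |∫ u in (0 : ℝ)..s, f u| ≤ ε * s := by
  have h1 : ∀ᶠ u in 𝓝[>] (0 : ℝ), |f u| < ε := by
    have := Metric.tendsto_nhds.1 hf ε hε
    simpa [Real.dist_eq] using this
  obtain ⟨η, hη, hη'⟩ := mem_nhdsGT_iff_exists_Ioo_subset.1 h1
  filter_upwards [Ioo_mem_nhdsGT hη] with h hh s hs
  have := intervalIntegral.norm_integral_le_of_norm_le_const (f := f) (C := ε) (a := 0) (b := s)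
    fun u hu => by
      rw [uIoc_of_le hs.1] at hu
      exact (hη' ⟨hu.1, hu.2.trans_lt (hs.2.trans_lt hh.2)⟩ : |f u| < ε).le
  simpa [abs_of_nonneg hs.1] using this

namespace DelayModel

variable {M : DelayModel}

theorem HasExpansion.unique (hM : M.Standing) {U x : ℝ → ℝ} {p q : ℝ} (h : M.HasExpansion U x p)
    (h' : M.HasExpansion U x q) : p = q :=
  (h.hasDerivAt hM (eqOn_refl x _)).unique (h'.hasDerivAt hM (eqOn_refl x _))

/-- Shifts of an optimal plan are optimal, and consumption and state are bounded below on an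
interval that covers all the windows concerned. The merging estimate with `δ = T` thus holds at all
times in `[0, 1]` with the same constants. -/
theorem IsOpt.exists_lipschitz_below (hM : M.Standing) {U c x : ℝ → ℝ} (hU : IsUtil U)
    (h : M.IsOpt U c x) : ∃ C d₁, 0 ≤ C ∧ 0 < d₁ ∧ ∀ t ∈ Icc (0 : ℝ) 1, ∀ y : ℝ → ℝ,
      IntervalIntegrable y volume (-M.T) 0 → |y 0 - x t| ≤ d₁ →
      (∫ ξ in (-M.T)..0, |y ξ - x (t + ξ)|) ≤ d₁ → M.Feas U y ∧
      M.vf U (fun u => x (t + u)) - C * (|y 0 - x t| + ∫ ξ in (-M.T)..0, |y ξ - x (t + ξ)|) ≤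
        M.vf U y := by
  have hT := hM.T_pos
  obtain ⟨m, hm, hcm⟩ := h.exists_consumption_lower_bound hM hU (1 + 2 * M.T)
  obtain ⟨μ, hμ, hxμ⟩ := h.plan.exists_state_lower_bound (by linarith : 0 ≤ 1 + M.T)
  obtain ⟨C, hC, hest⟩ := exists_merge_estimate hM hU hm hμ
  obtain ⟨d₁, hd₁, hest⟩ := hest M.T hT le_rfl
  have hm2 := half_pos hm
  set b := deriv M.U₁ (m / 2) with hb
  have hb0 : 0 < b := hM.U₁_deriv_pos _ hm2
  refine ⟨b + C * M.T + C, min d₁ (M.T * (m / 2)), by positivity, by positivity, ?_⟩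
  intro t ht y hy hd hD
  have ho := h.shift hM hU ht.1
  have hct : ∀ᵐ s, s ∈ Ioc 0 (2 * M.T) → m ≤ c (t + s) := by
    have hq := (measurePreserving_add_left volume t).quasiMeasurePreserving.ae hcm
    filter_upwards [hq] with s hs hmem
    exact hs ⟨by linarith [hmem.1, ht.1], by linarith [hmem.2, ht.2]⟩
  have key := hest _ _ y ho.plan ho.integrable hct
    (fun s hs => hxμ _ ⟨by linarith [hs.1, ht.1], by linarith [hs.2, ht.2]⟩) hy
    (by simp only [add_zero]; exact hd.trans (min_le_left _ _)) (hD.trans (min_le_left _ _))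
  simp only [add_zero] at key
  refine ⟨key.1, le_trans ?_ key.2⟩
  rw [ho.eq]
  set d := y 0 - x t with hdd
  set D := ∫ ξ in (-M.T)..0, |y ξ - x (t + ξ)| with hDD
  have hD0 : 0 ≤ D := intervalIntegral.integral_nonneg (by linarith) fun _ _ => abs_nonneg _
  have hsm : |d| / M.T ≤ m / 2 := by
    rw [div_le_iff₀ hT, mul_comm]
    exact hd.trans (min_le_right _ _)
  have hi := ho.plan.discount_U₁_diff_intervalIntegrable hM (d / M.T) hT.le
  have h1 : ∫ _s in (0 : ℝ)..M.T, -(b * (|d| / M.T)) ≤ ∫ s in (0 : ℝ)..M.T, Real.exp (-M.ρ * s) *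
      (M.U₁ (max (c (t + s) + d / M.T) 0) - M.U₁ (c (t + s))) := by
    refine intervalIntegral.integral_mono_ae_restrict hT.le intervalIntegrable_const hi ?_
    have hne : ∀ᵐ s : ℝ, s ≠ 0 := by simp [ae_iff, measure_singleton]
    refine (ae_restrict_iff' measurableSet_Icc).2 ?_
    filter_upwards [hct, hne] with s hs hs0 hmem
    have hs' : 0 < s := lt_of_le_of_ne hmem.1 hs0.symm
    have h2 := hs ⟨hs', by linarith [hmem.2]⟩
    have h3 : |d / M.T| ≤ |d| / M.T := by rw [abs_div, abs_of_pos hT]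
    have h4 := abs_le.1 h3
    have h5 : max (c (t + s) + d / M.T) 0 = c (t + s) + d / M.T := max_eq_left (by linarith)
    have h6 := U₁_sub_le_of_le hM (p := c (t + s)) (q := c (t + s) + d / M.T)
      (E := |d| / M.T) hm2 (by linarith) (by linarith) (by positivity) (by linarith)
    rw [h5]
    have hex : 0 < Real.exp (-M.ρ * s) := Real.exp_pos _
    have hex1 : Real.exp (-M.ρ * s) ≤ 1 := Real.exp_le_one_iff.2 (by nlinarith [hM.ρ_pos])
    have h7 := mul_le_mul_of_nonneg_left h6 hex.le
    have h8 : Real.exp (-M.ρ * s) * (b * (|d| / M.T)) ≤ b * (|d| / M.T) :=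
      mul_le_of_le_one_left (by positivity) hex1
    linarith
  rw [intervalIntegral.integral_const, smul_eq_mul, sub_zero] at h1
  have h2 : M.T * -(b * (|d| / M.T)) = -(b * |d|) := by field_simp
  rw [h2] at h1
  have h3 : 0 ≤ C * |d| := by positivity
  have h4 : 0 ≤ (b + C * M.T) * D := by positivity
  linarith

/-- Following a marginal plan loses at most `o(h)` on `[0, h]`. -/
theorem IsMarginalPlan.eventually_vf_le (hM : M.Standing) {U c x : ℝ → ℝ} (hU : IsUtil U)
    (hnot : ¬ IntegrableAtFilter U (𝓝[>] 0) volume) (h : M.IsMarginalPlan U c x) {ε : ℝ}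
    (hε : 0 < ε) : ∀ᶠ t in 𝓝[>] (0 : ℝ), M.vf U x - ε * t ≤
      (∫ s in (0 : ℝ)..t, M.gain U c x s) + Real.exp (-M.ρ * t) * M.vf U (fun u => x (t + u)) := by
  have hT := hM.T_pos
  have hexp0 := h.expansion 0 le_rfl
  simp only [zero_add] at hexp0
  obtain ⟨c₀, y, hyx, hopt₀⟩ := hexp0.feas.exists_isOpt hM hU hnot
  obtain ⟨c', hmar, hopt⟩ := hopt₀.exists_isMarginalPlan hM hU
  have hexp0' := hmar.expansion 0 le_rfl
  simp only [zero_add] at hexp0'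
  -- Both initial marginal utilities are the derivative of the value at the common state, and `U₁'`
  -- is injective.
  have hc0 : c' 0 = c 0 := (deriv_U₁_strictAnti hM).injOn (mem_Ioi.2 (hmar.pos 0 le_rfl))
    (mem_Ioi.2 (h.pos 0 le_rfl)) (hexp0'.unique hM (hexp0.congr hM hyx))
  have hy0 : y 0 = x 0 := hyx ⟨by linarith, le_rfl⟩
  have hle : 𝓝[>] (0 : ℝ) ≤ 𝓝[Ici 0] 0 := nhdsWithin_mono _ Ioi_subset_Ici_self
  have hc := (h.tendsto_ctrl hM hU le_rfl).mono_left hle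
  have hc' := (hmar.tendsto_ctrl hM hU le_rfl).mono_left hle
  rw [hc0] at hc'
  have hx := (h.plan.cont 0 (mem_Ici.2 le_rfl)).tendsto.mono_left hle
  have hy := (hmar.plan.cont 0 (mem_Ici.2 le_rfl)).tendsto.mono_left hle
  rw [hy0] at hy
  have hdx := (h.plan.drift_cont hM 0 (mem_Ici.2 le_rfl)).tendsto.mono_left hle
  have hdy := (hmar.plan.drift_cont hM 0 (mem_Ici.2 le_rfl)).tendsto.mono_left hle
  have hdd : M.drift y 0 = M.drift x 0 := drift_congr_ae hM hy0
    (Eventually.of_forall fun u hu => hyx ⟨by linarith [hu.1], hu.2.le⟩)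
  rw [hdd] at hdy
  have hrate : Tendsto (fun s => (M.drift x s - c s) - (M.drift y s - c' s)) (𝓝[>] 0) (𝓝 0) := by
    simpa using (hdx.sub hc).sub (hdy.sub hc')
  have hU₁ : ContinuousAt M.U₁ (c 0) := (U₁_hasDerivAt hM (h.pos 0 le_rfl)).continuousAt
  have hUc : ContinuousAt U (x 0) := hU.cont.continuousAt (Ioi_mem_nhds (h.plan.pos 0 le_rfl))
  have hgain : Tendsto (fun s => M.gain U c x s - M.gain U c' y s) (𝓝[>] 0) (𝓝 0) := by
    have h1 : Tendsto (fun s => (M.U₁ (c s) + U (x s)) - (M.U₁ (c' s) + U (y s))) (𝓝[>] 0)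
        (𝓝 0) := by
      simpa using ((hU₁.tendsto.comp hc).add (hUc.tendsto.comp hx)).sub
        ((hU₁.tendsto.comp hc').add (hUc.tendsto.comp hy))
    have h2 : Tendsto (fun s => Real.exp (-M.ρ * s)) (𝓝[>] 0) (𝓝 (Real.exp (-M.ρ * 0))) :=
      (Continuous.tendsto (by fun_prop) 0).mono_left nhdsWithin_le_nhds
    have h3 := h2.mul h1
    rw [mul_zero] at h3
    refine h3.congr fun s => ?_
    simp only [gain]; ring
  obtain ⟨C, d₁, hC, hd₁, hlip⟩ := hopt.exists_lipschitz_below hM hU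
  -- On `[0, t]` the gains differ by at most `e * t` in the integral. The capital and the history at
  -- time `t` differ by at most `e * t` each and cost at most the factor `C`.
  set e := ε / (1 + 2 * C) with he
  have he0 : 0 < e := by positivity
  have hsmall : ∀ᶠ t in 𝓝[>] (0 : ℝ), t < min 1 (d₁ / e) :=
    nhdsWithin_le_nhds (gt_mem_nhds (by positivity))
  filter_upwards [eventually_abs_integral_le hrate he0, eventually_abs_integral_le hgain he0, hsmall,
    self_mem_nhdsWithin] with t h1 h2 h3 ht
  have ht0 : 0 < t := ht
  have ht1 : t ≤ 1 := (h3.trans_le (min_le_left _ _)).le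
  have hed : e * t ≤ d₁ := by
    have := (lt_div_iff₀ he0).1 (h3.trans_le (min_le_right _ _))
    linarith
  have hxy : ∀ s ∈ Icc 0 t, |x s - y s| ≤ e * t := by
    intro s hs
    have h4 := h1 s hs
    rw [intervalIntegral.integral_sub (h.plan.rate_int hM le_rfl hs.1)
      (hmar.plan.rate_int hM le_rfl hs.1), ← h.plan.sub_eq hM le_rfl hs.1,
      ← hmar.plan.sub_eq hM le_rfl hs.1, hy0, sub_sub_sub_cancel_right] at h4
    exact h4.trans (mul_le_mul_of_nonneg_left hs.2 he0.le)
  have hl := h.plan.locInt.sub hmar.plan.locInt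
  have hD : ∫ ξ in (-M.T)..0, |x (t + ξ) - y (t + ξ)| ≤ e * t := by
    have hi : ∀ {a b : ℝ}, -M.T ≤ a → a ≤ b →
        IntervalIntegrable (fun u => |x u - y u|) volume a b := fun ha hab =>
      (hl.mono_interval hT ha hab).abs
    rw [intervalIntegral.integral_comp_add_left (fun u => |x u - y u|) t, add_zero]
    have h4 : ∫ u in (t + -M.T)..t, |x u - y u| ≤ ∫ u in (-M.T)..t, |x u - y u| := by
      rw [← intervalIntegral.integral_add_adjacent_intervals
        (hi le_rfl (by linarith : -M.T ≤ t + -M.T)) (hi (by linarith) (by linarith))]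
      have := intervalIntegral.integral_nonneg (by linarith : -M.T ≤ t + -M.T) (μ := volume)
        fun u _ => abs_nonneg (x u - y u)
      linarith
    refine h4.trans ?_
    rw [← intervalIntegral.integral_add_adjacent_intervals (hi le_rfl (by linarith : -M.T ≤ 0))
      (hi (by linarith) ht0.le)]
    have h5 : ∫ u in (-M.T)..0, |x u - y u| = 0 := by
      have : ∫ u in (-M.T)..0, |x u - y u| = ∫ _u in (-M.T)..0, (0 : ℝ) := by
        refine intervalIntegral.integral_congr fun u hu => ?_
        rw [uIcc_of_le (by linarith)] at hu
        simp [hyx hu]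
      simpa using this
    have h6 : ∫ u in (0 : ℝ)..t, |x u - y u| ≤ ∫ _u in (0 : ℝ)..t, e * t :=
      intervalIntegral.integral_mono_on ht0.le (hi (by linarith) ht0.le) intervalIntegrable_const hxy
    rw [intervalIntegral.integral_const, smul_eq_mul, sub_zero] at h6
    rw [h5, zero_add]
    exact h6.trans (mul_le_of_le_one_left (by positivity) ht1)
  have hxt := hxy t ⟨ht0.le, le_rfl⟩
  have key := (hlip t ⟨ht0.le, ht1⟩ (fun u => x (t + u)) (hist_shift hT h.plan.locInt ht0.le)
    (by simp only [add_zero]; linarith) (hD.trans hed)).2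
  simp only [add_zero] at key
  have h4 : C * (|x t - y t| + ∫ ξ in (-M.T)..0, |x (t + ξ) - y (t + ξ)|) ≤ C * (e * t + e * t) :=
    mul_le_mul_of_nonneg_left (add_le_add hxt hD) hC
  have h5 := h2 t ⟨ht0.le, le_rfl⟩
  rw [intervalIntegral.integral_sub (h.plan.gain_intervalIntegrable hM hU le_rfl ht0.le)
    (hmar.plan.gain_intervalIntegrable hM hU le_rfl ht0.le)] at h5
  have h6 := hopt.dpp hM hU ht0.le
  rw [← vf_congr hM hyx] at h6
  have hex : 0 < Real.exp (-M.ρ * t) := Real.exp_pos _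
  have hex1 : Real.exp (-M.ρ * t) ≤ 1 := Real.exp_le_one_iff.2 (by nlinarith [hM.ρ_pos])
  have h7 : M.vf U (fun u => y (t + u)) - C * (e * t + e * t) ≤ M.vf U (fun u => x (t + u)) := by
    linarith
  have h8 := mul_le_mul_of_nonneg_left h7 hex.le
  have h9 : Real.exp (-M.ρ * t) * (C * (e * t + e * t)) ≤ C * (e * t + e * t) :=
    mul_le_of_le_one_left (by positivity) hex1
  have h10 : ε * t = (1 + 2 * C) * e * t := by
    rw [he, mul_div_cancel₀ _ (by positivity : (1 + 2 * C) ≠ 0)]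
  have h11 := (abs_le.1 h5).1
  rw [h10]
  linarith

/-- The gap between `B * exp (-ρ t)` and the gain is nonnegative with bounded partial integrals,
hence integrable. The discounted term then disappears as `t → ∞`. -/
theorem IsPlan.integrableOn_and_le_integral (hM : M.Standing) {U c x : ℝ → ℝ} (hU : IsUtil U)
    (h : M.IsPlan c x) {v B' : ℝ}
    (hv : ∀ t, 0 ≤ t → v - B' * Real.exp (-M.ρ * t) ≤ ∫ s in (0 : ℝ)..t, M.gain U c x s) :
    IntegrableOn (M.gain U c x) (Ioi 0) ∧ v ≤ ∫ t in Ioi 0, M.gain U c x t := by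
  obtain ⟨B, hB⟩ := hM.U₁_bdd
  set k : ℝ → ℝ := fun t => B * Real.exp (-M.ρ * t) with hk
  have hki : IntegrableOn k (Ioi 0) := (discount_integrable hM).const_mul B
  have hkt : ∀ t, 0 ≤ t → IntervalIntegrable k volume 0 t := fun t _ =>
    Continuous.intervalIntegrable (by fun_prop) _ _
  have hgt := fun t (ht : 0 ≤ t) => h.gain_intervalIntegrable hM hU le_rfl ht
  have hexp : Tendsto (fun t => Real.exp (-M.ρ * t)) atTop (𝓝 0) := by
    refine Real.tendsto_exp_atBot.comp ?_
    exact tendsto_id.const_mul_atTop_of_neg (by linarith [hM.ρ_pos])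
  have hw0 : ∀ t, 0 ≤ t → 0 ≤ k t - M.gain U c x t := fun t ht =>
    sub_nonneg.2 (h.gain_le hU hB ht)
  have hk0 : ∀ t, 0 ≤ k t := fun t =>
    mul_nonneg ((abs_nonneg _).trans (hB 0 le_rfl)) (Real.exp_pos _).le
  have hwi : IntegrableOn (fun t => k t - M.gain U c x t) (Ioi 0) := by
    refine integrableOn_Ioi_of_intervalIntegral_norm_bounded
      ((∫ t in Ioi 0, k t) - v + |B'|) 0 (fun t : ℝ => ?_) tendsto_id ?_
    · rcases le_or_gt 0 t with ht | ht
      · exact (intervalIntegrable_iff_integrableOn_Ioc_of_le ht).1 ((hkt t ht).sub (hgt t ht))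
      · rw [id, Ioc_eq_empty (by linarith)]; exact integrableOn_empty
    · filter_upwards [eventually_ge_atTop 0] with t ht
      have e : ∫ s in (0 : ℝ)..t, ‖k s - M.gain U c x s‖ =
          ∫ s in (0 : ℝ)..t, (k s - M.gain U c x s) := by
        refine intervalIntegral.integral_congr fun s hs => ?_
        rw [uIcc_of_le ht] at hs
        exact Real.norm_of_nonneg (hw0 s hs.1)
      simp only [id]
      rw [e, intervalIntegral.integral_sub (hkt t ht) (hgt t ht)]
      have h1 := hv t ht
      have h2 : ∫ s in (0 : ℝ)..t, k s ≤ ∫ s in Ioi 0, k s := by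
        rw [intervalIntegral.integral_of_le ht]
        exact setIntegral_mono_set hki (Eventually.of_forall hk0)
          (LE.le.eventuallyLE Ioc_subset_Ioi_self)
      have h3 : Real.exp (-M.ρ * t) ≤ 1 := Real.exp_le_one_iff.2 (by nlinarith [hM.ρ_pos])
      have h4 : B' * Real.exp (-M.ρ * t) ≤ |B'| :=
        (mul_le_mul_of_nonneg_right (le_abs_self _) (Real.exp_pos _).le).trans
          (mul_le_of_le_one_right (abs_nonneg _) h3)
      linarith
  have hi : IntegrableOn (M.gain U c x) (Ioi 0) := by
    have := hki.sub hwi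
    refine this.congr (Eventually.of_forall fun t => ?_)
    simp
  refine ⟨hi, ?_⟩
  have h1 := intervalIntegral_tendsto_integral_Ioi 0 hi tendsto_id
  have h2 : Tendsto (fun t => v - B' * Real.exp (-M.ρ * t)) atTop (𝓝 v) := by
    simpa using tendsto_const_nhds.sub (hexp.const_mul B')
  exact le_of_tendsto_of_tendsto h2 h1 ((eventually_ge_atTop 0).mono fun t ht => hv t ht)

/-- Verification: marginal plans are optimal. -/
theorem IsMarginalPlan.isOpt (hM : M.Standing) {U c x : ℝ → ℝ} (hU : IsUtil U)
    (hnot : ¬ IntegrableAtFilter U (𝓝[>] 0) volume) (h : M.IsMarginalPlan U c x) :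
    M.IsOpt U c x := by
  have hT := hM.T_pos
  obtain ⟨B, hB0, hB⟩ := exists_vf_le hM
  have hgi : ∀ {a b : ℝ}, 0 ≤ a → 0 ≤ b → IntervalIntegrable (M.gain U c x) volume a b :=
    fun ha hb => h.plan.gain_intervalIntegrable hM hU ha hb
  -- Accumulated gain plus discounted continuation value. It suffices that `v` does not decrease;
  -- values are bounded above by `B`, so the continuation term costs at most `B * exp (-ρ t)`.
  set v : ℝ → ℝ := fun t => (∫ s in (0 : ℝ)..t, M.gain U c x s) +
    Real.exp (-M.ρ * t) * M.vf U (fun u => x (t + u)) with hv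
  have hv0 : v 0 = M.vf U x := by simp [hv]
  have hmono : ∀ b, 0 ≤ b → v 0 ≤ v b := by
    intro b hb
    have hcont : ContinuousOn v (Icc 0 b) := by
      refine ContinuousOn.add ?_ (ContinuousOn.mul (Continuous.continuousOn (by fun_prop)) ?_)
      · have := intervalIntegral.continuousOn_primitive_interval (a := 0) (b := b) (μ := volume)
          (f := M.gain U c x) (by
            rw [uIcc_of_le hb, integrableOn_Icc_iff_integrableOn_Ioc]
            exact (intervalIntegrable_iff_integrableOn_Ioc_of_le hb).1 (hgi le_rfl hb))
        rwa [uIcc_of_le hb] at this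
      · intro t ht
        exact ((h.expansion t ht.1).tendsto_vf hM h.plan.locInt h.plan.cont ht.1).mono_left
          (nhdsWithin_mono _ Icc_subset_Ici_self)
    -- At every time the one-step estimate for the shifted plan shows that right difference
    -- quotients of `-v` are eventually below any `r > 0`. With continuity of `v` this gives
    -- monotonicity, and no derivative of the value in the history is needed.
    have key := image_le_of_liminf_slope_right_le_deriv_boundary (f := fun t => -v t) (a := 0)
      (b := b) (B := fun _ => -v 0) (B' := fun _ => 0) hcont.neg le_rfl continuousOn_const
      (fun t _ => hasDerivWithinAt_const _ _ _) (fun t ht r hr => ?_) (right_mem_Icc.2 hb)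
    · simpa using key
    · refine Eventually.frequently ?_
      have hs := (h.shift hM ht.1).eventually_vf_le hM hU hnot (half_pos hr)
      have htr : Tendsto (fun z => z - t) (𝓝[>] t) (𝓝[>] 0) := by
        refine tendsto_nhdsWithin_iff.2 ⟨?_, ?_⟩
        · have : Tendsto (fun z => z - t) (𝓝[>] t) (𝓝 (t - t)) :=
            (Continuous.tendsto (by fun_prop) t).mono_left nhdsWithin_le_nhds
          simpa using this
        · filter_upwards [self_mem_nhdsWithin] with z hz
          exact mem_Ioi.2 (sub_pos.2 hz)
      filter_upwards [htr.eventually hs, self_mem_nhdsWithin] with z hz hzt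
      have hzt' : t < z := hzt
      have hz0 : 0 ≤ z := ht.1.trans hzt'.le
      have e1 : ∫ s in (0 : ℝ)..(z - t), M.gain U (fun u => c (t + u)) (fun u => x (t + u)) s =
          Real.exp (M.ρ * t) * ∫ s in t..z, M.gain U c x s := by
        simp only [gain_shift]
        rw [intervalIntegral.integral_const_mul,
          intervalIntegral.integral_comp_add_left (M.gain U c x) t]
        simp
      have e2 : (fun u => x (t + (z - t + u))) = fun u => x (z + u) := by
        ext u; congr 1; ring
      rw [e1, e2] at hz
      have hex : 0 < Real.exp (-M.ρ * t) := Real.exp_pos _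
      have hex1 : Real.exp (-M.ρ * t) ≤ 1 := Real.exp_le_one_iff.2 (by nlinarith [hM.ρ_pos, ht.1])
      have h1 := mul_le_mul_of_nonneg_left hz hex.le
      have e3 : Real.exp (-M.ρ * t) * Real.exp (M.ρ * t) = 1 := by rw [← Real.exp_add]; simp
      have e4 : Real.exp (-M.ρ * t) * Real.exp (-M.ρ * (z - t)) = Real.exp (-M.ρ * z) := by
        rw [← Real.exp_add]; congr 1; ring
      rw [mul_add, ← mul_assoc, ← mul_assoc, e3, e4, one_mul] at h1
      have h2 : v z - v t = (∫ s in t..z, M.gain U c x s) +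
          Real.exp (-M.ρ * z) * M.vf U (fun u => x (z + u)) -
          Real.exp (-M.ρ * t) * M.vf U (fun u => x (t + u)) := by
        simp only [hv]
        rw [← intervalIntegral.integral_interval_sub_left (hgi le_rfl hz0) (hgi le_rfl ht.1)]
        ring
      have h3 : Real.exp (-M.ρ * t) * (r / 2 * (z - t)) ≤ r / 2 * (z - t) :=
        mul_le_of_le_one_left (mul_nonneg (half_pos hr).le (by linarith)) hex1
      have h4 : 0 < r / 2 * (z - t) := mul_pos (half_pos hr) (by linarith)
      rw [slope_def_field, div_lt_iff₀ (by linarith)]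
      linarith
  have hle : ∀ t, 0 ≤ t → M.vf U x - B * Real.exp (-M.ρ * t) ≤
      ∫ s in (0 : ℝ)..t, M.gain U c x s := by
    intro t ht
    have h1 := hmono t ht
    rw [hv0] at h1
    have h2 := hB U _ hU (h.expansion t ht).feas
    have h3 := mul_le_mul_of_nonneg_left h2 (Real.exp_pos (-M.ρ * t)).le
    simp only [hv] at h1
    linarith
  obtain ⟨hi, hge⟩ := h.plan.integrableOn_and_le_integral hM hU hle
  exact ⟨h.plan, hi, le_antisymm (h.plan.le_vf hM hU (eqOn_refl x _) hi) hge⟩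

/-! ### Feedback strategies as marginal plans -/

/-- Uniqueness of the maximizer: if it differed from `k`, strict concavity would put the midpoint
above the tangent at `k`. -/
theorem eq_of_forall_le_of_deriv_U₁_eq (hM : M.Standing) {p k κ : ℝ} (hk : 0 < k)
    (hkp : deriv M.U₁ k = p) (hκ : 0 ≤ κ)
    (hmax : ∀ l, 0 ≤ l → M.U₁ l - l * p ≤ M.U₁ κ - κ * p) : κ = k := by
  by_contra hne
  have h1 := (U₁_strictConcave hM).2 (mem_Ici.2 hκ) (mem_Ici.2 hk.le) hne
    (by norm_num : (0 : ℝ) < 1 / 2) (by norm_num : (0 : ℝ) < 1 / 2) (by norm_num)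
  simp only [smul_eq_mul] at h1
  have h2 := U₁_sub_le hM hk (by positivity : 0 ≤ 1 / 2 * κ + 1 / 2 * k)
  have h3 := hmax k hk.le
  rw [hkp] at h2
  linarith

theorem intervalIntegrable_of_memLp (hM : M.Standing) {η₁ : ℝ → ℝ}
    (hη : MemLp η₁ 2 (volume.restrict (Icc (-M.T) 0))) :
    IntervalIntegrable η₁ volume (-M.T) 0 := by
  have h : IntegrableOn η₁ (Icc (-M.T) 0) := hη.integrable (by norm_num)
  rw [intervalIntegrable_iff_integrableOn_Ioc_of_le (by linarith [hM.T_pos])]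
  exact h.mono_set Ioc_subset_Icc_self

theorem memLp_history (hM : M.Standing) {η₁ x : ℝ → ℝ}
    (hη : MemLp η₁ 2 (volume.restrict (Icc (-M.T) 0))) (hx : ContinuousOn x (Ici 0))
    (hxη : EqOn x η₁ (Ico (-M.T) 0)) {t : ℝ} (ht : 0 ≤ t) :
    MemLp (fun u => x (t + u)) 2 (volume.restrict (Icc (-M.T) 0)) := by
  have hT := hM.T_pos
  have h1 : MemLp ((Ico (-M.T) 0).indicator η₁) 2 :=
    (memLp_indicator_iff_restrict measurableSet_Ico).2
      (hη.mono_measure (Measure.restrict_mono Ico_subset_Icc_self le_rfl))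
  have hxt : ContinuousOn x (Icc 0 t) := hx.mono fun u hu => hu.1
  obtain ⟨C, hC⟩ := isCompact_Icc.exists_bound_of_continuousOn hxt
  have h2 : MemLp ((Icc 0 t).indicator x) 2 := by
    refine (memLp_indicator_iff_restrict measurableSet_Icc).2 ?_
    have : IsFiniteMeasure (volume.restrict (Icc 0 t)) := ⟨by simp⟩
    exact MemLp.of_bound (hxt.aestronglyMeasurable measurableSet_Icc) C
      ((ae_restrict_iff' measurableSet_Icc).2 (Eventually.of_forall hC))
  have h3 : MemLp (fun u => ((Ico (-M.T) 0).indicator η₁ + (Icc 0 t).indicator x) (t + u)) 2 :=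
    (h1.add h2).comp_measurePreserving (measurePreserving_add_left volume t)
  refine (memLp_congr_ae ?_).1 (h3.restrict (Icc (-M.T) 0))
  refine (ae_restrict_iff' measurableSet_Icc).2 (Eventually.of_forall fun u hu => ?_)
  simp only [Pi.add_apply]
  rcases lt_or_ge (t + u) 0 with h4 | h4
  · have hm : t + u ∈ Ico (-M.T) 0 := ⟨by linarith [hu.1], h4⟩
    rw [indicator_of_mem hm, indicator_of_notMem (fun hh : t + u ∈ Icc 0 t => absurd hh.1 (not_le.2 h4)),
      add_zero, hxη hm]
  · rw [indicator_of_notMem (fun hh : t + u ∈ Ico (-M.T) 0 => absurd hh.2 (not_lt.2 h4)),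
      indicator_of_mem (show t + u ∈ Icc 0 t from ⟨h4, by linarith [hu.2]⟩), zero_add]

/-- Each visited state has finite value, hence an optimal plan and an expansion. The derivative in
the feedback map is therefore the positive slope of the expansion, and the argmax is the solution of
the first order condition. -/
theorem IsFeedbackStrategy.isMarginalPlan (hM : M.Standing) {U η₁ c x : ℝ → ℝ} {η₀ : ℝ}
    (hU : IsUtil U) (hnot : ¬ IntegrableAtFilter U (𝓝[>] 0) volume)
    (hη : IntervalIntegrable η₁ volume (-M.T) 0) (h : M.IsFeedbackStrategy U η₀ η₁ c x) :
    M.IsMarginalPlan U c x := by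
  obtain ⟨hplan, -, -⟩ := (isAdmissible_iff hM hη).1 h.1
  have key : ∀ t, 0 ≤ t → 0 < c t ∧ M.HasExpansion U (fun u => x (t + u)) (deriv M.U₁ (c t)) := by
    intro t ht
    obtain ⟨⟨-, hval⟩, p, hp, hκ, hmax⟩ := h.2 t ht
    have e0 : x (t + 0) = x t := by simp
    have hf : M.Feas U (fun u => x (t + u)) :=
      (feas_iff hM hU (hist_shift hM.T_pos hplan.locInt ht)).2 (by rw [e0]; exact hval)
    obtain ⟨d, y, hy, hopt⟩ := hf.exists_isOpt hM hU hnot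
    obtain ⟨q, C, hC, -, he⟩ := hopt.exists_expansion hM hU
    have hq : M.HasExpansion U y q := ⟨hopt.plan.hist, C, hC, he⟩
    have hq' : M.HasExpansion U (fun u => x (t + u)) q := hq.congr hM fun u hu => (hy hu).symm
    have hpq : p = q := by
      refine hp.unique ?_
      have := hq'.hasDerivAt hM (eqOn_refl _ _)
      rwa [e0] at this
    obtain ⟨k, hk, hkp⟩ := exists_deriv_U₁_eq hM (hq.pos hM hU hopt)
    have hck : c t = k := eq_of_forall_le_of_deriv_U₁_eq hM hk (hkp.trans hpq.symm) hκ hmax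
    rw [hck, hkp]
    exact ⟨hk, hq'⟩
  exact ⟨hplan, fun t ht => (key t ht).1, fun t ht => (key t ht).2⟩

/-- The tangent inequality for `U₁` at `c t` is exactly the maximum property that defines the
feedback map. -/
theorem IsMarginalPlan.isFeedbackStrategy (hM : M.Standing) {U η₁ c x : ℝ → ℝ} {η₀ : ℝ}
    (hU : IsUtil U) (hη : MemLp η₁ 2 (volume.restrict (Icc (-M.T) 0)))
    (h : M.IsMarginalPlan U c x) (h0 : x 0 = η₀) (hx : EqOn x η₁ (Ico (-M.T) 0)) :
    M.IsFeedbackStrategy U η₀ η₁ c x := by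
  refine ⟨(isAdmissible_iff hM (intervalIntegrable_of_memLp hM hη)).2 ⟨h.plan, h0, hx⟩,
    fun t ht => ?_⟩
  have he := h.expansion t ht
  have e0 : x (t + 0) = x t := by simp
  refine ⟨⟨⟨h.plan.pos t ht, memLp_history hM hη h.plan.cont hx ht⟩, ?_⟩, deriv M.U₁ (c t), ?_,
    (h.pos t ht).le, fun k hk => ?_⟩
  · have := (feas_iff hM hU (hist_shift hM.T_pos h.plan.locInt ht)).1 he.feas
    rwa [e0] at this
  · have := he.hasDerivAt hM (eqOn_refl _ _)
    rwa [e0] at this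
  · have := U₁_sub_le hM (h.pos t ht) hk
    linarith

/-! ### Removing the state utility -/

theorem vf_mono (hM : M.Standing) {U U' x : ℝ → ℝ} (hU : IsUtil U) (hU' : IsUtil U')
    (hle : ∀ k, 0 < k → U k ≤ U' k) (hx : M.Feas U x) : M.vf U x ≤ M.vf U' x := by
  refine le_of_forall_pos_le_add fun ε hε => ?_
  obtain ⟨c, y, hp, hyx, hi, hlt⟩ := hx.exists_lt hM hU hε
  have := (hp.le_vf_of_le hM hU' hyx hi (Eventually.of_forall fun t ht =>
    mul_le_mul_of_nonneg_left (add_le_add le_rfl (hle _ (hp.pos t ht.le)))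
      (Real.exp_pos _).le)).2
  linarith

/-- A state of finite value is the initial state of a plan whose trajectory is bounded away from
zero. -/
theorem Feas.exists_plan_bounded_below (hM : M.Standing) {U x : ℝ → ℝ} (hx : M.Feas U x) :
    ∃ c y μ, M.IsPlan c y ∧ EqOn y x (Icc (-M.T) 0) ∧ 0 < μ ∧ ∀ t, 0 ≤ t → μ ≤ y t := by
  have hT := hM.T_pos
  obtain ⟨c, z, hp, hzx, -⟩ := hx
  -- The trajectory is frozen at time `T`, the first time at which the window contains no part of
  -- the prescribed history before zero, where no sign is assumed.
  obtain ⟨d, y, hd, hyz, hyc, -, -⟩ := hp.exists_stopped hM le_rfl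
  obtain ⟨μ, hμ, hμz⟩ := hp.exists_state_lower_bound hT.le
  refine ⟨d, y, μ, hd, fun u hu => (hyz u (by linarith [hu.2])).trans (hzx hu), hμ, fun t ht => ?_⟩
  rcases le_total t M.T with h1 | h1
  · rw [hyz t h1]; exact hμz t ⟨ht, h1⟩
  · rw [hyc t h1]; exact hμz M.T ⟨hT.le, le_rfl⟩

theorem IsPlan.gain_integrableOn_of_bounded_below (hM : M.Standing) {U c x : ℝ → ℝ}
    (hU : IsUtil U) (h : M.IsPlan c x) {μ : ℝ} (hμ : 0 < μ) (hx : ∀ t, 0 ≤ t → μ ≤ x t) :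
    IntegrableOn (M.gain U c x) (Ioi 0) := by
  obtain ⟨B, hB⟩ := hM.U₁_bdd
  refine h.integrableOn_of_le hM hU (g := fun t => (-B + U μ) * Real.exp (-M.ρ * t))
    ((discount_integrable hM).const_mul _) (Eventually.of_forall fun t ht => ?_)
  have h1 : U μ ≤ U (x t) := hU.mono (mem_Ioi.2 hμ) (mem_Ioi.2 (h.pos t ht.le)) (hx t ht.le)
  have h2 := (abs_le.1 (hB _ (h.nonneg t ht.le))).1
  rw [mul_comm]
  exact mul_le_mul_of_nonneg_left (add_le_add h2 h1) (Real.exp_pos _).le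

/-- The domain does not depend on the state utility: along a trajectory bounded away from zero every
state utility is bounded. -/
theorem Feas.of_feas (hM : M.Standing) {U U' x : ℝ → ℝ} (hU' : IsUtil U') (hx : M.Feas U x) :
    M.Feas U' x := by
  obtain ⟨c, y, μ, hp, hyx, hμ, hy⟩ := hx.exists_plan_bounded_below hM
  exact ⟨c, y, hp, hyx, hp.gain_integrableOn_of_bounded_below hM hU' hμ hy⟩

theorem isUtil_zero : IsUtil fun _ => 0 :=
  ⟨continuousOn_const, fun _ _ _ _ _ => le_rfl, concaveOn_const 0 (convex_Ioi 0), fun _ _ => le_rfl⟩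

/-- Almost optimal plans for the problem without state utility can be taken bounded away from
zero. -/
theorem exists_bounded_below_almost_optimal (hM : M.Standing) {x : ℝ → ℝ}
    (hx : M.Feas (fun _ => 0) x) {ε : ℝ} (hε : 0 < ε) :
    ∃ c y μ, M.IsPlan c y ∧ EqOn y x (Icc (-M.T) 0) ∧ 0 < μ ∧ (∀ t, 0 ≤ t → μ ≤ y t) ∧
      IntegrableOn (M.gain (fun _ => 0) c y) (Ioi 0) ∧
      M.vf (fun _ => 0) x - ε < ∫ t in Ioi 0, M.gain (fun _ => 0) c y t := by
  obtain ⟨c, y, hp, hyx, hi, hlt⟩ := hx.exists_lt hM isUtil_zero (half_pos hε)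
  obtain ⟨d, z, μ, hq, hzx, hμ, hz⟩ := hx.exists_plan_bounded_below hM
  have hj := hq.gain_integrableOn_of_bounded_below hM isUtil_zero hμ hz
  set V := ∫ t in Ioi 0, M.gain (fun _ => 0) c y t with hV
  set G := ∫ t in Ioi 0, M.gain (fun _ => 0) d z t with hG
  -- A weight this small on the safe plan costs at most `ε / 2` of payoff, and the mixed trajectory
  -- stays above `l * μ`.
  set l := min 1 (ε / 2 / (|V - G| + 1)) with hl
  have hl0 : 0 < l := by positivity
  have hl1 : l ≤ 1 := min_le_left _ _
  obtain ⟨e, hr, he⟩ := hp.mix hM hq (sub_nonneg.2 hl1) hl0.le (by ring)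
  have hbelow : ∀ t, 0 ≤ t → l * μ ≤ (1 - l) * y t + l * z t := by
    intro t ht
    have h1 := mul_le_mul_of_nonneg_left (hz t ht) hl0.le
    have h2 := mul_nonneg (sub_nonneg.2 hl1) (hp.pos t ht).le
    linarith
  have hint := hr.gain_integrableOn_of_bounded_below hM isUtil_zero (mul_pos hl0 hμ) hbelow
  refine ⟨e, _, l * μ, hr, fun u hu => ?_, mul_pos hl0 hμ, hbelow, hint, ?_⟩
  · simp only [hyx hu, hzx hu]; ring
  · have h1 : (1 - l) * V + l * G ≤
        ∫ t in Ioi 0, M.gain (fun _ => 0) e (fun u => (1 - l) * y u + l * z u) t := by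
      rw [hV, hG, ← integral_const_mul, ← integral_const_mul,
        ← integral_add (hi.const_mul _) (hj.const_mul _)]
      refine setIntegral_mono_on ((hi.const_mul _).add (hj.const_mul _)) hint measurableSet_Ioi
        fun t ht => ?_
      have ht' : 0 < t := ht
      exact gain_concave hM isUtil_zero hp hq (sub_nonneg.2 hl1) hl0.le (by ring) ht'.le
        (he t ht'.le)
    have h2 : l * (|V - G| + 1) ≤ ε / 2 := (le_div_iff₀ (by positivity)).1 (min_le_right _ _)
    have h3 : l * (V - G) ≤ l * |V - G| := mul_le_mul_of_nonneg_left (le_abs_self _) hl0.le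
    linarith

end DelayModel

open DelayModel in
theorem StateUtilities.isUtil {U₂ : ℕ → ℝ → ℝ} (h : StateUtilities U₂) {n : ℕ} (hn : 1 ≤ n) :
    IsUtil (U₂ n) := by
  refine ⟨h.cont n hn, h.mono n hn, h.concave n hn, fun x hx => ?_⟩
  rw [← h.vanish n hn (max x (1 / n)) (le_max_right _ _)]
  exact h.mono n hn (mem_Ioi.2 hx) (mem_Ioi.2 (lt_max_of_lt_left hx)) (le_max_left _ _)

open DelayModel in
-- Along an almost optimal plan with state at least `μ`, the state utility vanishes once `1 / n ≤
-- μ`. The same plan then has the same payoff in the `n`-th problem.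
theorem StateUtilities.exists_lt_vf {M : DelayModel} (hM : M.Standing) {U₂ : ℕ → ℝ → ℝ}
    (h : StateUtilities U₂) {x : ℝ → ℝ} (hx : M.Feas (fun _ => 0) x) {ε : ℝ} (hε : 0 < ε) :
    ∃ N : ℕ, 1 ≤ N ∧ ∀ n, N ≤ n → M.vf (fun _ => 0) x - ε < M.vf (U₂ n) x := by
  obtain ⟨c, y, μ, hp, hyx, hμ, hy, hi, hlt⟩ := exists_bounded_below_almost_optimal hM hx hε
  obtain ⟨N, hN⟩ := exists_nat_ge (1 / μ)
  have hN0 : (0 : ℝ) < N := (by positivity : 0 < 1 / μ).trans_le hN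
  have hN1 : 1 ≤ N := Nat.cast_pos.1 hN0
  refine ⟨N, hN1, fun n hn => hlt.trans_le ?_⟩
  have hnN : (N : ℝ) ≤ n := Nat.cast_le.2 hn
  have hn0 : (0 : ℝ) < n := hN0.trans_le hnN
  have hnμ : 1 / (n : ℝ) ≤ μ := by
    rw [div_le_iff₀ hn0]
    have := (div_le_iff₀ hμ).1 hN
    nlinarith
  refine (hp.le_vf_of_le hM (h.isUtil (hN1.trans hn)) hyx hi (Eventually.of_forall fun t ht => ?_)).2
  simp only [gain]
  rw [h.vanish n (hN1.trans hn) (y t) (hnμ.trans (hy t ht.le))]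

theorem proposition4p3 (M : DelayModel) (hM : M.Standing)
    (U₂ : ℕ → ℝ → ℝ) (hU₂ : StateUtilities U₂)
    (η₀ : ℝ) (η₁ : ℝ → ℝ) (hη : M.InDomain (fun _ => 0) η₀ η₁) :
    Tendsto (fun n => M.value (U₂ n) η₀ η₁) atTop (𝓝 (M.value (fun _ => 0) η₀ η₁)) ∧
    (∀ n, 1 ≤ n →
      (∃ c x : ℝ → ℝ, M.IsFeedbackStrategy (U₂ n) η₀ η₁ c x) ∧
      ∀ c x : ℝ → ℝ, M.IsFeedbackStrategy (U₂ n) η₀ η₁ c x → M.IsOptimal (U₂ n) η₀ η₁ c x) ∧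
    ∀ ε : ℝ, 0 < ε → ∃ N : ℕ, 1 ≤ N ∧ ∀ n, N ≤ n →
      ∀ c x : ℝ → ℝ, M.IsFeedbackStrategy (U₂ n) η₀ η₁ c x →
        M.IsEpsOptimal (fun _ => 0) η₀ η₁ ε c x := by
  have hT := hM.T_pos
  set Z : ℝ → ℝ := fun _ => 0 with hZ
  have hZu : DelayModel.IsUtil Z := DelayModel.isUtil_zero
  have hηi := DelayModel.intervalIntegrable_of_memLp hM hη.1.2
  -- The pair `(η₀, η₁)` is encoded as one function on `[-T, 0]` whose value at `0` is the capital
  -- `η₀`, whatever `η₁` takes there.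
  set x₀ : ℝ → ℝ := fun u => if u < 0 then η₁ u else η₀ with hx₀
  have e0 : x₀ 0 = η₀ := by simp [hx₀]
  have hx₀η : EqOn x₀ η₁ (Ico (-M.T) 0) := fun u hu => by simp [hx₀, hu.2]
  have hval : ∀ U, M.value U η₀ η₁ = M.value U (x₀ 0) x₀ := fun U =>
    DelayModel.value_congr e0 hx₀η
  have hf₀ : M.Feas Z x₀ := (DelayModel.feas_iff hM hZu
    (DelayModel.hist_intervalIntegrable_of_eqOn hT hηi hx₀η)).2 (by rw [← hval]; exact hη.2)
  have hf : ∀ n, 1 ≤ n → M.Feas (U₂ n) x₀ := fun n hn => hf₀.of_feas hM (hU₂.isUtil hn)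
  have hv₀ : M.value Z η₀ η₁ = (M.vf Z x₀ : EReal) := by
    rw [hval, DelayModel.value_eq_vf hM hZu hf₀]
  have hv : ∀ n, 1 ≤ n → M.value (U₂ n) η₀ η₁ = (M.vf (U₂ n) x₀ : EReal) := fun n hn => by
    rw [hval, DelayModel.value_eq_vf hM (hU₂.isUtil hn) (hf n hn)]
  have hopt : ∀ n, 1 ≤ n → ∀ c x, M.IsFeedbackStrategy (U₂ n) η₀ η₁ c x →
      M.IsOpt (U₂ n) c x ∧ EqOn x x₀ (Icc (-M.T) 0) := by
    intro n hn c x h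
    obtain ⟨-, h0, hx⟩ := (DelayModel.isAdmissible_iff hM hηi).1 h.1
    refine ⟨(h.isMarginalPlan hM (hU₂.isUtil hn) (hU₂.not_integrable n hn) hηi).isOpt hM
      (hU₂.isUtil hn) (hU₂.not_integrable n hn), ?_⟩
    exact (DelayModel.eqOn_Icc_iff hM).2 ⟨h0.trans e0.symm, hx.trans hx₀η.symm⟩
  refine ⟨?_, fun n hn => ⟨?_, fun c x h => ?_⟩, fun ε hε => ?_⟩
  · have hreal : Tendsto (fun n => M.vf (U₂ n) x₀) atTop (𝓝 (M.vf Z x₀)) := by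
      rw [Metric.tendsto_atTop]
      intro ε hε
      obtain ⟨N, hN1, hN⟩ := hU₂.exists_lt_vf hM hf₀ hε
      refine ⟨N, fun n hn => ?_⟩
      have h1 := hN n hn
      have h2 := DelayModel.vf_mono hM (hU₂.isUtil (hN1.trans hn)) hZu
        (fun k hk => (hU₂.isUtil (hN1.trans hn)).nonpos k hk) (hf n (hN1.trans hn))
      rw [Real.dist_eq, abs_lt]
      constructor <;> linarith
    rw [hv₀]
    refine ((continuous_coe_real_ereal.tendsto _).comp hreal).congr' ?_
    filter_upwards [eventually_ge_atTop 1] with n hn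
    exact (hv n hn).symm
  · obtain ⟨c, y, hy, ho⟩ := (hf n hn).exists_isOpt hM (hU₂.isUtil hn) (hU₂.not_integrable n hn)
    obtain ⟨c', hm, -⟩ := ho.exists_isMarginalPlan hM (hU₂.isUtil hn)
    obtain ⟨h0, hy'⟩ := (DelayModel.eqOn_Icc_iff hM).1 hy
    exact ⟨c', y, hm.isFeedbackStrategy hM (hU₂.isUtil hn) hη.1.2 (h0.trans e0) (hy'.trans hx₀η)⟩
  · obtain ⟨ho, hx⟩ := hopt n hn c x h
    refine ⟨h.1, ?_⟩
    rw [DelayModel.payoff_eq_integral ho.integrable, ho.eq, hv n hn, DelayModel.vf_congr hM hx]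
  · obtain ⟨N, hN1, hN⟩ := hU₂.exists_lt_vf hM hf₀ hε
    refine ⟨N, hN1, fun n hn c x h => ⟨h.1, ?_⟩⟩
    have hn1 := hN1.trans hn
    obtain ⟨ho, hx⟩ := hopt n hn1 c x h
    -- Dropping a nonpositive state utility can only raise the payoff, so the optimal value of the
    -- `n`-th problem is a lower bound for `J⁰` of its feedback strategy.
    have hle : ∀ t, 0 < t → M.gain (U₂ n) c x t ≤ M.gain Z c x t := fun t ht =>
      mul_le_mul_of_nonneg_left
        (add_le_add le_rfl ((hU₂.isUtil hn1).nonpos _ (ho.plan.pos t ht.le))) (Real.exp_pos _).le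
    have hi := ho.plan.integrableOn_of_le hM hZu ho.integrable (Eventually.of_forall hle)
    rw [DelayModel.payoff_eq_integral hi, hv₀, ← EReal.coe_sub, EReal.coe_lt_coe_iff]
    have h1 := setIntegral_mono_on ho.integrable hi measurableSet_Ioi fun t ht => hle t ht
    rw [ho.eq, ← DelayModel.vf_congr hM hx] at h1
    exact (hN n hn).trans_le h1
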